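/- Let $\omega$ be an exponent of matrix multiplication, i.e. a real number such that two real $k\times k$ matrices can be multiplied in $O(k^{\omega})$ steps on a real-number random access machine (unit-cost arithmetic on reals and index registers); all constants below may depend on $\omega$. There are a single randomized algorithm $P$ on this machine and constants $C, c$ such that the following holds for all $n\ge 1$, all $\epsilon\in(0,1]$ and all $\mathbf{A}\in\mathbb{R}^{n\times n}$ (not necessarily symmetric) with $\|\mathbf{A}\|_\infty=\max_{i,j}|\mathbf{A}_{i,j}|\le 1$, where $P$ is given $n$, $\epsilon$, query access to the entries of $\mathbf{A}$, and independent uniformly random indices from $\{1,\dots,n\}$. 1. (Random principal submatrices, non-adaptive.) There are sizes $k_1,\dots,k_m$, depending only on $n$ and $\epsilon$ and taking at most $C(1+\log(1/\epsilon))$ different values (scales), such that, with $T_j$ the set of indices occurring in the $j$-th of the consecutive blocks of $k_1,\dots,k_m$ random indices, the set of the positions queried by $P$ is $\bigcup_j T_j\times T_j$; the sequence of queries depends only on $n$, $\epsilon$ and the random indices, not on $\mathbf{A}$. 2. (Complexity.) $P$ always halts, after at most $C(1+\log(1/\epsilon))^c\,\epsilon^{-2}$ queries and at most $C(1+\log(1/\epsilon))^c\,\epsilon^{-\omega}$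 steps, i.e. $\tilde O(1/\epsilon^2)$ queries and $\tilde O(1/\epsilon^{\omega})$ time, independently of $n$. 3. (One-sided error, certificate.) $P$ outputs either PSD or Not PSD. If $x^\top\mathbf{A}x\ge 0$ for all $x\in\mathbb{R}^n$, then $P$ always outputs PSD. Whenever $P$ outputs Not PSD, it also outputs one of the sets $T=T_j$, and the principal submatrix $\mathbf{A}_{T\times T}$ is not PSD: $z^\top\mathbf{A}_{T\times T}z<0$ for some $z\in\mathbb{R}^{T}$. 4. (Soundness.) If $x^\top\mathbf{A}x\le-\epsilon n$ for some $x\in\mathbb{R}^n$ with $\|x\|_2\le 1$, then $P$ outputs Not PSD with probability at least $3/4$. -/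

import Mathlib

namespace PSDTest

open Finset

/-! ### A uniform real-number random access machine

The memory has natural-number registers, one-dimensional natural-number arrays, real registers and
two-dimensional real arrays.  Names of registers and arrays are fixed in the program, array indices
are read from registers.  Programs are finite texts with rational constants only; they neither
convert reals to integers nor multiply integers in one step.  Every instruction, every evaluation
of a test, every draw of a random index and every query to the input matrix costs one step. -/

/-- The configuration of the machine, with its three meters: the number of steps made, the number
of random indices drawn, and the list of all queries made (latest first, with repetitions). -/
structure State where
  nreg : ℕ → ℕ
  narr : ℕ → ℕ → ℕ
  rreg : ℕ → ℝ
  rarr : ℕ → ℕ → ℕ → ℝ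
  time : ℕ
  draws : ℕ
  queries : List (ℕ × ℕ)

/-- Unit-cost instructions.  The first argument is the target. -/
inductive Instr where
  /-- `x := c` -/
  | nconst (x c : ℕ)
  /-- `x := y + z` -/
  | nadd (x y z : ℕ)
  /-- `x := max (y - z) 0` -/
  | nsub (x y z : ℕ)
  /-- `x := a[y]` for the natural-number array `a` -/
  | nload (x a y : ℕ)
  /-- `a[y] := x` for the natural-number array `a` -/
  | nstore (a y x : ℕ)
  /-- `r := c` -/
  | rconst (r : ℕ) (c : ℚ)
  | radd (r s t : ℕ)
  | rsub (r s t : ℕ)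
  | rmul (r s t : ℕ)
  /-- `r := s / t`, with result `0` if `t` holds `0` -/
  | rdiv (r s t : ℕ)
  /-- `r := a[x, y]` for the real array `a` -/
  | rload (r a x y : ℕ)
  /-- `a[x, y] := r` for the real array `a` -/
  | rstore (a x y r : ℕ)
  /-- `x :=` the next random index -/
  | draw (x : ℕ)
  /-- `r := A[x, y]` for the input matrix `A`; the position is put on record -/
  | query (r x y : ℕ)

/-- Tests: comparison of two natural-number registers, or of two real registers. -/
inductive Test where
  | nlt (x y : ℕ)
  | rlt (r s : ℕ)

/-- Programs. -/
inductive Prog where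
  | instr (i : Instr)
  | seq (p q : Prog)
  | ite (b : Test) (p q : Prog)
  | while (b : Test) (p : Prog)

/-- One step is charged. -/
def State.tick (s : State) : State := { s with time := s.time + 1 }

/-- Effect of one instruction, for the input matrix `O` and the sequence `ρ` of random indices. -/
noncomputable def Instr.apply (O : ℕ → ℕ → ℝ) (ρ : ℕ → ℕ) (s : State) : Instr → State
  | .nconst x c => { s.tick with nreg := Function.update s.nreg x c }
  | .nadd x y z => { s.tick with nreg := Function.update s.nreg x (s.nreg y + s.nreg z) }
  | .nsub x y z => { s.tick with nreg := Function.update s.nreg x (s.nreg y - s.nreg z) }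
  | .nload x a y => { s.tick with nreg := Function.update s.nreg x (s.narr a (s.nreg y)) }
  | .nstore a y x =>
      { s.tick with
        narr := Function.update s.narr a
          (Function.update (s.narr a) (s.nreg y) (s.nreg x)) }
  | .rconst r c => { s.tick with rreg := Function.update s.rreg r (c : ℝ) }
  | .radd r u t => { s.tick with rreg := Function.update s.rreg r (s.rreg u + s.rreg t) }
  | .rsub r u t => { s.tick with rreg := Function.update s.rreg r (s.rreg u - s.rreg t) }
  | .rmul r u t => { s.tick with rreg := Function.update s.rreg r (s.rreg u * s.rreg t) }
  | .rdiv r u t => { s.tick with rreg := Function.update s.rreg r (s.rreg u / s.rreg t) }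
  | .rload r a x y =>
      { s.tick with rreg := Function.update s.rreg r (s.rarr a (s.nreg x) (s.nreg y)) }
  | .rstore a x y r =>
      { s.tick with
        rarr := Function.update s.rarr a
          (Function.update (s.rarr a) (s.nreg x)
            (Function.update (s.rarr a (s.nreg x)) (s.nreg y) (s.rreg r))) }
  | .draw x =>
      { s.tick with
        nreg := Function.update s.nreg x (ρ s.draws)
        draws := s.draws + 1 }
  | .query r x y =>
      { s.tick with
        rreg := Function.update s.rreg r (O (s.nreg x) (s.nreg y))
        queries := (s.nreg x, s.nreg y) :: s.queries }

/-- The outcome of a test. -/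
def Test.holds (s : State) : Test → Prop
  | .nlt x y => s.nreg x < s.nreg y
  | .rlt r t => s.rreg r < s.rreg t

/-- `Exec O ρ p s s'`: started in `s`, the program `p` halts, and it halts in `s'`. -/
inductive Exec (O : ℕ → ℕ → ℝ) (ρ : ℕ → ℕ) : Prog → State → State → Prop where
  | instr (i : Instr) (s : State) : Exec O ρ (.instr i) s (i.apply O ρ s)
  | seq {p q : Prog} {s s' s'' : State} :
      Exec O ρ p s s' → Exec O ρ q s' s'' → Exec O ρ (.seq p q) s s''
  | ite_true {b : Test} {p q : Prog} {s s' : State} :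
      b.holds s → Exec O ρ p s.tick s' → Exec O ρ (.ite b p q) s s'
  | ite_false {b : Test} {p q : Prog} {s s' : State} :
      ¬ b.holds s → Exec O ρ q s.tick s' → Exec O ρ (.ite b p q) s s'
  | while_true {b : Test} {p : Prog} {s s' s'' : State} :
      b.holds s → Exec O ρ p s.tick s' → Exec O ρ (.while b p) s' s'' →
        Exec O ρ (.while b p) s s''
  | while_false {b : Test} {p : Prog} {s : State} :
      ¬ b.holds s → Exec O ρ (.while b p) s s.tick

/-- The machine is deterministic once the random indices are fixed. -/
theorem Exec.deterministic {O : ℕ → ℕ → ℝ} {ρ : ℕ → ℕ} {p : Prog} {s s₁ s₂ : State}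
    (h₁ : Exec O ρ p s s₁) (h₂ : Exec O ρ p s s₂) : s₁ = s₂ := by
  induction h₁ generalizing s₂ with
  | instr i s => cases h₂; rfl
  | seq _ _ ih₁ ih₂ =>
    cases h₂ with
    | seq k₁ k₂ => cases ih₁ k₁; exact ih₂ k₂
  | ite_true hb _ ih =>
    cases h₂ with
    | ite_true _ k => exact ih k
    | ite_false hb' _ => exact absurd hb hb'
  | ite_false hb _ ih =>
    cases h₂ with
    | ite_true hb' _ => exact absurd hb' hb
    | ite_false _ k => exact ih k
  | while_true hb _ _ ih₁ ih₂ =>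
    cases h₂ with
    | while_true _ k₁ k₂ => cases ih₁ k₁; exact ih₂ k₂
    | while_false hb' => exact absurd hb hb'
  | while_false hb =>
    cases h₂ with
    | while_true hb' _ _ => exact absurd hb' hb
    | while_false _ => rfl

/-! ### Exponents of matrix multiplication -/

/-- The program is purely arithmetical: it draws no random index and makes no query. -/
def Prog.IsArithmetical : Prog → Prop
  | .instr (.draw _) => False
  | .instr (.query _ _ _) => False
  | .instr _ => True
  | .seq p q => p.IsArithmetical ∧ q.IsArithmetical
  | .ite _ p q => p.IsArithmetical ∧ q.IsArithmetical
  | .while _ p => p.IsArithmetical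

/-- Two real `k × k` matrices can be multiplied in `O(k ^ ω)` steps: some arithmetical program,
started with `k` in the register `0` and with the factors in the real arrays `0` and `1` (and with
anything in the rest of the memory), leaves the product in the real array `2`. -/
def IsMatMulExponent (ω : ℝ) : Prop :=
  ∃ (M : Prog) (C : ℝ), M.IsArithmetical ∧
    ∀ (O : ℕ → ℕ → ℝ) (ρ : ℕ → ℕ) (k : ℕ) (s : State), 1 ≤ k → s.nreg 0 = k →
      ∃ s' : State, Exec O ρ M s s' ∧
        (s'.time : ℝ) ≤ s.time + C * (k : ℝ) ^ ω ∧
        ∀ i < k, ∀ j < k, s'.rarr 2 i j = ∑ l ∈ range k, s.rarr 0 i l * s.rarr 1 l j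

/-! ### Testers -/

/-- Nonnegativity of the quadratic form of a square matrix, symmetric or not. -/
def IsPSD {ι : Type} [Fintype ι] (A : Matrix ι ι ℝ) : Prop :=
  ∀ x : ι → ℝ, 0 ≤ x ⬝ᵥ A.mulVec x

/-- The principal submatrix of `A` on the rows and columns in `T`. -/
def principal {n : ℕ} (A : Matrix (Fin n) (Fin n) ℝ) (T : Finset (Fin n)) : Matrix T T ℝ :=
  A.submatrix (fun i => i.1) (fun i => i.1)

/-- Query access to `A` (a query outside of the matrix returns `0`). -/
def oracle {n : ℕ} (A : Matrix (Fin n) (Fin n) ℝ) (i j : ℕ) : ℝ :=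
  if h : i < n ∧ j < n then A ⟨i, h.1⟩ ⟨j, h.2⟩ else 0

/-- The initial state: `n` in the natural-number register `0`, `ε` in the real register `0`, and
`0` everywhere else. -/
noncomputable def init (n : ℕ) (ε : ℝ) : State where
  nreg := Function.update (fun _ => 0) 0 n
  narr := fun _ _ => 0
  rreg := Function.update (fun _ => 0) 0 ε
  rarr := fun _ _ _ => 0
  time := 0
  draws := 0
  queries := []

/-- On the input `(n, ε)`, with query access to `A` and the random indices `ρ`, the program `P`
halts, in the state `s`. -/
def Run (P : Prog) {n : ℕ} (ε : ℝ) (A : Matrix (Fin n) (Fin n) ℝ) (ρ : ℕ → Fin n)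
    (s : State) : Prop :=
  Exec (oracle A) (fun t => (ρ t : ℕ)) P (init n ε) s

/-- The output is `PSD`. -/
def State.SaysPSD (s : State) : Prop := s.nreg 0 = 0

/-- The output is `Not PSD`. -/
def State.SaysNotPSD (s : State) : Prop := s.nreg 0 = 1

/-- The set of indices that is output as a certificate: the first entries of the natural-number
array `0`, as many as the register `1` tells. -/
def State.certificate (s : State) : Finset ℕ := (range (s.nreg 1)).image (s.narr 0)

/-- The law of a sequence of independent uniformly random indices from `Fin n`. -/
noncomputable def uniformIndices (n : ℕ) : MeasureTheory.Measure (ℕ → Fin n) :=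
  MeasureTheory.Measure.infinitePi fun _ => ProbabilityTheory.uniformOn (Set.univ : Set (Fin n))

/-- Consecutive blocks of random indices, of the lengths `k`, starting with the `t`-th index; each
block gives the set of the indices that occur in it. -/
def sampledSets {n : ℕ} (ρ : ℕ → Fin n) : ℕ → List ℕ → List (Finset (Fin n))
  | _, [] => []
  | t, k :: ks => ((range k).image fun a => ρ (t + a)) :: sampledSets ρ (t + k) ks

end PSDTest

/-!
# Testing positive semidefiniteness by random principal submatrices

The program goes through the scales `j = 0, …, J`, with `2 ^ J` of order `1 / ε`.  At the scale `j`
it draws a number of blocks of `k = 2 * 2 ^ j` random indices, of order `J * 4 ^ (J - j)`, and for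
each block queries the matrix `E` of the entries on these indices, with repetitions.  All scales
then make about the same number of queries, and as the exponent `ω` is at least `2`
(`two_le_of_matMul`), no scale costs more than the last one, where `k` is of order `1 / ε`.

**The test of a block.**  For entries in `[-1, 1]` the symmetric matrix
`G = 1 - (E + Eᵀ) / (2k)` has its eigenvalues in `[0, 1]` if `E` is positive semidefinite, and then
every power of `G` has a trace of at most `k` (`trace_shifted_pow_le`).  If the form of `E` takes a
value less than `-δ` on the unit sphere, then `G` has an eigenvalue above `1 + δ / k`, and the trace
of `G ^ 2 ^ N` exceeds `k` as soon as `2 ^ N` is at least `k ^ 2 / δ` (`lt_trace_shifted_pow`).  So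
the test compares one trace with `k`, after `O(log (1 / ε))` multiplications of matrices; it never
rejects a positive semidefinite matrix.

**Why some block is rejected.**  Let `B` be symmetric with entries in `[-1, 1]`, and let `x` be a
unit eigenvector for an eigenvalue `-lam ≤ -ε n` (`exists_eigenvector_le`).  Remove the large
coordinates of `x`.  If little mass is lost, then for about `n / lam` random indices `i` the vector
`∑ v i • e i` of the remaining coordinates has a value of the form whose mean is negative and
comparable to the root of its second moment, so that it is negative with a definite probability
(`le_avg_isNegativeOn_of_light`).  Otherwise one of the `J + 1` dyadic levels of large coordinates
carries a mass of order `1 / J`.  If `c` is an index of that level, then `θ • e c + ∑ v i • e i`,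
with the sum over the random indices of the block, does the same, because the entry `c` of `B v`,
for the vector `v` of the remaining coordinates, is close to `-lam * x c`
(`le_avg_isNegativeOn_cons`); and since each index of the level carries only little mass, the level
has so many elements that a block hits it with a probability of order `1 / (J * 4 ^ (J - j))`.  Both
cases are combined in `exists_scale`, and `le_uniformIndices_detects` draws the conclusion for the
whole sequence of blocks.  It applies `exists_scale` to half the symmetric part of the input matrix,
moved by a multiple of `ε` (`symmShift`), which gives the negative directions the margin `δ` that
the test needs.

**The program.**  Runs are analysed by a Hoare logic with a bound on the number of steps
(`Triple`), with frame conditions (`Prog.Local`, `Agree`): nothing is known about the program `M`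
for matrix multiplication but the registers and arrays that its text can change.  All of these are
less than a bound `B`, and the tester keeps its own data from `B` on:

* index registers: `B`, `B + 1` scratch, `B + 2`, `B + 3` loop counters, `B + 5` the constant `1`,
  `B + 6` the size of the present block, `B + 7` the flag for a rejection, `B + 8` the size of the
  block that was rejected;
* real registers: `B`, `B + 1` scratch, `B + 2` the trace, `B + 4` the exponent `2 ^ i` reached by
  squaring, `B + 5` the constant `1`, `B + 6` the size of the present block, `B + 10` the number of
  blocks done at the present scale, `B + 11` the scale `j`, `B + 12` the number `J + 1`, `B + 13`
  the product `ε * 2 ^ i` in the search for `J`, `B + 14` the number `ε`, `B + 15` the number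
  `2 ^ J`, `B + 16` the constant `32`, `B + 17` the bound for the exponent, `B + 18` the number of
  blocks at the present scale;
* index arrays: `B + 1` the present block, `B + 2` the block that was rejected;
* real arrays: `B` the entries queried for the present block; the powers of `G` are in array `2`.
-/

namespace PSDTest

open Finset Matrix

/-! ### Deciding semidefiniteness by repeated squaring -/

lemma dotProduct_transpose_mulVec_self {ι : Type*} [Fintype ι] (B : Matrix ι ι ℝ) (x : ι → ℝ) :
    x ⬝ᵥ Bᵀ *ᵥ x = x ⬝ᵥ B *ᵥ x := by
  rw [Matrix.mulVec_transpose, dotProduct_comm, ← Matrix.dotProduct_mulVec]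

lemma dotProduct_mulVec_eq_sum {ι : Type*} [Fintype ι] (B : Matrix ι ι ℝ) (x y : ι → ℝ) :
    x ⬝ᵥ B *ᵥ y = ∑ i, ∑ j, x i * B i j * y j := by
  simp only [dotProduct, mulVec, Finset.mul_sum, mul_assoc]

lemma abs_dotProduct_mulVec_le {ι : Type*} [Fintype ι] (B : Matrix ι ι ℝ)
    (hB : ∀ i j, |B i j| ≤ 1) (x : ι → ℝ) : |x ⬝ᵥ B *ᵥ x| ≤ (∑ i, |x i|) ^ 2 := by
  rw [dotProduct_mulVec_eq_sum, sq, Finset.sum_mul_sum]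
  refine (Finset.abs_sum_le_sum_abs _ _).trans (Finset.sum_le_sum fun i _ => ?_)
  refine (Finset.abs_sum_le_sum_abs _ _).trans (Finset.sum_le_sum fun j _ => ?_)
  rw [abs_mul, abs_mul]
  have h := mul_le_mul_of_nonneg_left (hB i j) (mul_nonneg (abs_nonneg (x i)) (abs_nonneg (x j)))
  nlinarith

/-- The matrix `1 - (B + Bᵀ) / (2k)`.  For entries of `B` in `[-1, 1]`, its eigenvalues are in
`[0, 1]` if `B` is positive semidefinite, and one of them exceeds `1` otherwise. -/
noncomputable def shifted {k : ℕ} (B : Matrix (Fin k) (Fin k) ℝ) : Matrix (Fin k) (Fin k) ℝ :=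
  1 - (1 / (2 * (k : ℝ))) • (B + Bᵀ)

lemma shifted_transpose {k : ℕ} (B : Matrix (Fin k) (Fin k) ℝ) : (shifted B)ᵀ = shifted B := by
  simp [shifted, add_comm]

lemma dotProduct_shifted {k : ℕ} (B : Matrix (Fin k) (Fin k) ℝ) (x : Fin k → ℝ) :
    x ⬝ᵥ shifted B *ᵥ x = x ⬝ᵥ x - (x ⬝ᵥ B *ᵥ x) / k := by
  rw [shifted, sub_mulVec, one_mulVec, smul_mulVec, add_mulVec, dotProduct_sub, dotProduct_smul,
    dotProduct_add, dotProduct_transpose_mulVec_self, smul_eq_mul]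
  rcases eq_or_ne (k : ℝ) 0 with h | h
  · simp [h]
  · field_simp
    ring

lemma posSemidef_of_quad {ι : Type*} [Fintype ι] {C : Matrix ι ι ℝ} (hC : Cᵀ = C)
    (h : ∀ x, 0 ≤ x ⬝ᵥ C *ᵥ x) : C.PosSemidef :=
  PosSemidef.of_dotProduct_mulVec_nonneg (by simpa [IsHermitian] using hC) (by simpa using h)

/-- Squaring preserves `0 ≤ C ≤ 1`. -/
lemma posSemidef_sq_and_one_sub_sq {ι : Type*} [Fintype ι] [DecidableEq ι] {C : Matrix ι ι ℝ}
    (h₀ : C.PosSemidef) (h₁ : (1 - C).PosSemidef) :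
    (C ^ 2).PosSemidef ∧ (1 - C ^ 2).PosSemidef := by
  refine ⟨h₀.pow 2, ?_⟩
  have e₀ := h₀.conjTranspose_mul_mul_same (1 - C)
  have e₁ := h₁.conjTranspose_mul_mul_same C
  rw [h₁.1.eq] at e₀
  rw [h₀.1.eq] at e₁
  convert h₁.add (e₀.add e₁) using 1
  noncomm_ring

/-- Positive semidefinite matrices pass the trace test, whatever the number of squarings. -/
lemma trace_shifted_pow_le {k : ℕ} (B : Matrix (Fin k) (Fin k) ℝ) (hk : 1 ≤ k)
    (hB : ∀ i j, |B i j| ≤ 1) (h : IsPSD B) (N : ℕ) : (shifted B ^ 2 ^ N).trace ≤ k := by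
  have hk' : (0 : ℝ) < k := by exact_mod_cast hk
  have bound (x : Fin k → ℝ) : x ⬝ᵥ B *ᵥ x ≤ k * (x ⬝ᵥ x) := by
    refine (le_abs_self _).trans ((abs_dotProduct_mulVec_le B hB x).trans ?_)
    have := sq_sum_le_card_mul_sum_sq (s := (univ : Finset (Fin k))) (f := fun i => |x i|)
    simpa [dotProduct, ← sq] using this
  have h₁ : (1 - shifted B).PosSemidef := by
    refine posSemidef_of_quad (by simp [shifted_transpose]) fun x => ?_
    rw [sub_mulVec, one_mulVec, dotProduct_sub, dotProduct_shifted]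
    have := div_nonneg (h x) hk'.le
    linarith
  have h₀ : (shifted B).PosSemidef := by
    refine posSemidef_of_quad (shifted_transpose B) fun x => ?_
    rw [dotProduct_shifted, sub_nonneg, div_le_iff₀ hk']
    linarith [bound x]
  have key : (shifted B ^ 2 ^ N).PosSemidef ∧ (1 - shifted B ^ 2 ^ N).PosSemidef := by
    induction N with
    | zero => simpa using ⟨h₀, h₁⟩
    | succ N ih =>
      rw [pow_succ, pow_mul]
      exact posSemidef_sq_and_one_sub_sq ih.1 ih.2
  have := key.2.trace_nonneg
  rw [trace_sub, trace_one, Fintype.card_fin] at this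
  linarith

lemma dotProduct_self_mulVec_le_trace {ι : Type*} [Fintype ι] [DecidableEq ι] {G : Matrix ι ι ℝ}
    (hG : Gᵀ = G) (z : ι → ℝ) : (G *ᵥ z) ⬝ᵥ (G *ᵥ z) ≤ (G ^ 2).trace * (z ⬝ᵥ z) := by
  have : (G ^ 2).trace = ∑ i, ∑ j, G i j ^ 2 := by
    rw [sq, trace]
    refine Finset.sum_congr rfl fun i _ => ?_
    rw [diag_apply, mul_apply]
    refine Finset.sum_congr rfl fun j _ => ?_
    rw [sq]
    congr 1
    exact congrFun (congrFun hG i) j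
  rw [this, dotProduct, Finset.sum_mul]
  refine Finset.sum_le_sum fun i _ => ?_
  rw [← sq]
  have := Finset.sum_mul_sq_le_sq_mul_sq univ (G i) z
  simpa [mulVec, dotProduct, ← sq] using this

/-- A direction on which the form of `B` is at most `-δ` makes the trace test fail after enough
squarings, because `(1 + δ / k) ^ (2 ^ N)` exceeds `k`. -/
lemma lt_trace_shifted_pow {k : ℕ} (B : Matrix (Fin k) (Fin k) ℝ) (z : Fin k → ℝ) (δ : ℝ)
    (hδ : 0 < δ) (hz : z ⬝ᵥ B *ᵥ z < -(δ * (z ⬝ᵥ z))) (N : ℕ) (hN : (k : ℝ) ^ 2 ≤ δ * 2 ^ (N + 1)) :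
    (k : ℝ) < (shifted B ^ 2 ^ (N + 1)).trace := by
  have hz0 : 0 < z ⬝ᵥ z := by
    have hnn : 0 ≤ z ⬝ᵥ z := Finset.sum_nonneg fun i _ => mul_self_nonneg (z i)
    rcases hnn.lt_or_eq with h | h
    · exact h
    · have : z = 0 := by
        funext i
        have := (Finset.sum_eq_zero_iff_of_nonneg (fun i _ => mul_self_nonneg (z i))).1 h.symm i
          (mem_univ _)
        simpa using this
      simp [this] at hz
  have hk : 0 < (k : ℝ) := by
    rcases Nat.eq_zero_or_pos k with rfl | h
    · simp [dotProduct] at hz0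
    · exact_mod_cast h
  have sym (j : ℕ) : (shifted B ^ j)ᵀ = shifted B ^ j := by
    rw [transpose_pow, shifted_transpose]
  have sq_quad (G : Matrix (Fin k) (Fin k) ℝ) (hG : Gᵀ = G) :
      z ⬝ᵥ (G ^ 2) *ᵥ z = (G *ᵥ z) ⬝ᵥ (G *ᵥ z) := by
    rw [sq, ← mulVec_mulVec, dotProduct_mulVec, ← mulVec_transpose, hG]
  have key (j : ℕ) : (1 + δ / k) ^ 2 ^ j * (z ⬝ᵥ z) ≤ z ⬝ᵥ (shifted B ^ 2 ^ j) *ᵥ z := by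
    induction j with
    | zero =>
      rw [pow_zero, pow_one, pow_one, dotProduct_shifted]
      have : (z ⬝ᵥ B *ᵥ z) / k ≤ -(δ * (z ⬝ᵥ z)) / k := by gcongr
      have e : (1 + δ / k) * (z ⬝ᵥ z) = z ⬝ᵥ z - -(δ * (z ⬝ᵥ z)) / k := by ring
      linarith
    | succ j ih =>
      set G := shifted B ^ 2 ^ j
      have hcs : (z ⬝ᵥ G *ᵥ z) ^ 2 ≤ (z ⬝ᵥ z) * ((G *ᵥ z) ⬝ᵥ (G *ᵥ z)) := by
        have := Finset.sum_mul_sq_le_sq_mul_sq univ z (G *ᵥ z)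
        simpa [dotProduct, ← sq] using this
      have h0 : 0 ≤ (1 + δ / k) ^ 2 ^ j * (z ⬝ᵥ z) := by positivity
      have h2 := pow_le_pow_left₀ h0 ih 2
      rw [pow_succ 2 j, pow_mul, pow_mul, sq_quad G (sym _)]
      refine le_of_mul_le_mul_left ?_ hz0
      calc (z ⬝ᵥ z) * (((1 + δ / k) ^ 2 ^ j) ^ 2 * (z ⬝ᵥ z))
          = ((1 + δ / k) ^ 2 ^ j * (z ⬝ᵥ z)) ^ 2 := by ring
        _ ≤ _ := h2.trans hcs
  have h1 := key (N + 1)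
  rw [pow_succ 2 N, pow_mul (shifted B), sq_quad _ (sym _)] at h1
  have h2 := le_of_mul_le_mul_right (h1.trans (dotProduct_self_mulVec_le_trace (sym _) z)) hz0
  rw [← pow_mul, ← pow_succ] at h2
  refine lt_of_lt_of_le ?_ h2
  have h3 := one_add_mul_le_pow (a := δ / k) (by have : 0 < δ / k := by positivity
                                                 linarith) (2 ^ (N + 1))
  refine lt_of_lt_of_le ?_ h3
  have : (k : ℝ) ≤ (2 ^ (N + 1) : ℕ) * (δ / k) := by
    rw [← mul_div_assoc, le_div_iff₀ hk]
    push_cast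
    nlinarith
  linarith

/-! ### Averages over lists of independent uniform samples -/

section Average

variable {ι : Type*} [Fintype ι]

/-- The average of `F` over all lists of `k` elements of `ι`, i.e. its expectation for `k`
independent uniform samples. -/
noncomputable def avg : ℕ → (List ι → ℝ) → ℝ
  | 0, F => F []
  | k + 1, F => (∑ j, avg k fun l => F (j :: l)) / Fintype.card ι

lemma avg_succ (k : ℕ) (F : List ι → ℝ) :
    avg (k + 1) F = (∑ j, avg k fun l => F (j :: l)) / Fintype.card ι := rfl

lemma avg_mono (k : ℕ) {F G : List ι → ℝ} (h : ∀ l, l.length = k → F l ≤ G l) :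
    avg k F ≤ avg k G := by
  induction k generalizing F G with
  | zero => exact h [] rfl
  | succ k ih =>
    rw [avg_succ, avg_succ]
    gcongr with j
    exact ih fun l hl => h _ (by simp [hl])

lemma avg_congr (k : ℕ) {F G : List ι → ℝ} (h : ∀ l, l.length = k → F l = G l) :
    avg k F = avg k G :=
  le_antisymm (avg_mono k fun l hl => (h l hl).le) (avg_mono k fun l hl => (h l hl).ge)

lemma avg_add (k : ℕ) (F G : List ι → ℝ) : avg k (fun l => F l + G l) = avg k F + avg k G := by
  induction k generalizing F G with
  | zero => rfl
  | succ k ih => simp only [avg_succ, ih, Finset.sum_add_distrib, add_div]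

lemma avg_const_mul (k : ℕ) (c : ℝ) (F : List ι → ℝ) :
    avg k (fun l => c * F l) = c * avg k F := by
  induction k generalizing F with
  | zero => rfl
  | succ k ih => simp only [avg_succ, ih, ← Finset.mul_sum, mul_div_assoc]

lemma avg_mul_const (k : ℕ) (c : ℝ) (F : List ι → ℝ) :
    avg k (fun l => F l * c) = avg k F * c := by
  simp only [mul_comm _ c, avg_const_mul]

lemma avg_sum {κ : Type*} (s : Finset κ) (k : ℕ) (F : κ → List ι → ℝ) :
    avg k (fun l => ∑ i ∈ s, F i l) = ∑ i ∈ s, avg k (F i) := by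
  classical
  induction s using Finset.induction_on with
  | empty => simpa using avg_const_mul k 0 (fun _ => 0)
  | insert a s ha ih => simp only [Finset.sum_insert ha, avg_add, ih]

lemma avg_append (k m : ℕ) (F : List ι → ℝ) :
    avg (k + m) F = avg k fun l => avg m fun l' => F (l ++ l') := by
  induction k generalizing F with
  | zero => simp [avg]
  | succ k ih => rw [Nat.succ_add, avg_succ, avg_succ]; simp only [ih, List.cons_append]

lemma avg_const [Nonempty ι] (k : ℕ) (c : ℝ) : avg k (fun _ : List ι => c) = c := by
  induction k with
  | zero => rfl
  | succ k ih =>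
    have : (Fintype.card ι : ℝ) ≠ 0 := by simp
    simp only [avg_succ, ih, Finset.sum_const, Finset.card_univ, nsmul_eq_mul]
    field_simp

lemma avg_nonneg [Nonempty ι] (k : ℕ) {F : List ι → ℝ} (h : ∀ l, l.length = k → 0 ≤ F l) :
    0 ≤ avg k F := by
  rw [← avg_const (ι := ι) k 0]
  exact avg_mono k h

lemma avg_take_mul_drop (k m : ℕ) (F G : List ι → ℝ) :
    avg (k + m) (fun l => F (l.take k) * G (l.drop k)) = avg k F * avg m G := by
  rw [avg_append, ← avg_mul_const]
  refine avg_congr k fun l hl => ?_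
  rw [← avg_const_mul]
  exact avg_congr m fun l' _ => by rw [List.take_left' hl, List.drop_left' hl]

open Classical in
/-- A second-moment bound in the manner of Paley and Zygmund: a quantity whose mean is clearly
negative, compared with its second moment, is negative with a definite probability. -/
lemma le_avg_neg (k : ℕ) (F : List ι → ℝ) {κ K : ℝ} (hκ : 0 < κ) (hK : 0 < K)
    (h₁ : avg k F ≤ -κ) (h₂ : avg k (fun l => F l ^ 2) ≤ K) :
    κ ^ 2 / K ≤ avg k fun l => if F l < 0 then 1 else 0 := by
  have h : avg k (fun l => (-1) * F l) ≤
      avg k fun l => κ / (2 * K) * F l ^ 2 + K / (2 * κ) * (if F l < 0 then 1 else 0) := by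
    refine avg_mono k fun l _ => ?_
    split_ifs with hl
    · have e : κ / (2 * K) * F l ^ 2 + K / (2 * κ) * 1 - (-1) * F l
          = (κ * F l + K) ^ 2 / (2 * K * κ) := by
        field_simp
        ring
      have : 0 ≤ (κ * F l + K) ^ 2 / (2 * K * κ) := by positivity
      linarith
    · have : 0 ≤ κ / (2 * K) * F l ^ 2 := by positivity
      linarith
  rw [avg_const_mul, avg_add, avg_const_mul, avg_const_mul] at h
  set p := avg k fun l => if F l < 0 then (1 : ℝ) else 0
  have h3 : κ / (2 * K) * avg k (fun l => F l ^ 2) ≤ κ / (2 * K) * K := by gcongr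
  have h4 : κ / (2 * K) * K = κ / 2 := by field_simp
  rw [div_le_iff₀ hK]
  have h5 : κ / 2 ≤ K / (2 * κ) * p := by linarith
  have h6 : κ * (κ / 2) * 2 ≤ κ * (K / (2 * κ) * p) * 2 := by gcongr
  have h7 : κ * (K / (2 * κ) * p) * 2 = p * K := by field_simp
  nlinarith

/-! ### Moments of a quadratic form at a random sample -/

/-- The sum of `f` over a list of samples. -/
def lsum {ι : Type*} (f : ι → ℝ) (l : List ι) : ℝ := (l.map f).sum

lemma lsum_cons {ι : Type*} (f : ι → ℝ) (j : ι) (l : List ι) :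
    lsum f (j :: l) = f j + lsum f l := by
  simp [lsum]

/-- Twice the sum of the kernel `g` over all pairs of positions of a list of samples. -/
def pairSum {ι : Type*} (g : ι → ι → ℝ) : List ι → ℝ
  | [] => 0
  | j :: l => pairSum g l + 2 * lsum (g j) l

/-- Average of a function of a single uniform sample. -/
noncomputable def mean (f : ι → ℝ) : ℝ := (∑ i, f i) / Fintype.card ι

lemma avg_succ_eq_mean (k : ℕ) (F : List ι → ℝ) :
    avg (k + 1) F = mean fun j => avg k fun l => F (j :: l) := rfl

lemma mean_add (f g : ι → ℝ) : mean (fun i => f i + g i) = mean f + mean g := by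
  simp only [mean, Finset.sum_add_distrib, add_div]

lemma mean_const_mul (c : ℝ) (f : ι → ℝ) : mean (fun i => c * f i) = c * mean f := by
  simp only [mean, ← Finset.mul_sum, mul_div_assoc]

lemma mean_mul_const (f : ι → ℝ) (c : ℝ) : mean (fun i => f i * c) = mean f * c := by
  simp only [mul_comm _ c, mean_const_mul]

lemma mean_const [Nonempty ι] (c : ℝ) : mean (fun _ : ι => c) = c := avg_const 1 c

lemma avg_lsum [Nonempty ι] (k : ℕ) (f : ι → ℝ) : avg k (lsum f) = k * mean f := by
  induction k with
  | zero => simp [avg, lsum]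
  | succ k ih =>
    rw [avg_succ_eq_mean]
    simp only [lsum_cons, avg_add, avg_const, mean_add, mean_const]
    rw [show avg k (fun l => lsum f l) = k * mean f from ih]
    push_cast
    ring

lemma avg_lsum_mul_lsum [Nonempty ι] (k : ℕ) (f g : ι → ℝ) :
    avg k (fun l => lsum f l * lsum g l)
      = k * mean (fun i => f i * g i) + k * (k - 1) * (mean f * mean g) := by
  induction k with
  | zero => simp [avg, lsum]
  | succ k ih =>
    rw [avg_succ_eq_mean]
    simp only [lsum_cons, add_mul, mul_add, avg_add, avg_const, avg_const_mul, avg_mul_const,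
      mean_add, mean_const, mean_const_mul, mean_mul_const, ih, avg_lsum]
    push_cast
    ring

lemma avg_pairSum [Nonempty ι] (k : ℕ) (g : ι → ι → ℝ) :
    avg k (pairSum g) = k * (k - 1) * mean fun i => mean (g i) := by
  induction k with
  | zero => simp [avg, pairSum]
  | succ k ih =>
    rw [avg_succ_eq_mean]
    simp only [pairSum, avg_add, avg_const_mul, mean_add, mean_const, mean_const_mul, avg_lsum]
    rw [show avg k (fun l => pairSum g l) = _ from ih]
    push_cast
    ring

lemma mean_lsum (g : ι → ι → ℝ) (l : List ι) :
    mean (fun j => lsum (g j) l) = lsum (fun i => mean fun j => g j i) l := by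
  induction l with
  | nil => simp [lsum, mean]
  | cons i l ih => simp only [lsum_cons, mean_add, ih]

lemma avg_mean (k : ℕ) (F : ι → List ι → ℝ) :
    avg k (fun l => mean fun j => F j l) = mean fun j => avg k (F j) := by
  simp only [mean, div_eq_mul_inv, avg_mul_const, avg_sum]

lemma avg_pairSum_mul_lsum [Nonempty ι] (k : ℕ) (g : ι → ι → ℝ) (hg : ∀ i j, g i j = g j i) :
    avg k (fun l => pairSum g l * lsum (fun i => mean (g i)) l)
      = k * (k - 1) * (k - 2) * (mean fun i => mean (g i)) ^ 2
        + 2 * (k * (k - 1)) * mean fun i => mean (g i) ^ 2 := by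
  set m : ι → ℝ := fun i => mean (g i) with hm
  induction k with
  | zero => simp [avg, pairSum]
  | succ k ih =>
    have e2 : avg k (fun l => mean fun j => lsum (g j) l * lsum m l)
        = k * mean (fun i => m i ^ 2) + k * (k - 1) * mean m ^ 2 := by
      simp only [mean_mul_const, mean_lsum]
      have : (fun i => mean fun j => g j i) = m := by
        funext i; simp only [hg _ i]; rfl
      rw [this, avg_lsum_mul_lsum]
      simp only [sq]
    rw [avg_mean] at e2
    rw [avg_succ_eq_mean]
    simp only [lsum_cons, pairSum, add_mul, mul_add, mul_assoc, avg_add, avg_const_mul,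
      avg_mul_const, mean_add, mean_const, mean_const_mul, avg_lsum, ih]
    simp only [mul_assoc] at e2
    rw [e2, show avg k (fun l => pairSum g l) = _ from avg_pairSum k g]
    have e3 : mean (fun j => mean (g j) * m j) = mean fun i => m i ^ 2 := by
      simp only [sq, hm]
    rw [e3]
    push_cast
    simp only [hm]
    ring

/-- The second moment of the off-diagonal part of a quadratic form at independent samples. -/
lemma avg_pairSum_sq [Nonempty ι] (k : ℕ) (g : ι → ι → ℝ) (hg : ∀ i j, g i j = g j i) :
    avg k (fun l => pairSum g l ^ 2)
      = k * (k - 1) * (k - 2) * (k - 3) * (mean fun i => mean (g i)) ^ 2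
        + 4 * (k * (k - 1) * (k - 2)) * mean (fun i => mean (g i) ^ 2)
        + 2 * (k * (k - 1)) * mean fun i => mean fun j => g i j ^ 2 := by
  induction k with
  | zero => simp [avg, pairSum]
  | succ k ih =>
    have e1 : mean (fun j => avg k fun l => pairSum g l * lsum (g j) l)
        = avg k (fun l => pairSum g l * lsum (fun i => mean (g i)) l) := by
      rw [← avg_mean]
      simp only [mean_const_mul, mean_lsum]
      have : (fun i => mean fun j => g j i) = fun i => mean (g i) := by
        funext i; simp only [hg _ i]
      rw [this]
    have e2 (l : List ι) (j : ι) : pairSum g (j :: l) ^ 2 = pairSum g l ^ 2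
        + 4 * (pairSum g l * lsum (g j) l) + 4 * (lsum (g j) l * lsum (g j) l) := by
      rw [pairSum]
      ring
    rw [avg_succ_eq_mean]
    simp only [e2, avg_add, avg_const_mul, mean_add, mean_const, mean_const_mul,
      avg_lsum_mul_lsum, e1, ih, avg_pairSum_mul_lsum k g hg]
    push_cast
    simp only [sq]
    ring

end Average

/-! ### Spectral analysis of random principal submatrices -/

/-- The sum of `v i • e i` over the samples `i` in a list. -/
def sampleVec {n : ℕ} (v : Fin n → ℝ) : List (Fin n) → Fin n → ℝ
  | [] => 0
  | j :: l => Pi.single j (v j) + sampleVec v l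

lemma sampleVec_apply_eq_zero {n : ℕ} (v : Fin n → ℝ) (l : List (Fin n)) {i : Fin n} (hi : i ∉ l) :
    sampleVec v l i = 0 := by
  induction l with
  | nil => rfl
  | cons j l ih =>
    simp only [List.mem_cons, not_or] at hi
    simp [sampleVec, ih hi.2, hi.1]

lemma mulVec_sampleVec {n : ℕ} (B : Matrix (Fin n) (Fin n) ℝ) (v : Fin n → ℝ) (c : Fin n)
    (l : List (Fin n)) : (B *ᵥ sampleVec v l) c = lsum (fun j => B c j * v j) l := by
  induction l with
  | nil => simp [sampleVec, lsum]
  | cons j l ih => simp [sampleVec, lsum_cons, mulVec_add, ih, mul_comm]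

lemma dotProduct_mulVec_comm {n : ℕ} {B : Matrix (Fin n) (Fin n) ℝ} (hB : Bᵀ = B)
    (x y : Fin n → ℝ) : x ⬝ᵥ B *ᵥ y = y ⬝ᵥ B *ᵥ x := by
  rw [dotProduct_mulVec, ← mulVec_transpose, hB, dotProduct_comm]

lemma quad_add {n : ℕ} {B : Matrix (Fin n) (Fin n) ℝ} (hB : Bᵀ = B) (x y : Fin n → ℝ) :
    (x + y) ⬝ᵥ B *ᵥ (x + y) = x ⬝ᵥ B *ᵥ x + 2 * (x ⬝ᵥ B *ᵥ y) + y ⬝ᵥ B *ᵥ y := by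
  rw [mulVec_add, dotProduct_add, add_dotProduct, add_dotProduct, dotProduct_mulVec_comm hB y x]
  ring

lemma quad_single_add {n : ℕ} {B : Matrix (Fin n) (Fin n) ℝ} (hB : Bᵀ = B) (c : Fin n) (θ : ℝ)
    (y : Fin n → ℝ) : (Pi.single c θ + y) ⬝ᵥ B *ᵥ (Pi.single c θ + y)
      = θ ^ 2 * B c c + 2 * (θ * (B *ᵥ y) c) + y ⬝ᵥ B *ᵥ y := by
  rw [quad_add hB, single_dotProduct, single_dotProduct]
  simp
  ring

lemma quad_sampleVec {n : ℕ} {B : Matrix (Fin n) (Fin n) ℝ} (hB : Bᵀ = B) (v : Fin n → ℝ)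
    (l : List (Fin n)) : sampleVec v l ⬝ᵥ B *ᵥ sampleVec v l
      = lsum (fun i => v i ^ 2 * B i i) l + pairSum (fun i j => v i * B i j * v j) l := by
  induction l with
  | nil => simp [sampleVec, lsum, pairSum]
  | cons j l ih =>
    rw [sampleVec, quad_single_add hB, ih, lsum_cons, pairSum, mulVec_sampleVec]
    have : lsum (fun i => v j * B j i * v i) l = v j * lsum (fun i => B j i * v i) l := by
      simp [lsum, ← List.sum_map_mul_left, mul_assoc]
    rw [this]
    ring

/-- The principal submatrix of `B` on the indices that occur in `l` is not positive
semidefinite. -/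
def IsNegativeOn {n : ℕ} (B : Matrix (Fin n) (Fin n) ℝ) (l : List (Fin n)) : Prop :=
  ∃ y : Fin n → ℝ, (∀ i ∉ l, y i = 0) ∧ y ⬝ᵥ B *ᵥ y < 0

lemma IsNegativeOn.mono {n : ℕ} {B : Matrix (Fin n) (Fin n) ℝ} {l l' : List (Fin n)}
    (h : IsNegativeOn B l) (hl : ∀ i ∈ l, i ∈ l') : IsNegativeOn B l' := by
  obtain ⟨y, hy, h⟩ := h
  exact ⟨y, fun i hi => hy i fun h' => hi (hl i h'), h⟩

lemma sq_add_four_le (p q d u : ℝ) :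
    (p + 2 * q + (d + u)) ^ 2 ≤ 4 * (p ^ 2 + 4 * q ^ 2 + d ^ 2 + u ^ 2) := by
  have h₁ := add_sq_le (a := p + 2 * q) (b := d + u)
  have h₂ := add_sq_le (a := p) (b := 2 * q)
  have h₃ := add_sq_le (a := d) (b := u)
  linarith

set_option maxHeartbeats 800000 in
open Classical in
/-- If the coordinates of `v` are not too large, then the form of `B` at `θ e_c + Σ v_i e_i`, the
sum over `k` random indices `i`, is negative with a definite probability as soon as its expectation
is clearly negative. -/
lemma le_avg_quad_neg {n k : ℕ} [NeZero n] (hk : 4 ≤ k) {B : Matrix (Fin n) (Fin n) ℝ}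
    (hB : Bᵀ = B) (hB1 : ∀ i j, |B i j| ≤ 1) {v : Fin n → ℝ} {a b θ P : ℝ} (c : Fin n)
    (hP : P = k / n) (hv1 : ∑ i, v i ^ 2 ≤ 1) (hv2 : ∀ i, v i ^ 2 ≤ 4 * P)
    (ha : |v ⬝ᵥ B *ᵥ v| ≤ a) (ha' : P ^ 2 * a ≤ 9 * P)
    (hb : ∀ i, v i ≠ 0 → (B *ᵥ v) i ^ 2 ≤ b) (hb' : P ^ 3 * b ≤ 600 * P ^ 2)
    (hθ : θ ^ 2 ≤ 4 * P) (hc : θ ^ 2 * (P ^ 2 * (B *ᵥ v) c ^ 2) ≤ 164 * P ^ 2)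
    (hE : θ ^ 2 + 2 * θ * (P * (B *ᵥ v) c) + P
      + k * (k - 1) * ((v ⬝ᵥ B *ᵥ v) / n ^ 2) ≤ -P) :
    1 / 16000 ≤ avg k fun l => if (Pi.single c θ + sampleVec v l) ⬝ᵥ B *ᵥ
      (Pi.single c θ + sampleVec v l) < 0 then 1 else 0 := by
  have hn : (0 : ℝ) < n := by exact_mod_cast Nat.pos_of_ne_zero (NeZero.ne n)
  have hk' : (4 : ℝ) ≤ k := by exact_mod_cast hk
  have hk0 : (0 : ℝ) < k := by linarith
  have hP0 : 0 < P := by rw [hP]; positivity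
  have hkP : (k : ℝ) = P * n := by rw [hP]; field_simp
  have hB2 (i j) : B i j ^ 2 ≤ 1 := by
    rw [← sq_abs]; exact pow_le_one₀ (abs_nonneg _) (hB1 i j)
  have mean_eq (f : Fin n → ℝ) : mean f = (∑ i, f i) / n := by simp [mean]
  set w := B *ᵥ v with hw
  set X : List (Fin n) → ℝ := lsum fun j => B c j * v j with hX
  set D : List (Fin n) → ℝ := lsum fun i => v i ^ 2 * B i i with hD
  set g : Fin n → Fin n → ℝ := fun i j => v i * B i j * v j with hg
  have hF (l : List (Fin n)) : (Pi.single c θ + sampleVec v l) ⬝ᵥ B *ᵥ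
      (Pi.single c θ + sampleVec v l) = θ ^ 2 * B c c + 2 * (θ * X l) + (D l + pairSum g l) := by
    rw [quad_single_add hB, quad_sampleVec hB, mulVec_sampleVec]
  -- first and second moments of the three random parts of the form
  have mX : mean (fun j => B c j * v j) = w c / n := by
    rw [mean_eq]; rfl
  have mX2 : mean (fun j => (B c j * v j) * (B c j * v j)) ≤ 1 / n := by
    rw [mean_eq]
    gcongr
    refine (Finset.sum_le_sum fun i _ => ?_).trans hv1
    nlinarith [hB2 c i, sq_nonneg (v i)]
  have mD : |mean fun i => v i ^ 2 * B i i| ≤ 1 / n := by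
    rw [mean_eq, abs_div, abs_of_pos hn]
    gcongr
    refine (Finset.abs_sum_le_sum_abs _ _).trans ((Finset.sum_le_sum fun i _ => ?_).trans hv1)
    rw [abs_mul, abs_of_nonneg (sq_nonneg (v i))]
    exact mul_le_of_le_one_right (sq_nonneg _) (hB1 i i)
  have mD2 : mean (fun i => (v i ^ 2 * B i i) * (v i ^ 2 * B i i)) ≤ 4 * P / n := by
    rw [mean_eq]
    gcongr
    calc _ ≤ ∑ i, v i ^ 2 * (4 * P) := by
          refine Finset.sum_le_sum fun i _ => ?_
          have h1 : (v i ^ 2 * B i i) * (v i ^ 2 * B i i) = v i ^ 2 * (v i ^ 2 * B i i ^ 2) := by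
            ring
          rw [h1]
          exact mul_le_mul_of_nonneg_left
            ((mul_le_of_le_one_right (sq_nonneg _) (hB2 i i)).trans (hv2 i)) (sq_nonneg _)
      _ = (∑ i, v i ^ 2) * (4 * P) := by rw [Finset.sum_mul]
      _ ≤ 4 * P := mul_le_of_le_one_left (by positivity) hv1
  have mgi (i) : mean (g i) = v i * w i / n := by
    rw [mean_eq, hw, mulVec, dotProduct, Finset.mul_sum]
    simp only [hg, mul_assoc]
  have mg : (mean fun i => mean (g i)) = (v ⬝ᵥ w) / n ^ 2 := by
    rw [mean_eq]
    simp only [mgi, ← Finset.sum_div, dotProduct]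
    field_simp
  have mg2 : mean (fun i => mean (g i) ^ 2) ≤ b / n ^ 3 := by
    rw [mean_eq]
    simp only [mgi, div_pow, ← Finset.sum_div]
    rw [div_div, ← pow_succ]
    gcongr
    calc _ ≤ ∑ i, v i ^ 2 * b := by
          refine Finset.sum_le_sum fun i _ => ?_
          rw [mul_pow]
          rcases eq_or_ne (v i) 0 with h | h
          · simp [h]
          · exact mul_le_mul_of_nonneg_left (hb i h) (sq_nonneg _)
      _ = (∑ i, v i ^ 2) * b := by rw [Finset.sum_mul]
      _ ≤ b := by
          by_cases h : ∃ i, v i ≠ 0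
          · obtain ⟨i, hi⟩ := h
            exact mul_le_of_le_one_left ((sq_nonneg _).trans (hb i hi)) hv1
          · push Not at h
            simp only [h]
            -- then `v = 0` and the mean of the form cannot be negative
            exfalso
            have hv0 : v = 0 := funext h
            have hw0 : w = 0 := by rw [hw, hv0, mulVec_zero]
            rw [hv0, hw0] at hE
            simp at hE
            nlinarith [sq_nonneg θ]
  have mgg : mean (fun i => mean fun j => g i j ^ 2) ≤ 1 / n ^ 2 := by
    simp only [mean_eq, ← Finset.sum_div]
    rw [div_div, ← sq]
    gcongr
    calc _ ≤ ∑ i, ∑ j, v i ^ 2 * v j ^ 2 := by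
          refine Finset.sum_le_sum fun i _ => Finset.sum_le_sum fun j _ => ?_
          have : g i j ^ 2 = v i ^ 2 * v j ^ 2 * B i j ^ 2 := by simp only [hg]; ring
          rw [this]
          exact mul_le_of_le_one_right (by positivity) (hB2 i j)
      _ = (∑ i, v i ^ 2) * ∑ j, v j ^ 2 := by rw [Finset.sum_mul_sum]
      _ ≤ 1 := mul_le_one₀ hv1 (Finset.sum_nonneg fun i _ => sq_nonneg _) hv1
  have sX : θ ^ 2 * avg k (fun l => X l * X l) ≤ 168 * P ^ 2 := by
    rw [avg_lsum_mul_lsum, mX]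
    have h1 : k * mean (fun j => (B c j * v j) * (B c j * v j)) ≤ P := by
      rw [hP, div_eq_mul_one_div]
      gcongr
    have h2 : (k : ℝ) * (k - 1) * (w c / n * (w c / n)) ≤ P ^ 2 * w c ^ 2 := by
      have e : P ^ 2 * w c ^ 2 = k * k * (w c / n * (w c / n)) := by rw [hP]; field_simp
      rw [e]
      gcongr
      · exact mul_self_nonneg _
      · linarith
    calc _ ≤ θ ^ 2 * (P + P ^ 2 * w c ^ 2) := by gcongr
      _ ≤ 4 * P * P + 164 * P ^ 2 := by rw [mul_add]; gcongr
      _ = _ := by ring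
  have sD : avg k (fun l => D l * D l) ≤ 5 * P ^ 2 := by
    rw [avg_lsum_mul_lsum]
    have h1 : k * mean (fun i => (v i ^ 2 * B i i) * (v i ^ 2 * B i i)) ≤ 4 * P ^ 2 := by
      have e : 4 * P ^ 2 = k * (4 * P / n) := by rw [hkP]; field_simp
      rw [e]
      gcongr
    have h2 : (k : ℝ) * (k - 1) * (mean (fun i => v i ^ 2 * B i i) *
        mean (fun i => v i ^ 2 * B i i)) ≤ P ^ 2 := by
      have e : P ^ 2 = k * k * (1 / n * (1 / n)) := by rw [hP]; field_simp
      rw [e]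
      have h3 : mean (fun i => v i ^ 2 * B i i) * mean (fun i => v i ^ 2 * B i i)
          ≤ 1 / n * (1 / n) := by
        rw [← abs_mul_abs_self]
        gcongr
      gcongr
      · exact mul_self_nonneg _
      · linarith
    linarith
  have sU : avg k (fun l => pairSum g l ^ 2) ≤ 2483 * P ^ 2 := by
    rw [avg_pairSum_sq k g fun i j => by
      simp only [hg]
      rw [show B i j = B j i from congrFun (congrFun hB.symm i) j]
      ring, mg]
    have hn2 : (0 : ℝ) < n ^ 2 := by positivity
    have q1 : ((v ⬝ᵥ w) / n ^ 2) ^ 2 * k ^ 4 ≤ 81 * P ^ 2 := by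
      have h1 : |P ^ 2 * (v ⬝ᵥ w)| ≤ 9 * P := by
        rw [abs_mul, abs_of_pos (by positivity : 0 < P ^ 2)]
        exact (mul_le_mul_of_nonneg_left ha (by positivity)).trans ha'
      have h2 := pow_le_pow_left₀ (abs_nonneg _) h1 2
      rw [sq_abs] at h2
      have e : ((v ⬝ᵥ w) / n ^ 2) ^ 2 * k ^ 4 = (P ^ 2 * (v ⬝ᵥ w)) ^ 2 := by rw [hkP]; field_simp
      rw [e]
      linarith
    have q2 : b / n ^ 3 * k ^ 3 ≤ 600 * P ^ 2 := by
      have e : b / n ^ 3 * k ^ 3 = P ^ 3 * b := by rw [hkP]; field_simp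
      rw [e]
      exact hb'
    have q3 : 1 / n ^ 2 * k ^ 2 = P ^ 2 := by rw [hkP]; field_simp
    have c1 : (k : ℝ) * (k - 1) * (k - 2) * (k - 3) ≤ k ^ 4 := by
      have : (k : ℝ) * (k - 1) * (k - 2) * (k - 3) ≤ k * k * k * k := by
        gcongr <;> linarith
      linarith
    have c2 : (k : ℝ) * (k - 1) * (k - 2) ≤ k ^ 3 := by
      have : (k : ℝ) * (k - 1) * (k - 2) ≤ k * k * k := by
        gcongr <;> linarith
      linarith
    have c3 : (k : ℝ) * (k - 1) ≤ k ^ 2 := by nlinarith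
    have c2' : 0 ≤ (k : ℝ) * (k - 1) * (k - 2) :=
      mul_nonneg (mul_nonneg hk0.le (by linarith)) (by linarith)
    have c3' : 0 ≤ (k : ℝ) * (k - 1) := mul_nonneg hk0.le (by linarith)
    have r1 := mul_le_mul_of_nonneg_right c1 (sq_nonneg ((v ⬝ᵥ w) / n ^ 2))
    have hb0 : 0 ≤ mean (fun i => mean (g i) ^ 2) := by
      rw [mean_eq]
      exact div_nonneg (Finset.sum_nonneg fun i _ => sq_nonneg _) hn.le
    have r2 : k * (k - 1) * (k - 2) * mean (fun i => mean (g i) ^ 2) ≤ k ^ 3 * (b / n ^ 3) := by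
      gcongr
    have r3 : k * (k - 1) * mean (fun i => mean fun j => g i j ^ 2) ≤ k ^ 2 * (1 / n ^ 2) := by
      gcongr
      rw [mean_eq]
      refine div_nonneg (Finset.sum_nonneg fun i _ => ?_) hn.le
      rw [mean_eq]
      exact div_nonneg (Finset.sum_nonneg fun j _ => sq_nonneg _) hn.le
    linarith
  have key := le_avg_neg k (fun l => θ ^ 2 * B c c + 2 * (θ * X l) + (D l + pairSum g l))
    hP0 (K := 16000 * P ^ 2) (by positivity) ?_ ?_
  · simp only [hF]
    refine le_trans (le_of_eq ?_) key
    field_simp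
  · have eX : avg k (fun l => X l) = k * (w c / n) := by rw [← mX]; exact avg_lsum k _
    have eD : avg k (fun l => D l) = k * mean fun i => v i ^ 2 * B i i := avg_lsum k _
    have eU : avg k (fun l => pairSum g l) = k * (k - 1) * ((v ⬝ᵥ w) / n ^ 2) := by
      rw [← mg]; exact avg_pairSum k g
    simp only [avg_add, avg_const_mul, avg_const, eX, eD, eU]
    have h1 : θ ^ 2 * B c c ≤ θ ^ 2 :=
      mul_le_of_le_one_right (sq_nonneg _) ((le_abs_self _).trans (hB1 c c))
    have h2 : k * mean (fun i => v i ^ 2 * B i i) ≤ P := by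
      rw [hP, div_eq_mul_one_div]
      gcongr
      exact (le_abs_self _).trans mD
    have h3 : (k : ℝ) * (w c / n) = P * w c := by rw [hP]; field_simp
    rw [h3]
    linarith
  · have hpt (l : List (Fin n)) : (θ ^ 2 * B c c + 2 * (θ * X l) + (D l + pairSum g l)) ^ 2
        ≤ 4 * (16 * P ^ 2 + 4 * (θ ^ 2 * (X l * X l)) + D l * D l + pairSum g l ^ 2) := by
      have h1 : (θ ^ 2 * B c c) ^ 2 ≤ 16 * P ^ 2 := by
        have h2 : (θ ^ 2) ^ 2 ≤ (4 * P) ^ 2 := by gcongr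
        have h3 := mul_le_of_le_one_right (sq_nonneg (θ ^ 2)) (hB2 c c)
        rw [mul_pow]
        linarith
      have h4 : θ ^ 2 * (X l * X l) = (θ * X l) ^ 2 := by ring
      have h5 := sq_add_four_le (θ ^ 2 * B c c) (θ * X l) (D l) (pairSum g l)
      rw [h4, ← sq (D l)]
      linarith
    refine (avg_mono k fun l _ => hpt l).trans ?_
    simp only [avg_add, avg_const_mul, avg_const]
    linarith [sq_nonneg P]

/-! ### Truncated eigenvectors -/

/-- A value of at most `-δ` of the form on the unit ball forces an eigenvalue of at most `-δ`. -/
lemma exists_eigenvector_le {n : ℕ} {B : Matrix (Fin n) (Fin n) ℝ} (hB : Bᵀ = B) {δ : ℝ}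
    (hδ : 0 < δ) {x : Fin n → ℝ} (hx : ∑ i, x i ^ 2 ≤ 1) (h : x ⬝ᵥ B *ᵥ x ≤ -δ) :
    ∃ (u : Fin n → ℝ) (μ : ℝ), δ ≤ μ ∧ ∑ i, u i ^ 2 = 1 ∧ B *ᵥ u = -(μ • u) := by
  have hH : B.IsHermitian := by simpa [IsHermitian] using hB
  set b := hH.eigenvectorBasis
  set μ := hH.eigenvalues
  have inner_eq (x y : EuclideanSpace ℝ (Fin n)) : inner ℝ x y = x.ofLp ⬝ᵥ y.ofLp := by
    simp [PiLp.inner_apply, dotProduct, mul_comm]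
  have parseval (x y : Fin n → ℝ) : ∑ i, ((b i).ofLp ⬝ᵥ x) * ((b i).ofLp ⬝ᵥ y) = x ⬝ᵥ y := by
    have := b.sum_inner_mul_inner (WithLp.toLp 2 x) (WithLp.toLp 2 y)
    simp only [inner_eq] at this
    rw [← this]
    exact Finset.sum_congr rfl fun i _ => by rw [dotProduct_comm x]
  have hquad : x ⬝ᵥ B *ᵥ x = ∑ i, μ i * ((b i).ofLp ⬝ᵥ x) ^ 2 := by
    rw [← parseval]
    refine Finset.sum_congr rfl fun i _ => ?_
    rw [dotProduct_mulVec_comm hB (b i).ofLp x, hH.mulVec_eigenvectorBasis, dotProduct_smul,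
      smul_eq_mul, dotProduct_comm x]
    ring
  have hnorm : ∑ i, ((b i).ofLp ⬝ᵥ x) ^ 2 ≤ 1 := by
    simp only [sq]
    rw [parseval]
    simpa [dotProduct, ← sq] using hx
  by_cases hex : ∃ i, μ i ≤ -δ
  · obtain ⟨i, hi⟩ := hex
    refine ⟨(b i).ofLp, -μ i, by linarith, ?_, ?_⟩
    · have := b.orthonormal.1 i
      have h2 : (b i).ofLp ⬝ᵥ (b i).ofLp = 1 := by
        rw [← inner_eq, real_inner_self_eq_norm_sq, this]
        norm_num
      simpa [dotProduct, ← sq] using h2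
    · rw [hH.mulVec_eigenvectorBasis, neg_smul, neg_neg]
  · push Not at hex
    exfalso
    have h1 : ∀ i, -δ * ((b i).ofLp ⬝ᵥ x) ^ 2 ≤ μ i * ((b i).ofLp ⬝ᵥ x) ^ 2 := fun i =>
      mul_le_mul_of_nonneg_right (hex i).le (sq_nonneg _)
    have h2 : -δ * ∑ i, ((b i).ofLp ⬝ᵥ x) ^ 2 ≤ x ⬝ᵥ B *ᵥ x := by
      rw [hquad, Finset.mul_sum]
      exact Finset.sum_le_sum fun i _ => h1 i
    have h3 : ∑ i, ((b i).ofLp ⬝ᵥ x) ^ 2 = 1 := by nlinarith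
    have h4 : -δ * ∑ i, ((b i).ofLp ⬝ᵥ x) ^ 2 < x ⬝ᵥ B *ᵥ x := by
      rw [hquad, Finset.mul_sum]
      refine Finset.sum_lt_sum (fun i _ => h1 i) ?_
      by_contra hall
      push Not at hall
      have : ∀ i, ((b i).ofLp ⬝ᵥ x) ^ 2 = 0 := fun i => by
        by_contra hne
        have hpos : 0 < ((b i).ofLp ⬝ᵥ x) ^ 2 := lt_of_le_of_ne (sq_nonneg _) (Ne.symm hne)
        exact absurd (hall i (mem_univ i)) (not_le.2 (mul_lt_mul_of_pos_right (hex i) hpos))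
      simp [this] at h3
    rw [h3] at h4
    linarith

/-- The vector `x` without its coordinates of square greater than `τ`. -/
noncomputable def truncate {n : ℕ} (x : Fin n → ℝ) (τ : ℝ) (i : Fin n) : ℝ :=
  if x i ^ 2 ≤ τ then x i else 0

/-- The squared norm of the part of `x` that is removed by `truncate`. -/
noncomputable def tailMass {n : ℕ} (x : Fin n → ℝ) (τ : ℝ) : ℝ :=
  ∑ i, if x i ^ 2 ≤ τ then 0 else x i ^ 2

lemma tailMass_nonneg {n : ℕ} (x : Fin n → ℝ) (τ : ℝ) : 0 ≤ tailMass x τ :=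
  Finset.sum_nonneg fun i _ => by split_ifs <;> positivity

lemma sum_truncate_sq_add {n : ℕ} (x : Fin n → ℝ) (τ : ℝ) :
    ∑ i, truncate x τ i ^ 2 + tailMass x τ = ∑ i, x i ^ 2 := by
  rw [tailMass, ← Finset.sum_add_distrib]
  refine Finset.sum_congr rfl fun i _ => ?_
  rw [truncate]
  split_ifs <;> simp

/-- The tail has a small `ℓ¹`-norm, since its coordinates are large. -/
lemma mul_sum_abs_sub_truncate_le {n : ℕ} (x : Fin n → ℝ) (t : ℝ) :
    t * ∑ i, |(x - truncate x (t ^ 2)) i| ≤ tailMass x (t ^ 2) := by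
  rw [tailMass, Finset.mul_sum]
  refine Finset.sum_le_sum fun i _ => ?_
  simp only [Pi.sub_apply, truncate]
  split_ifs with h
  · simp
  · rw [sub_zero, ← sq_abs (x i), sq]
    refine mul_le_mul_of_nonneg_right ?_ (abs_nonneg _)
    exact le_of_sq_le_sq (by rw [sq_abs]; exact (not_le.1 h).le) (abs_nonneg _)

section Truncated

variable {n : ℕ} {B : Matrix (Fin n) (Fin n) ℝ} {x : Fin n → ℝ} {lam t : ℝ}

/-- Truncating an eigenvector changes its image only a little. -/
lemma abs_mulVec_truncate_add_le (hB1 : ∀ i j, |B i j| ≤ 1)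
    (hx : B *ᵥ x = -(lam • x)) (ht : 0 < t) (i : Fin n) :
    |(B *ᵥ truncate x (t ^ 2)) i + lam * x i| ≤ tailMass x (t ^ 2) / t := by
  set u := x - truncate x (t ^ 2) with hu
  have h1 : (B *ᵥ truncate x (t ^ 2)) i + lam * x i = -(B *ᵥ u) i := by
    rw [hu, mulVec_sub, hx]
    simp
  rw [h1, abs_neg, le_div_iff₀ ht, mul_comm]
  refine (mul_le_mul_of_nonneg_left ?_ ht.le).trans (mul_sum_abs_sub_truncate_le x t)
  rw [mulVec, dotProduct]
  refine (Finset.abs_sum_le_sum_abs _ _).trans (Finset.sum_le_sum fun j _ => ?_)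
  rw [abs_mul]
  exact mul_le_of_le_one_left (abs_nonneg _) (hB1 i j)

/-- Truncating an eigenvector changes the value of the form in a controlled way. -/
lemma abs_quad_truncate_sub_le (hB : Bᵀ = B) (hB1 : ∀ i j, |B i j| ≤ 1)
    (hx1 : ∑ i, x i ^ 2 = 1) (hx : B *ᵥ x = -(lam • x)) (ht : 0 < t) :
    |truncate x (t ^ 2) ⬝ᵥ B *ᵥ truncate x (t ^ 2) - (-lam + 2 * lam * tailMass x (t ^ 2))|
      ≤ (tailMass x (t ^ 2) / t) ^ 2 := by
  set v := truncate x (t ^ 2) with hv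
  set u := x - v with hu
  have hxx : x ⬝ᵥ x = 1 := by simpa [dotProduct, ← sq] using hx1
  have hux : u ⬝ᵥ x = tailMass x (t ^ 2) := by
    rw [tailMass, dotProduct]
    refine Finset.sum_congr rfl fun i _ => ?_
    simp only [hu, hv, Pi.sub_apply, truncate]
    split_ifs <;> ring
  have h1 : v ⬝ᵥ B *ᵥ v = x ⬝ᵥ B *ᵥ x - 2 * (u ⬝ᵥ B *ᵥ x) + u ⬝ᵥ B *ᵥ u := by
    have hvx : v = (-u) + x := by rw [hu]; abel
    conv_lhs => rw [hvx]
    rw [quad_add hB, mulVec_neg, neg_dotProduct, neg_dotProduct, dotProduct_neg]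
    ring
  have h2 : v ⬝ᵥ B *ᵥ v - (-lam + 2 * lam * tailMass x (t ^ 2)) = u ⬝ᵥ B *ᵥ u := by
    rw [h1, hx, dotProduct_neg, dotProduct_neg, dotProduct_smul, dotProduct_smul, hxx, hux]
    simp only [smul_eq_mul]
    ring
  rw [h2]
  refine (abs_dotProduct_mulVec_le B hB1 u).trans ?_
  refine pow_le_pow_left₀ (Finset.sum_nonneg fun i _ => abs_nonneg _) ?_ 2
  rw [le_div_iff₀ ht, mul_comm]
  exact mul_sum_abs_sub_truncate_le x t

open Classical in
/-- The second-moment argument, for a truncated eigenvector. -/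
lemma le_avg_isNegativeOn_of_mean {k : ℕ} [NeZero n] (hk : 4 ≤ k) (hB : Bᵀ = B)
    (hB1 : ∀ i j, |B i j| ≤ 1) (hx1 : ∑ i, x i ^ 2 = 1) (hx : B *ᵥ x = -(lam • x)) {r θ : ℝ}
    (hr : 0 < r) (hP : r ^ 2 = k / n) (hlam : 0 ≤ lam) (hlam8 : r ^ 2 * lam ≤ 8) (c : Fin n)
    (hθ : θ ^ 2 ≤ 4 * r ^ 2)
    (hc : θ ^ 2 * ((r ^ 2) ^ 2 * (B *ᵥ truncate x ((2 * r) ^ 2)) c ^ 2) ≤ 164 * (r ^ 2) ^ 2)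
    (hE : θ ^ 2 + 2 * θ * (r ^ 2 * (B *ᵥ truncate x ((2 * r) ^ 2)) c) + r ^ 2
      + k * (k - 1) * ((truncate x ((2 * r) ^ 2) ⬝ᵥ B *ᵥ truncate x ((2 * r) ^ 2)) / n ^ 2)
        ≤ -r ^ 2) :
    1 / 16000 ≤ avg k fun l => if (Pi.single c θ + sampleVec (truncate x ((2 * r) ^ 2)) l) ⬝ᵥ
      B *ᵥ (Pi.single c θ + sampleVec (truncate x ((2 * r) ^ 2)) l) < 0 then 1 else 0 := by
  have hη0 := tailMass_nonneg x ((2 * r) ^ 2)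
  have hη1 : tailMass x ((2 * r) ^ 2) ≤ 1 := by
    have h1 := sum_truncate_sq_add x ((2 * r) ^ 2)
    have h2 : 0 ≤ ∑ i, truncate x ((2 * r) ^ 2) i ^ 2 := Finset.sum_nonneg fun i _ => sq_nonneg _
    linarith
  have hηr : (tailMass x ((2 * r) ^ 2) / (2 * r)) ^ 2 ≤ 1 / (4 * r ^ 2) := by
    rw [div_pow, show 4 * r ^ 2 = (2 * r) ^ 2 by ring]
    gcongr
    exact pow_le_one₀ hη0 hη1
  refine le_avg_quad_neg hk hB hB1 (a := lam + 1 / (4 * r ^ 2))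
    (b := 2 * (lam ^ 2 * (4 * r ^ 2)) + 2 * (1 / (4 * r ^ 2))) c hP ?_ ?_ ?_ ?_ ?_ ?_ hθ hc hE
  · linarith [sum_truncate_sq_add x ((2 * r) ^ 2)]
  · intro i
    rw [truncate]
    split_ifs with h
    · linarith
    · rw [zero_pow two_ne_zero]
      positivity
  · have h1 := abs_le.1 (abs_quad_truncate_sub_le hB hB1 hx1 hx (t := 2 * r) (by positivity))
    have h2 : lam * tailMass x ((2 * r) ^ 2) ≤ lam := mul_le_of_le_one_right hlam hη1
    have h3 : 0 ≤ lam * tailMass x ((2 * r) ^ 2) := by positivity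
    rw [abs_le]
    constructor <;> linarith
  · have e : (r ^ 2) ^ 2 * (lam + 1 / (4 * r ^ 2)) = r ^ 2 * (r ^ 2 * lam + 1 / 4) := by
      field_simp
    rw [e, mul_comm]
    gcongr
    linarith
  · intro i hi
    have hxi : x i ^ 2 ≤ 4 * r ^ 2 := by
      by_contra hne
      refine hi ?_
      rw [truncate, if_neg]
      linarith
    have h1 := abs_mulVec_truncate_add_le hB1 hx (t := 2 * r) (by positivity) i
    have h2 := pow_le_pow_left₀ (abs_nonneg _) h1 2
    rw [sq_abs] at h2
    have h3 := add_sq_le (a := (B *ᵥ truncate x ((2 * r) ^ 2)) i + lam * x i) (b := -(lam * x i))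
    have h4 : lam ^ 2 * x i ^ 2 ≤ lam ^ 2 * (4 * r ^ 2) := by gcongr
    have h5 : (B *ᵥ truncate x ((2 * r) ^ 2)) i + lam * x i + -(lam * x i)
      = (B *ᵥ truncate x ((2 * r) ^ 2)) i := by ring
    rw [h5] at h3
    have h6 : (-(lam * x i)) ^ 2 = lam ^ 2 * x i ^ 2 := by ring
    linarith
  · have e : (r ^ 2) ^ 3 * (2 * (lam ^ 2 * (4 * r ^ 2)) + 2 * (1 / (4 * r ^ 2)))
        = (8 * (r ^ 2 * lam) ^ 2 + 1 / 2) * (r ^ 2) ^ 2 := by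
      field_simp
      ring
    rw [e]
    gcongr
    have h0 : 0 ≤ r ^ 2 * lam := by positivity
    nlinarith

open Classical in
/-- If almost all of the mass of the eigenvector is spread, then a sample of size about `n / lam`
sees the negative direction. -/
lemma le_avg_isNegativeOn_of_light {k : ℕ} [NeZero n] (hk : 4 ≤ k) (hB : Bᵀ = B)
    (hB1 : ∀ i j, |B i j| ≤ 1) (hx1 : ∑ i, x i ^ 2 = 1) (hx : B *ᵥ x = -(lam • x))
    (hlam : 0 < lam) (h4 : 4 ≤ k / n * lam) (h8 : k / n * lam ≤ 8)
    (hη : tailMass x (16 / lam) ≤ 1 / 8) :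
    1 / 16000 ≤ avg k fun l : List (Fin n) => if IsNegativeOn B l then (1 : ℝ) else 0 := by
  have hn : (0 : ℝ) < n := by exact_mod_cast Nat.pos_of_ne_zero (NeZero.ne n)
  have hk' : (4 : ℝ) ≤ k := by exact_mod_cast hk
  set P : ℝ := k / n with hPdef
  have hP0 : 0 < P := by positivity
  set r := Real.sqrt P
  have hr : 0 < r := Real.sqrt_pos.2 hP0
  have hrP : r ^ 2 = P := Real.sq_sqrt hP0.le
  set v := truncate x ((2 * r) ^ 2) with hv
  have hτ : (2 * r) ^ 2 = 4 * P := by rw [mul_pow, hrP]; norm_num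
  have hη' : tailMass x ((2 * r) ^ 2) ≤ 1 / 8 := by
    refine le_trans (Finset.sum_le_sum fun i _ => ?_) hη
    have : 16 / lam ≤ (2 * r) ^ 2 := by rw [hτ, div_le_iff₀ hlam]; linarith
    split_ifs with h1 h2
    · exact le_rfl
    · positivity
    · linarith
    · exact le_rfl
  have hη0 := tailMass_nonneg x ((2 * r) ^ 2)
  have hquad : v ⬝ᵥ B *ᵥ v ≤ -(7 / 10 * lam) := by
    have h1 := (abs_le.1 (abs_quad_truncate_sub_le hB hB1 hx1 hx (t := 2 * r) (by positivity))).2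
    have h2 : (tailMass x ((2 * r) ^ 2) / (2 * r)) ^ 2 ≤ lam / 1024 := by
      rw [div_pow, hτ, div_le_iff₀ (by positivity)]
      have : tailMass x ((2 * r) ^ 2) ^ 2 ≤ (1 / 8) ^ 2 := by gcongr
      rw [hτ] at this
      linarith
    have h3 : lam * tailMass x ((2 * r) ^ 2) ≤ lam * (1 / 8) := by gcongr
    linarith
  have hE : (k : ℝ) * (k - 1) * ((v ⬝ᵥ B *ᵥ v) / n ^ 2) ≤ -(2 * P) := by
    have h1 : (k : ℝ) * (k - 1) * ((v ⬝ᵥ B *ᵥ v) / n ^ 2)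
        ≤ k * (3 / 4 * k) * (-(7 / 10 * lam) / n ^ 2) := by
      have h2 : (k : ℝ) * (k - 1) * ((v ⬝ᵥ B *ᵥ v) / n ^ 2)
          ≤ k * (k - 1) * (-(7 / 10 * lam) / n ^ 2) := by
        gcongr
        exact mul_nonneg (by linarith) (by linarith)
      refine h2.trans ?_
      refine mul_le_mul_of_nonpos_right ?_ ?_
      · gcongr
        linarith
      · exact div_nonpos_of_nonpos_of_nonneg (by linarith) (by positivity)
    have e : (k : ℝ) * (3 / 4 * k) * (-(7 / 10 * lam) / n ^ 2) = -(21 / 40) * (P * (P * lam)) := by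
      rw [hPdef]; field_simp; ring
    have h3 : P * 4 ≤ P * (P * lam) := by gcongr
    rw [e] at h1
    linarith
  have key := le_avg_isNegativeOn_of_mean (θ := 0) hk hB hB1 hx1 hx hr (hrP.trans hPdef) hlam.le
    (by rw [hrP]; exact h8) 0 (by rw [hrP]; linarith) (by simp; positivity)
    (by rw [hrP]; simp only [← hv]; linarith)
  refine key.trans (avg_mono k fun l _ => ?_)
  split_ifs with h1 h2 h2
  · exact le_rfl
  · refine absurd ⟨sampleVec v l, fun i hi => sampleVec_apply_eq_zero v l hi, ?_⟩ h2
    simpa using h1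
  · exact zero_le_one
  · exact le_rfl

open Classical in
/-- If `c` is an index with a heavy coordinate, then the star of `c` and `k` random indices sees a
negative direction, for a suitable `k` that is the smaller the heavier the coordinate. -/
lemma le_avg_isNegativeOn_cons {k : ℕ} [NeZero n] (hk : 4 ≤ k) (hB : Bᵀ = B)
    (hB1 : ∀ i j, |B i j| ≤ 1) (hx1 : ∑ i, x i ^ 2 = 1) (hx : B *ᵥ x = -(lam • x))
    (hlam : 0 < lam) (h2 : k / n * lam ≤ 2) (c : Fin n)
    (h16 : 16 ≤ k / n * (lam * x c) ^ 2) (h32 : k / n * (lam * x c) ^ 2 ≤ 32) :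
    1 / 16000 ≤ avg k fun l : List (Fin n) => if IsNegativeOn B (c :: l) then (1 : ℝ) else 0 := by
  have hn : (0 : ℝ) < n := by exact_mod_cast Nat.pos_of_ne_zero (NeZero.ne n)
  have hk' : (4 : ℝ) ≤ k := by exact_mod_cast hk
  set P : ℝ := k / n with hPdef
  have hP0 : 0 < P := by positivity
  set r := Real.sqrt P
  have hr : 0 < r := Real.sqrt_pos.2 hP0
  have hrP : r ^ 2 = P := Real.sq_sqrt hP0.le
  set v := truncate x ((2 * r) ^ 2) with hv
  have hτ : (2 * r) ^ 2 = 4 * P := by rw [mul_pow, hrP]; norm_num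
  have hη0 := tailMass_nonneg x ((2 * r) ^ 2)
  have hη1 : tailMass x ((2 * r) ^ 2) ≤ 1 := by
    have h1 := sum_truncate_sq_add x ((2 * r) ^ 2)
    have h2 : 0 ≤ ∑ i, truncate x ((2 * r) ^ 2) i ^ 2 := Finset.sum_nonneg fun i _ => sq_nonneg _
    linarith
  have hquad : v ⬝ᵥ B *ᵥ v ≤ lam + 1 / (4 * P) := by
    have h1 := (abs_le.1 (abs_quad_truncate_sub_le hB hB1 hx1 hx (t := 2 * r) (by positivity))).2
    have h2 : (tailMass x ((2 * r) ^ 2) / (2 * r)) ^ 2 ≤ 1 / (4 * P) := by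
      rw [div_pow, hτ]
      rw [hτ] at hη0 hη1
      gcongr
      exact pow_le_one₀ hη0 hη1
    have h3 : lam * tailMass x ((2 * r) ^ 2) ≤ lam * 1 := by gcongr
    linarith
  set w := (B *ᵥ v) c with hw
  set s := r * (lam * x c) with hs
  have hs2 : s ^ 2 = P * (lam * x c) ^ 2 := by rw [hs, mul_pow, hrP]
  have hs4 : 4 ≤ |s| := by
    have : (4 : ℝ) ^ 2 ≤ |s| ^ 2 := by rw [sq_abs, hs2]; linarith
    exact le_of_sq_le_sq this (abs_nonneg _)
  have hs6 : |s| ≤ 57 / 10 := by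
    have : |s| ^ 2 ≤ (57 / 10) ^ 2 := by rw [sq_abs, hs2]; linarith
    exact le_of_sq_le_sq this (by norm_num)
  have hws : |r * w + s| ≤ 1 / 2 := by
    have h1 := abs_mulVec_truncate_add_le hB1 hx (t := 2 * r) (by positivity) c
    have e : r * w + s = r * (w + lam * x c) := by rw [hs]; ring
    rw [e, abs_mul, abs_of_pos hr]
    calc _ ≤ r * (tailMass x ((2 * r) ^ 2) / (2 * r)) := by gcongr
      _ ≤ r * (1 / (2 * r)) := by gcongr
      _ = 1 / 2 := by field_simp
  have hw1 : 35 / 10 ≤ |r * w| := by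
    have h1 : |s| ≤ |r * w + s| + |r * w| := by
      have := abs_sub (r * w + s) (r * w)
      simpa using this
    linarith
  have hw2 : |r * w| ≤ 62 / 10 := by
    have h1 := abs_sub (r * w + s) s
    simp only [add_sub_cancel_right] at h1
    linarith
  -- the coefficient of `e_c` is as large as the coordinates of `v` can be, and its sign makes the
  -- cross term negative, which then outweighs all the other terms
  obtain ⟨θ, hθ, hθw⟩ : ∃ θ, θ ^ 2 = 4 * P ∧ θ * w = -(2 * |r * w|) := by
    rcases le_total 0 (r * w) with h | h
    · exact ⟨-(2 * r), by rw [neg_sq, hτ], by rw [abs_of_nonneg h]; ring⟩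
    · exact ⟨2 * r, hτ, by rw [abs_of_nonpos h]; ring⟩
  have hE : (k : ℝ) * (k - 1) * ((v ⬝ᵥ B *ᵥ v) / n ^ 2) ≤ 9 / 4 * P := by
    have h1 : (k : ℝ) * (k - 1) * ((v ⬝ᵥ B *ᵥ v) / n ^ 2)
        ≤ k * k * ((lam + 1 / (4 * P)) / n ^ 2) := by
      have h2 : (k : ℝ) * (k - 1) * ((v ⬝ᵥ B *ᵥ v) / n ^ 2)
          ≤ k * (k - 1) * ((lam + 1 / (4 * P)) / n ^ 2) := by
        gcongr
        exact mul_nonneg (by linarith) (by linarith)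
      refine h2.trans ?_
      gcongr
      linarith
    have e : (k : ℝ) * k * ((lam + 1 / (4 * P)) / n ^ 2) = P * (P * lam) + P / 4 := by
      rw [hPdef]; field_simp
    have h3 : P * (P * lam) ≤ P * 2 := by gcongr
    rw [e] at h1
    linarith
  have key := le_avg_isNegativeOn_of_mean (θ := θ) hk hB hB1 hx1 hx hr (hrP.trans hPdef) hlam.le
    (by rw [hrP]; linarith) c (by rw [hrP]; exact hθ.le) (by
      simp only [← hv, ← hw, hrP]
      have h1 : |r * w| ^ 2 ≤ (62 / 10) ^ 2 := by gcongr
      rw [sq_abs, mul_pow, hrP] at h1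
      rw [hθ]
      have h2 : 4 * P * (P ^ 2 * w ^ 2) = 4 * P ^ 2 * (P * w ^ 2) := by ring
      rw [h2]
      nlinarith [sq_nonneg P]) (by
      simp only [← hv, ← hw, hrP]
      have h1 : 2 * θ * (P * w) = 2 * P * (θ * w) := by ring
      rw [hθ, h1, hθw]
      nlinarith)
  refine key.trans (avg_mono k fun l _ => ?_)
  split_ifs with h1 h2 h2
  · exact le_rfl
  · refine absurd ⟨Pi.single c θ + sampleVec v l, fun i hi => ?_, h1⟩ h2
    simp only [List.mem_cons, not_or] at hi
    simp [sampleVec_apply_eq_zero v l hi.2, hi.1]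
  · exact zero_le_one
  · exact le_rfl

end Truncated

/-! ### A scale at which a random block sees a negative direction -/

open Classical in
lemma avg_forall_notMem {ι : Type*} [Fintype ι] [Nonempty ι] (k : ℕ) (S : Finset ι) :
    avg k (fun l => if ∀ c ∈ l, c ∉ S then (1 : ℝ) else 0) = (1 - S.card / Fintype.card ι) ^ k := by
  have hι : (Fintype.card ι : ℝ) ≠ 0 := by simp
  induction k with
  | zero => simp [avg]
  | succ k ih =>
    have h (j : ι) : avg k (fun l => if ∀ c ∈ j :: l, c ∉ S then (1 : ℝ) else 0)
        = (if j ∈ S then 0 else 1) * (1 - S.card / Fintype.card ι) ^ k := by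
      rw [← ih, ← avg_const_mul]
      refine avg_congr k fun l _ => ?_
      by_cases hj : j ∈ S <;> simp [hj]
    have h2 : ∑ j, (if j ∈ S then (0 : ℝ) else 1) = Fintype.card ι - S.card := by
      have h3 (j : ι) : (if j ∈ S then (0 : ℝ) else 1) = 1 - if j ∈ S then 1 else 0 := by
        split_ifs <;> simp
      simp only [h3, Finset.sum_sub_distrib]
      simp
    rw [avg_succ]
    simp only [h, ← Finset.sum_mul, h2]
    rw [pow_succ]
    field_simp

open Classical in
/-- `k` samples hit a set of density `q` with probability of order `min (k q) 1`. -/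
lemma le_avg_exists_mem {ι : Type*} [Fintype ι] [Nonempty ι] (k : ℕ) (S : Finset ι) {p : ℝ}
    (hp0 : 0 ≤ p) (hp1 : p ≤ 1) (hp : p ≤ k * (S.card / Fintype.card ι)) :
    p / 2 ≤ avg k (fun l => if ∃ c ∈ l, c ∈ S then (1 : ℝ) else 0) := by
  have h1 : avg k (fun l => if ∃ c ∈ l, c ∈ S then (1 : ℝ) else 0)
      = 1 - (1 - S.card / Fintype.card ι) ^ k := by
    rw [← avg_forall_notMem, eq_sub_iff_add_eq, ← avg_add]
    refine (avg_congr k fun l _ => ?_).trans (avg_const k 1)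
    by_cases h : ∃ c ∈ l, c ∈ S
    · rw [if_pos h, if_neg (by simpa using h), add_zero]
    · rw [if_neg h, if_pos (by simpa using h), zero_add]
  rw [h1]
  have hι : (0 : ℝ) < Fintype.card ι := by exact_mod_cast Fintype.card_pos
  set q : ℝ := S.card / Fintype.card ι with hq
  have hq0 : 0 ≤ q := by positivity
  have hq1 : q ≤ 1 := by
    rw [hq, div_le_one hι]
    exact_mod_cast Finset.card_le_univ S
  have h2 : (1 - q) ^ k * (1 + q) ^ k ≤ 1 := by
    rw [← mul_pow]
    exact pow_le_one₀ (mul_nonneg (by linarith) (by linarith)) (by nlinarith)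
  have h3 := one_add_mul_le_pow (a := q) (by linarith) k
  have h4 : 0 ≤ (1 - q) ^ k := pow_nonneg (by linarith) k
  have h5 : (1 - q) ^ k * (1 + p) ≤ 1 :=
    (mul_le_mul_of_nonneg_left (by linarith) h4).trans h2
  nlinarith

open Classical in
/-- The central estimate: if the form of `B` takes a value of at most `-ε n` on the unit ball, then
at some scale `2 ^ j` a block of `2 * 2 ^ j` random indices sees a negative direction with a
probability of at least `1 / 4 ^ (J - j)`, up to a factor of order `J`. -/
theorem exists_scale {n : ℕ} [NeZero n] {B : Matrix (Fin n) (Fin n) ℝ} (hB : Bᵀ = B)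
    (hB1 : ∀ i j, |B i j| ≤ 1) {ε : ℝ} (hε : 0 < ε) {z : Fin n → ℝ} (hz : ∑ i, z i ^ 2 ≤ 1)
    (h : z ⬝ᵥ B *ᵥ z ≤ -(ε * n)) {J : ℕ} (hJ : 8 ≤ ε * 2 ^ J) :
    ∃ j ≤ J, 1 / (128000 * (J + 1) * 4 ^ (J - j)) ≤
      avg (2 * 2 ^ j) fun l : List (Fin n) => if IsNegativeOn B l then (1 : ℝ) else 0 := by
  have hn : (0 : ℝ) < n := by exact_mod_cast Nat.pos_of_ne_zero (NeZero.ne n)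
  obtain ⟨x, lam, hlam, hx1, hx⟩ := exists_eigenvector_le hB (by positivity) hz h
  have hlam0 : 0 < lam := lt_of_lt_of_le (by positivity) hlam
  -- the image of the unit vector `x` has entries of square at most `n`
  have hBx (i) : (lam * x i) ^ 2 ≤ n := by
    have h1 : lam * x i = -(B *ᵥ x) i := by rw [hx]; simp
    rw [h1, neg_sq, mulVec, dotProduct]
    refine (Finset.sum_mul_sq_le_sq_mul_sq _ _ _).trans ?_
    rw [hx1, mul_one]
    calc ∑ j, B i j ^ 2 ≤ ∑ _j : Fin n, (1 : ℝ) := by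
          refine Finset.sum_le_sum fun j _ => ?_
          rw [← sq_abs]
          exact pow_le_one₀ (abs_nonneg _) (hB1 i j)
      _ = n := by simp
  have hlamn : lam ≤ n := by
    have h1 : lam ^ 2 ≤ n ^ 2 := by
      calc lam ^ 2 = ∑ i, (lam * x i) ^ 2 := by
            simp only [mul_pow, ← Finset.mul_sum, hx1, mul_one]
        _ ≤ ∑ _i : Fin n, (n : ℝ) := Finset.sum_le_sum fun i _ => hBx i
        _ = n ^ 2 := by simp [sq]
    exact le_of_sq_le_sq h1 hn.le
  have hJ' : 8 / ε ≤ 2 ^ J := by rw [div_le_iff₀ hε]; linarith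
  have hnl : n / lam ≤ 1 / ε := by
    rw [div_le_div_iff₀ hlam0 hε]
    linarith
  have two_pow_le {j : ℕ} (hj : (2 : ℝ) ^ j ≤ 8 * (n / lam)) : j ≤ J := by
    have h1 : (2 : ℝ) ^ j ≤ 2 ^ J := by
      have : 8 * (n / lam) ≤ 8 * (1 / ε) := by gcongr
      rw [mul_one_div] at this
      linarith
    exact (pow_le_pow_iff_right₀ (by norm_num)).1 h1
  have factor_le {j : ℕ} (hj : j ≤ J) :
      1 / (128000 * (J + 1) * 4 ^ (J - j)) ≤ (1 / 16000 : ℝ) := by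
    have h4 : (1 : ℝ) ≤ 4 ^ (J - j) := one_le_pow₀ (by norm_num)
    have h5 : (1 : ℝ) ≤ J + 1 := by linarith [Nat.cast_nonneg (α := ℝ) J]
    have h6 : (1 : ℝ) ≤ (J + 1) * 4 ^ (J - j) := one_le_mul_of_one_le_of_one_le h5 h4
    apply one_div_le_one_div_of_le (by norm_num)
    linarith
  by_cases hlight : tailMass x (16 / lam) ≤ 1 / 8
  · -- scale `n / lam`
    obtain ⟨j, hj1, hj2⟩ := exists_nat_pow_near (x := 8 * (n / lam)) (y := 2)
      (by have : 1 ≤ n / lam := by rw [one_le_div hlam0]; exact hlamn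
          linarith) (by norm_num)
    have hjJ := two_pow_le hj1
    refine ⟨j, hjJ, (factor_le hjJ).trans ?_⟩
    have h8 : ((2 ^ j : ℕ) : ℝ) / n * lam ≤ 8 := by
      push_cast
      calc (2 : ℝ) ^ j / n * lam ≤ 8 * (n / lam) / n * lam := by gcongr
        _ = 8 := by field_simp
    have h4 : 4 ≤ ((2 ^ j : ℕ) : ℝ) / n * lam := by
      push_cast
      rw [pow_succ] at hj2
      calc (4 : ℝ) = 4 * (n / lam) / n * lam := by field_simp
        _ ≤ (2 : ℝ) ^ j / n * lam := by gcongr; linarith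
    have hk4 : 4 ≤ 2 ^ j := by
      have h5 : 4 * (n / lam) < 2 ^ j := by rw [pow_succ] at hj2; linarith
      have h6 : 1 ≤ n / lam := by rw [one_le_div hlam0]; exact hlamn
      have h7 : (4 : ℝ) ≤ ((2 ^ j : ℕ) : ℝ) := by push_cast; linarith
      exact_mod_cast h7
    have key := le_avg_isNegativeOn_of_light hk4 hB hB1 hx1 hx hlam0 h4 h8 hlight
    rw [two_mul, avg_append, ← avg_const (ι := Fin n) (2 ^ j) (1 / 16000)]
    refine avg_mono _ fun l _ => key.trans (avg_mono _ fun l' _ => ?_)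
    split_ifs with h1 h2 h2
    · exact le_rfl
    · exact absurd (h1.mono fun i hi => by simp [hi]) h2
    · exact zero_le_one
    · exact le_rfl
  · -- some dyadic level of heavy coordinates has a mass of order at least `1 / J`
    push Not at hlight
    set S : ℕ → Finset (Fin n) := fun j => univ.filter fun i =>
      16 ≤ ((2 ^ j : ℕ) : ℝ) / n * (lam * x i) ^ 2 ∧ ((2 ^ j : ℕ) : ℝ) / n * (lam * x i) ^ 2 ≤ 32 ∧
      ((2 ^ j : ℕ) : ℝ) / n * lam ≤ 2 with hS
    have level (i : Fin n) (hi : ¬ x i ^ 2 ≤ 16 / lam) : ∃ j ∈ range (J + 1), i ∈ S j := by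
      rw [div_eq_mul_one_div, not_le, mul_one_div, div_lt_iff₀ hlam0] at hi
      have hs : 16 * lam ≤ (lam * x i) ^ 2 := by
        have : (lam * x i) ^ 2 = lam * (x i ^ 2 * lam) := by ring
        rw [this]
        nlinarith
      have hs0 : 0 < (lam * x i) ^ 2 := lt_of_lt_of_le (by positivity) hs
      obtain ⟨j, hj1, hj2⟩ := exists_nat_pow_near (x := 32 * n / (lam * x i) ^ 2) (y := 2)
        (by rw [one_le_div hs0]; linarith [hBx i]) (by norm_num)
      have h1 : 32 * n / (lam * x i) ^ 2 ≤ 2 * (n / lam) := by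
        rw [div_le_iff₀ hs0]
        calc 32 * (n : ℝ) = 2 * (n / lam) * (16 * lam) := by field_simp; ring
          _ ≤ _ := by gcongr
      have h2 : 0 ≤ n / lam := by positivity
      refine ⟨j, mem_range.2 (Nat.lt_succ_of_le (two_pow_le (by linarith))), ?_⟩
      rw [hS, mem_filter]
      refine ⟨mem_univ _, ?_, ?_, ?_⟩
      · push_cast
        rw [pow_succ 2 j, div_lt_iff₀ hs0] at hj2
        rw [div_mul_eq_mul_div, le_div_iff₀ hn]
        linarith
      · push_cast
        rw [le_div_iff₀ hs0] at hj1
        rw [div_mul_eq_mul_div, div_le_iff₀ hn]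
        linarith
      · push_cast
        calc (2 : ℝ) ^ j / n * lam ≤ 2 * (n / lam) / n * lam := by
              gcongr
              linarith
          _ = 2 := by field_simp
    obtain ⟨j, hj, hmass⟩ : ∃ j ∈ range (J + 1), 1 / (8 * (J + 1 : ℝ)) ≤ ∑ i ∈ S j, x i ^ 2 := by
      by_contra hcon
      push Not at hcon
      have h1 : tailMass x (16 / lam) ≤
          ∑ i, ∑ j ∈ range (J + 1), if i ∈ S j then x i ^ 2 else 0 := by
        refine Finset.sum_le_sum fun i _ => ?_
        have hnn : ∀ j ∈ range (J + 1), 0 ≤ if i ∈ S j then x i ^ 2 else 0 := fun j _ => by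
          split_ifs <;> positivity
        split_ifs with hi
        · exact Finset.sum_nonneg hnn
        · obtain ⟨j, hj, hij⟩ := level i hi
          refine le_trans ?_ (Finset.single_le_sum hnn hj)
          rw [if_pos hij]
      rw [Finset.sum_comm] at h1
      have h2 : ∑ j ∈ range (J + 1), ∑ i, (if i ∈ S j then x i ^ 2 else 0)
          ≤ ∑ j ∈ range (J + 1), 1 / (8 * (J + 1 : ℝ)) := by
        refine Finset.sum_le_sum fun j hj => ?_
        rw [Finset.sum_ite_mem, univ_inter]
        exact (hcon j hj).le
      have h3 : ∑ j ∈ range (J + 1), 1 / (8 * (J + 1 : ℝ)) = 1 / 8 := by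
        rw [Finset.sum_const, card_range, nsmul_eq_mul]
        push_cast
        field_simp
      linarith
    have hjJ : j ≤ J := Nat.lt_succ_iff.1 (mem_range.1 hj)
    refine ⟨j, hjJ, ?_⟩
    have hne : (S j).Nonempty := by
      rw [Finset.nonempty_iff_ne_empty]
      intro h0
      rw [h0, Finset.sum_empty] at hmass
      have : (0 : ℝ) < 1 / (8 * (J + 1)) := by positivity
      linarith
    obtain ⟨i₀, hi₀⟩ := hne
    set k : ℕ := 2 ^ j with hk
    have hSmem (i : Fin n) (hi : i ∈ S j) := (mem_filter.1 hi).2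
    have hk2 := (hSmem i₀ hi₀).2.2
    have hk16 : (16 : ℝ) ≤ k := by
      refine (hSmem i₀ hi₀).1.trans ?_
      calc (k : ℝ) / n * (lam * x i₀) ^ 2 ≤ k / n * n := by gcongr; exact hBx i₀
        _ = k := by field_simp
    have hk4 : 4 ≤ k := by
      have : (4 : ℝ) ≤ k := by linarith
      exact_mod_cast this
    -- the level has many elements, since each of them carries little mass
    have hcard : (k / n * lam) ^ 2 / (256 * (J + 1)) ≤ k * ((S j).card / Fintype.card (Fin n)) := by
      have h1 : ∑ i ∈ S j, x i ^ 2 ≤ (S j).card * (32 / (k / n * lam ^ 2)) := by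
        rw [← nsmul_eq_mul]
        refine Finset.sum_le_card_nsmul _ _ _ fun i hi => ?_
        rw [le_div_iff₀ (by positivity)]
        have := (hSmem i hi).2.1
        rw [mul_pow] at this
        linarith
      have h2 := hmass.trans h1
      rw [Fintype.card_fin]
      have h3 : 1 / (8 * (J + 1 : ℝ)) * ((k / n * lam) ^ 2 / 32)
          ≤ (S j).card * (32 / (k / n * lam ^ 2)) * ((k / n * lam) ^ 2 / 32) := by gcongr
      have e1 : 1 / (8 * (J + 1 : ℝ)) * ((k / n * lam) ^ 2 / 32)
          = (k / n * lam) ^ 2 / (256 * (J + 1)) := by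
        field_simp
        ring
      have e2 : (S j).card * (32 / (k / n * lam ^ 2)) * ((k / n * lam) ^ 2 / 32)
          = k * ((S j).card / n) := by
        field_simp
      rw [e1, e2] at h3
      exact h3
    have hkl0 : 0 ≤ k / n * lam := by positivity
    have hJ1 : (1 : ℝ) ≤ J + 1 := by linarith [Nat.cast_nonneg (α := ℝ) J]
    have hhit := le_avg_exists_mem k (S j) (by positivity) (by
      rw [div_le_one (by positivity)]
      nlinarith) hcard
    have hstep : avg k (fun l => (if ∃ c ∈ l, c ∈ S j then (1 : ℝ) else 0) * (1 / 16000))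
        ≤ avg (2 * k) fun l : List (Fin n) => if IsNegativeOn B l then (1 : ℝ) else 0 := by
      rw [two_mul, avg_append]
      refine avg_mono _ fun l _ => ?_
      split_ifs with hl
      · obtain ⟨c, hcl, hcS⟩ := hl
        have hc := hSmem c hcS
        rw [one_mul]
        refine (le_avg_isNegativeOn_cons hk4 hB hB1 hx1 hx hlam0 hk2 c hc.1 hc.2.1).trans
          (avg_mono _ fun l' _ => ?_)
        split_ifs with h1 h2 h2
        · exact le_rfl
        · refine absurd (h1.mono fun i hi => ?_) h2
          rcases List.mem_cons.1 hi with rfl | hi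
          · simp [hcl]
          · simp [hi]
        · exact zero_le_one
        · exact le_rfl
      · rw [zero_mul]
        exact avg_nonneg _ fun l' _ => by split_ifs <;> norm_num
    rw [avg_mul_const] at hstep
    refine le_trans ?_ hstep
    have h1 : 8 ≤ k / n * lam * 2 ^ (J - j) := by
      have e : (2 : ℝ) ^ J = 2 ^ j * 2 ^ (J - j) := by rw [← pow_add]; congr 1; omega
      have e2 : ε ≤ lam / n := by rw [le_div_iff₀ hn]; exact hlam
      calc 8 ≤ ε * 2 ^ J := hJ
        _ ≤ lam / n * 2 ^ J := by gcongr
        _ = k / n * lam * 2 ^ (J - j) := by rw [e, hk]; push_cast; ring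
    have h2 : 64 ≤ (k / n * lam) ^ 2 * 4 ^ (J - j) := by
      have e : (4 : ℝ) ^ (J - j) = (2 ^ (J - j)) ^ 2 := by
        rw [← pow_mul, mul_comm, pow_mul]; norm_num
      rw [e, ← mul_pow]
      nlinarith
    have hhit' : (k / n * lam) ^ 2 / (256 * (J + 1 : ℝ)) / 2
        ≤ avg k (fun l => if ∃ c ∈ l, c ∈ S j then (1 : ℝ) else 0) := by convert hhit
    refine le_trans ?_ (mul_le_mul_of_nonneg_right hhit' (by norm_num))
    rw [div_le_iff₀ (by positivity)]
    have e : (k / n * lam) ^ 2 / (256 * (J + 1 : ℝ)) / 2 * (1 / 16000)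
        * (128000 * (J + 1) * 4 ^ (J - j)) = (k / n * lam) ^ 2 * 4 ^ (J - j) / 64 := by
      field_simp
      ring
    rw [e]
    linarith

/-! ### From the test on a block of samples to the whole sequence of samples -/

/-- The submatrix of `O` on the indices `I 0, …, I (k - 1)`, in this order and with repetitions. -/
def blockMatrix (O : ℕ → ℕ → ℝ) (I : ℕ → ℕ) (k : ℕ) : Matrix (Fin k) (Fin k) ℝ :=
  of fun a b => O (I a) (I b)

/-- The trace test with `N` squarings rejects the block of the indices `I 0, …, I (k - 1)`. -/
def Detects (O : ℕ → ℕ → ℝ) (N : ℕ) (I : ℕ → ℕ) (k : ℕ) : Prop :=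
  (k : ℝ) < (shifted (blockMatrix O I k) ^ 2 ^ N).trace

lemma blockMatrix_congr (O : ℕ → ℕ → ℝ) {I I' : ℕ → ℕ} {k : ℕ} (h : ∀ a < k, I a = I' a) :
    blockMatrix O I k = blockMatrix O I' k := by
  ext a b
  simp only [blockMatrix, of_apply, h a a.2, h b b.2]

lemma detects_congr (O : ℕ → ℕ → ℝ) (N : ℕ) {I I' : ℕ → ℕ} {k : ℕ} (h : ∀ a < k, I a = I' a) :
    Detects O N I k ↔ Detects O N I' k := by
  rw [Detects, Detects, blockMatrix_congr O h]

/-- The form of a submatrix with possibly repeated indices. -/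
lemma quad_submatrix {ι κ : Type*} [Fintype ι] [Fintype κ] [DecidableEq ι] (A : Matrix ι ι ℝ)
    (f : κ → ι) (z : κ → ℝ) : z ⬝ᵥ A.submatrix f f *ᵥ z
      = (fun i => ∑ a with f a = i, z a) ⬝ᵥ A *ᵥ (fun i => ∑ a with f a = i, z a) := by
  have h (g : ι → ℝ) : ∑ i, (∑ a with f a = i, z a) * g i = ∑ a, z a * g (f a) := by
    simp only [Finset.sum_mul]
    rw [← Finset.sum_fiberwise univ f fun a => z a * g (f a)]
    refine Finset.sum_congr rfl fun i _ => Finset.sum_congr rfl fun a ha => ?_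
    rw [(mem_filter.1 ha).2]
  rw [dotProduct, dotProduct, h]
  refine Finset.sum_congr rfl fun a _ => ?_
  congr 1
  rw [mulVec, mulVec, dotProduct, dotProduct]
  simp only [mul_comm (A _ _)]
  rw [h]
  simp [submatrix_apply, mul_comm]

lemma IsPSD.submatrix {ι κ : Type} [Fintype ι] [Fintype κ] {A : Matrix ι ι ℝ}
    (hA : IsPSD A) (f : κ → ι) : IsPSD (A.submatrix f f) := fun z => by
  classical
  rw [quad_submatrix]
  exact hA _

lemma blockMatrix_oracle {n : ℕ} (A : Matrix (Fin n) (Fin n) ℝ) (f : ℕ → Fin n) (k : ℕ) :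
    blockMatrix (oracle A) (fun a => (f a : ℕ)) k
      = A.submatrix (fun a : Fin k => f a) (fun a : Fin k => f a) := by
  ext a b
  simp [blockMatrix, oracle]

lemma not_detects_of_isPSD {n : ℕ} {A : Matrix (Fin n) (Fin n) ℝ} (hA1 : ∀ i j, |A i j| ≤ 1)
    (hA : IsPSD A) (N : ℕ) (f : ℕ → Fin n) {k : ℕ} (hk : 1 ≤ k) :
    ¬ Detects (oracle A) N (fun a => (f a : ℕ)) k := by
  rw [Detects, not_lt, blockMatrix_oracle]
  exact trace_shifted_pow_le _ hk (fun _ _ => hA1 _ _) (hA.submatrix _) N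

lemma not_isPSD_principal_of_detects {n : ℕ} {A : Matrix (Fin n) (Fin n) ℝ}
    (hA1 : ∀ i j, |A i j| ≤ 1) {N : ℕ} {f : ℕ → Fin n} {k : ℕ} (hk : 1 ≤ k)
    (h : Detects (oracle A) N (fun a => (f a : ℕ)) k) :
    ¬ IsPSD (principal A ((range k).image f)) := by
  intro hT
  have h1 := hT.submatrix fun a : Fin k =>
    (⟨f a, mem_image_of_mem f (mem_range.2 a.2)⟩ : {x // x ∈ (range k).image f})
  have h2 := trace_shifted_pow_le _ hk (fun _ _ => hA1 _ _) h1 N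
  rw [Detects, blockMatrix_oracle] at h
  exact absurd h2 (not_le.2 h)

/-- The matrix `((A + Aᵀ) / 2 + δ) / 2`: a negative value of its form is a value of the form of `A`
that is negative by a margin. -/
noncomputable def symmShift {n : ℕ} (A : Matrix (Fin n) (Fin n) ℝ) (δ : ℝ) :
    Matrix (Fin n) (Fin n) ℝ :=
  (1 / 4 : ℝ) • (A + Aᵀ) + (δ / 2) • (1 : Matrix (Fin n) (Fin n) ℝ)

lemma quad_symmShift {n : ℕ} (A : Matrix (Fin n) (Fin n) ℝ) (δ : ℝ) (y : Fin n → ℝ) :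
    y ⬝ᵥ symmShift A δ *ᵥ y = (y ⬝ᵥ A *ᵥ y + δ * (y ⬝ᵥ y)) / 2 := by
  rw [symmShift, add_mulVec, smul_mulVec, smul_mulVec, add_mulVec, one_mulVec, dotProduct_add,
    dotProduct_smul, dotProduct_smul, dotProduct_add, dotProduct_transpose_mulVec_self]
  simp only [smul_eq_mul]
  ring

lemma symmShift_transpose {n : ℕ} (A : Matrix (Fin n) (Fin n) ℝ) (δ : ℝ) :
    (symmShift A δ)ᵀ = symmShift A δ := by
  simp [symmShift, add_comm]

lemma abs_symmShift_le {n : ℕ} {A : Matrix (Fin n) (Fin n) ℝ} (hA : ∀ i j, |A i j| ≤ 1) {δ : ℝ}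
    (hδ0 : 0 ≤ δ) (hδ1 : δ ≤ 1) (i j : Fin n) : |symmShift A δ i j| ≤ 1 := by
  have h1 := abs_le.1 (hA i j)
  have h2 := abs_le.1 (hA j i)
  have h3 : 0 ≤ δ / 2 * (1 : Matrix (Fin n) (Fin n) ℝ) i j ∧
      δ / 2 * (1 : Matrix (Fin n) (Fin n) ℝ) i j ≤ 1 / 2 := by
    rw [one_apply]
    split_ifs
    · constructor <;> linarith
    · constructor <;> norm_num
  simp only [symmShift, Matrix.add_apply, Matrix.smul_apply, transpose_apply, smul_eq_mul]
  rw [abs_le]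
  constructor <;> linarith [h3.1, h3.2]

/-- A vector on the set of the sampled indices is spread evenly over the repetitions of each
index, which does not increase its norm. -/
lemma exists_quad_submatrix_lt {n k : ℕ} (A : Matrix (Fin n) (Fin n) ℝ) {δ : ℝ} (hδ : 0 ≤ δ)
    (f : Fin k → Fin n) {l : List (Fin n)} (hl : ∀ i ∈ l, ∃ a, f a = i)
    (h : IsNegativeOn (symmShift A δ) l) :
    ∃ z : Fin k → ℝ, z ⬝ᵥ A.submatrix f f *ᵥ z < -(δ * (z ⬝ᵥ z)) := by
  obtain ⟨y, hy, h⟩ := h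
  rw [quad_symmShift] at h
  set cnt : Fin n → ℝ := fun i => ((univ.filter fun a => f a = i).card : ℝ) with hcnt
  have hfib (i : Fin n) : ∑ a with f a = i, y (f a) / cnt (f a) = y i := by
    have h1 : ∑ a with f a = i, y (f a) / cnt (f a) = ∑ a with f a = i, y i / cnt i :=
      Finset.sum_congr rfl fun a ha => by rw [(mem_filter.1 ha).2]
    rw [h1, Finset.sum_const, nsmul_eq_mul]
    by_cases hi : i ∈ l
    · obtain ⟨a, ha⟩ := hl i hi
      have : cnt i ≠ 0 := by
        simp only [hcnt]
        exact_mod_cast (Finset.card_pos.2 ⟨a, by simp [ha]⟩).ne'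
      change cnt i * (y i / cnt i) = y i
      field_simp
    · simp [hy i hi]
  refine ⟨fun a => y (f a) / cnt (f a), ?_⟩
  have hz : (fun a => y (f a) / cnt (f a)) ⬝ᵥ (fun a => y (f a) / cnt (f a)) ≤ y ⬝ᵥ y := by
    rw [dotProduct, ← Finset.sum_fiberwise univ f, dotProduct]
    refine Finset.sum_le_sum fun i _ => ?_
    have h1 : ∑ a with f a = i, y (f a) / cnt (f a) * (y (f a) / cnt (f a))
        = ∑ a with f a = i, y (f a) / cnt (f a) * (y i / cnt i) :=
      Finset.sum_congr rfl fun a ha => by rw [(mem_filter.1 ha).2]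
    rw [h1, ← Finset.sum_mul, hfib]
    rcases Nat.eq_zero_or_pos (univ.filter fun a => f a = i).card with h0 | h0
    · simp only [hcnt, h0]
      simpa using mul_self_nonneg (y i)
    · have h2 : 1 ≤ cnt i := by simp only [hcnt]; exact_mod_cast h0
      rw [← mul_div_assoc]
      exact div_le_self (mul_self_nonneg _) h2
  rw [quad_submatrix]
  simp only [hfib]
  have := mul_le_mul_of_nonneg_left hz hδ
  linarith

/-- The sequence of the natural numbers listed in `l`, continued by `0`. -/
def listIdx {n : ℕ} (l : List (Fin n)) (a : ℕ) : ℕ := (l.map Fin.val).getD a 0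

open Classical in
/-- The probability that a block of samples at a suitable scale is rejected. -/
lemma exists_scale_detects {n : ℕ} [NeZero n] {A : Matrix (Fin n) (Fin n) ℝ}
    (hA : ∀ i j, |A i j| ≤ 1) {ε : ℝ} (hε : 0 < ε) (hε1 : ε ≤ 1) {z : Fin n → ℝ}
    (hz : ∑ i, z i ^ 2 ≤ 1) (h : z ⬝ᵥ A *ᵥ z ≤ -(ε * n)) {J N : ℕ} (hJ : 32 ≤ ε * 2 ^ J)
    (hN : 8 * 4 ^ J / ε ≤ 2 ^ (N + 1)) :
    ∃ j ≤ J, 1 / (128000 * (J + 1) * 4 ^ (J - j)) ≤ avg (2 * 2 ^ j) fun l : List (Fin n) =>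
      if Detects (oracle A) (N + 1) (listIdx l) (2 * 2 ^ j) then (1 : ℝ) else 0 := by
  have hn : (1 : ℝ) ≤ n := by exact_mod_cast Nat.one_le_iff_ne_zero.2 (NeZero.ne n)
  have hzz : z ⬝ᵥ z ≤ 1 := by simpa [dotProduct, ← sq] using hz
  have hB : z ⬝ᵥ symmShift A (ε / 2) *ᵥ z ≤ -(ε / 4 * n) := by
    rw [quad_symmShift]
    nlinarith
  -- half of the negative value is given up for the margin `ε / 2`, and another half is lost since
  -- `symmShift` halves the form, so that `exists_scale` is applied with `ε / 4`
  obtain ⟨j, hj, hp⟩ := exists_scale (symmShift_transpose A (ε / 2))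
    (abs_symmShift_le hA (by linarith) (by linarith)) (by linarith : 0 < ε / 4) hz hB
    (J := J) (by linarith)
  refine ⟨j, hj, hp.trans (avg_mono _ fun l hl => ?_)⟩
  split_ifs with h1 h2 h2
  · exact le_rfl
  · refine absurd ?_ h2
    set k := 2 * 2 ^ j with hk
    obtain ⟨w, hw⟩ := exists_quad_submatrix_lt (k := k) A (by linarith)
      (fun a => l.get (a.cast hl.symm))
      (fun i hi => by
        obtain ⟨a, ha⟩ := List.get_of_mem hi
        exact ⟨a.cast hl, by simpa using ha⟩) h1
    have hblock : blockMatrix (oracle A) (listIdx l) k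
        = A.submatrix (fun a : Fin k => l.get (a.cast hl.symm))
          (fun a : Fin k => l.get (a.cast hl.symm)) := by
      have hidx (a : Fin k) : listIdx l a = (l.get (a.cast hl.symm) : ℕ) := by
        have ha : (a : ℕ) < l.length := by rw [hl]; exact a.2
        simp [listIdx, List.getD, ha]
      ext a b
      simp only [blockMatrix, of_apply, hidx, submatrix_apply]
      simp [oracle]
    rw [Detects, hblock]
    refine lt_trace_shifted_pow _ w (ε / 2) (by linarith) hw N ?_
    rw [div_le_iff₀ hε] at hN
    have h4 : (4 : ℝ) ^ j ≤ 4 ^ J := pow_le_pow_right₀ (by norm_num) hj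
    have e : (k : ℝ) ^ 2 = 4 * 4 ^ j := by
      rw [hk]
      push_cast
      rw [mul_pow, ← pow_mul, mul_comm j 2, pow_mul]
      norm_num
    rw [e]
    linarith
  · exact zero_le_one
  · exact le_rfl

/-! ### The blocks of samples -/

/-- The offset and the length of each of the consecutive blocks of the lengths in a list. -/
def blocks : ℕ → List ℕ → List (ℕ × ℕ)
  | _, [] => []
  | t, k :: ks => (t, k) :: blocks (t + k) ks

lemma blocks_append (t : ℕ) (ks ks' : List ℕ) :
    blocks t (ks ++ ks') = blocks t ks ++ blocks (t + ks.sum) ks' := by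
  induction ks generalizing t with
  | nil => simp [blocks]
  | cons k ks ih => simp [blocks, ih, add_assoc]

lemma sampledSets_eq_map {n : ℕ} (ρ : ℕ → Fin n) (t : ℕ) (ks : List ℕ) :
    sampledSets ρ t ks = (blocks t ks).map fun b => (range b.2).image fun a => ρ (b.1 + a) := by
  induction ks generalizing t with
  | nil => rfl
  | cons k ks ih => simp [sampledSets, blocks, ih]

lemma snd_mem_of_mem_blocks {t : ℕ} {ks : List ℕ} {b : ℕ × ℕ} (h : b ∈ blocks t ks) :
    b.2 ∈ ks := by
  induction ks generalizing t with
  | nil => simp [blocks] at h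
  | cons k ks ih =>
    rcases List.mem_cons.1 h with rfl | h
    · simp
    · exact List.mem_cons_of_mem _ (ih h)

/-- None of the consecutive blocks, of the given lengths, of a list of samples satisfies `D`. -/
def NoBlock {ι : Type*} (D : ℕ → List ι → Prop) : List ℕ → List ι → Prop
  | [], _ => True
  | k :: ks, l => ¬ D k (l.take k) ∧ NoBlock D ks (l.drop k)

lemma noBlock_map_range' {ι : Type*} (D : ℕ → List ι → Prop) (ρ : ℕ → ι) (t : ℕ) (ks : List ℕ) :
    NoBlock D ks ((List.range' t ks.sum).map ρ)
      ↔ ∀ b ∈ blocks t ks, ¬ D b.2 ((List.range' b.1 b.2).map ρ) := by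
  induction ks generalizing t with
  | nil => simp [NoBlock, blocks]
  | cons k ks ih =>
    have h : (List.range' t (k :: ks).sum).map ρ
        = (List.range' t k).map ρ ++ (List.range' (t + k) ks.sum).map ρ := by
      rw [← List.map_append, List.sum_cons, List.range'_append_1]
    rw [NoBlock, h, List.take_left' (by simp), List.drop_left' (by simp), ih]
    simp [blocks]

open Classical in
/-- Consecutive blocks are independent. -/
lemma avg_noBlock {ι : Type*} [Fintype ι] (D : ℕ → List ι → Prop) (ks : List ℕ) :
    avg ks.sum (fun l => if NoBlock D ks l then (1 : ℝ) else 0)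
      = (ks.map fun k => avg k fun l => if D k l then (0 : ℝ) else 1).prod := by
  induction ks with
  | nil => simp [NoBlock, avg]
  | cons k ks ih =>
    rw [List.sum_cons, List.map_cons, List.prod_cons, ← ih, ← avg_take_mul_drop]
    refine avg_congr _ fun l _ => ?_
    by_cases h1 : D k (l.take k) <;> by_cases h2 : NoBlock D ks (l.drop k) <;>
      simp [NoBlock, h1, h2]

/-- The sizes of the blocks: at each of the scales `2 ^ j`, `j ≤ J`, a number of blocks of
`2 * 2 ^ j` indices, such that all scales have about the same total number of entries. -/
def sizes (J : ℕ) : List ℕ :=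
  (List.range (J + 1)).flatMap fun j => List.replicate (256000 * (J + 1) * 4 ^ (J - j)) (2 * 2 ^ j)

lemma prod_flatMap_le {κ : Type*} (L : List κ) (f : κ → List ℝ)
    (h : ∀ j, ∀ x ∈ f j, 0 ≤ x ∧ x ≤ 1) {j : κ} (hj : j ∈ L) :
    (L.flatMap f).prod ≤ (f j).prod := by
  have h01 (l : List ℝ) (hl : ∀ x ∈ l, 0 ≤ x ∧ x ≤ 1) : 0 ≤ l.prod ∧ l.prod ≤ 1 := by
    induction l with
    | nil => simp
    | cons x l ih =>
      have h1 := hl x (by simp)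
      have h2 := ih fun y hy => hl y (by simp [hy])
      rw [List.prod_cons]
      exact ⟨mul_nonneg h1.1 h2.1, mul_le_one₀ h1.2 h2.1 h2.2⟩
  induction L with
  | nil => simp at hj
  | cons i L ih =>
    rw [List.flatMap_cons, List.prod_append]
    have hi := h01 (f i) (h i)
    have hL := h01 (L.flatMap f) fun x hx => by
      obtain ⟨i', -, hx⟩ := List.mem_flatMap.1 hx
      exact h i' x hx
    rcases List.mem_cons.1 hj with rfl | hj
    · exact mul_le_of_le_one_right hi.1 hL.2
    · exact (mul_le_of_le_one_left hL.1 hi.2).trans (ih hj)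

open Classical in
/-- If some scale has blocks that satisfy `D` with the probability given by the central estimate,
then the probability that no block does is at most `1 / 4`. -/
lemma avg_noBlock_sizes_le {ι : Type*} [Fintype ι] [Nonempty ι] (D : ℕ → List ι → Prop) {J j : ℕ}
    (hj : j ≤ J) (h : 1 / (128000 * (J + 1) * 4 ^ (J - j)) ≤
      avg (2 * 2 ^ j) fun l => if D (2 * 2 ^ j) l then (1 : ℝ) else 0) :
    avg (sizes J).sum (fun l => if NoBlock D (sizes J) l then (1 : ℝ) else 0) ≤ 1 / 4 := by
  have hcompl (k : ℕ) : avg k (fun l => if D k l then (0 : ℝ) else 1)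
      = 1 - avg k fun l => if D k l then (1 : ℝ) else 0 := by
    rw [eq_sub_iff_add_eq, ← avg_add]
    refine (avg_congr k fun l _ => ?_).trans (avg_const k 1)
    split_ifs <;> simp
  rw [avg_noBlock, sizes, List.map_flatMap]
  refine (prod_flatMap_le _ _ (fun i x hx => ?_) (List.mem_range.2 (Nat.lt_succ_of_le hj))).trans ?_
  · obtain ⟨k, -, rfl⟩ := List.mem_map.1 hx
    refine ⟨avg_nonneg _ fun l _ => by split_ifs <;> norm_num, ?_⟩
    refine (avg_mono k (G := fun _ => 1) fun l _ => by split_ifs <;> norm_num).trans ?_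
    rw [avg_const]
  · rw [List.map_replicate, List.prod_replicate, hcompl]
    set p := avg (2 * 2 ^ j) fun l => if D (2 * 2 ^ j) l then (1 : ℝ) else 0
    set m : ℕ := 256000 * (J + 1) * 4 ^ (J - j) with hm
    have hp1 : p ≤ 1 := by
      refine (avg_mono _ (G := fun _ => 1) fun l _ => by split_ifs <;> norm_num).trans ?_
      rw [avg_const]
    have hmp : 2 ≤ p * m := by
      have hpos : (0 : ℝ) < 128000 * (J + 1) * 4 ^ (J - j) := by positivity
      have e : (m : ℝ) = 2 * (128000 * (J + 1) * 4 ^ (J - j)) := by rw [hm]; push_cast; ring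
      rw [div_le_iff₀ hpos] at h
      rw [e]
      linarith
    calc (1 - p) ^ m ≤ Real.exp (-p) ^ m := by
          refine pow_le_pow_left₀ (by linarith) ?_ m
          linarith [Real.add_one_le_exp (-p)]
      _ = Real.exp (-(p * m)) := by rw [← Real.exp_nat_mul]; ring_nf
      _ ≤ Real.exp (-2) := Real.exp_le_exp.2 (by linarith)
      _ ≤ 1 / 4 := by
          rw [Real.exp_neg, one_div]
          apply inv_anti₀ (by norm_num)
          have : Real.exp 2 = Real.exp 1 ^ 2 := by rw [← Real.exp_nat_mul]; norm_num
          rw [this]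
          have := Real.add_one_le_exp (1 : ℝ)
          nlinarith

/-! ### The law of the samples -/

lemma avg_eq_sum {ι : Type*} [Fintype ι] (k : ℕ) (F : List ι → ℝ) :
    avg k F = (∑ f : Fin k → ι, F (List.ofFn f)) / (Fintype.card ι : ℝ) ^ k := by
  induction k generalizing F with
  | zero => simp [avg]
  | succ k ih =>
    rw [avg_succ, ← (Fin.consEquiv fun _ => ι).sum_comp, Fintype.sum_prod_type]
    simp only [ih, ← Finset.sum_div, pow_succ, div_div]
    congr 1
    refine Finset.sum_congr rfl fun j _ => Finset.sum_congr rfl fun f _ => ?_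
    exact congrArg F (List.ofFn_cons j f).symm

open Classical MeasureTheory in
lemma uniformIndices_setOf {n : ℕ} [NeZero n] (N : ℕ) (p : List (Fin n) → Prop) :
    uniformIndices n {ρ | p ((List.range' 0 N).map ρ)}
      = ENNReal.ofReal (avg N fun l => if p l then (1 : ℝ) else 0) := by
  set π : (ℕ → Fin n) → (Fin N → Fin n) := fun ρ i => ρ i with hπ
  have hlist (ρ : ℕ → Fin n) : (List.range' 0 N).map ρ = List.ofFn (π ρ) := by
    refine List.ext_getElem (by simp) fun i h₁ h₂ => ?_
    simp [hπ]
  have hset : {ρ | p ((List.range' 0 N).map ρ)}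
      = π ⁻¹' ((univ.filter fun f => p (List.ofFn f) : Finset (Fin N → Fin n)) : Set _) := by
    ext ρ
    simp [hlist]
  have hmeas : Measurable π := measurable_pi_lambda _ fun i => measurable_pi_apply _
  have hpoint (f : Fin N → Fin n) : uniformIndices n (π ⁻¹' {f}) = ((n : ENNReal)⁻¹) ^ N := by
    have h1 : π ⁻¹' {f} = Set.pi (range N : Finset ℕ)
        fun i => if h : i < N then {f ⟨i, h⟩} else Set.univ := by
      ext ρ
      simp only [Set.mem_preimage, Set.mem_singleton_iff, Set.mem_pi, coe_range, Set.mem_Iio]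
      constructor
      · rintro rfl i hi
        simp [hi, hπ]
      · intro h
        funext i
        simpa using h i i.2
    rw [h1, uniformIndices, Measure.infinitePi_pi _ fun i _ => MeasurableSet.of_discrete]
    conv_rhs => rw [← Finset.card_range N, ← Finset.prod_const]
    refine Finset.prod_congr rfl fun i hi => ?_
    rw [dif_pos (mem_range.1 hi), ProbabilityTheory.uniformOn_univ]
    simp
  rw [hset, ← sum_measure_preimage_singleton _ fun f _ => hmeas (MeasurableSet.of_discrete)]
  simp only [hpoint, Finset.sum_const, nsmul_eq_mul]
  rw [avg_eq_sum, Finset.sum_ite, Finset.sum_const_zero, add_zero, Finset.sum_const, nsmul_eq_mul,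
    mul_one, Fintype.card_fin, div_eq_mul_inv, ENNReal.ofReal_mul (by positivity),
    ENNReal.ofReal_natCast, ← inv_pow, ENNReal.ofReal_pow (by positivity),
    ENNReal.ofReal_inv_of_pos (by exact_mod_cast Nat.pos_of_ne_zero (NeZero.ne n)),
    ENNReal.ofReal_natCast]

/-- A matrix that is far from positive semidefinite is rejected on some block with probability at
least `3 / 4`. -/
theorem le_uniformIndices_detects {n : ℕ} [NeZero n] {A : Matrix (Fin n) (Fin n) ℝ}
    (hA : ∀ i j, |A i j| ≤ 1) {ε : ℝ} (hε : 0 < ε) (hε1 : ε ≤ 1) {z : Fin n → ℝ}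
    (hz : ∑ i, z i ^ 2 ≤ 1) (h : z ⬝ᵥ A *ᵥ z ≤ -(ε * n)) {J N : ℕ} (hJ : 32 ≤ ε * 2 ^ J)
    (hN : 8 * 4 ^ J / ε ≤ 2 ^ (N + 1)) :
    ENNReal.ofReal (3 / 4) ≤ uniformIndices n {ρ | ∃ b ∈ blocks 0 (sizes J),
      Detects (oracle A) (N + 1) (fun a => (ρ (b.1 + a) : ℕ)) b.2} := by
  classical
  obtain ⟨j, hj, hp⟩ := exists_scale_detects hA hε hε1 hz h hJ hN
  set D : ℕ → List (Fin n) → Prop := fun k l => Detects (oracle A) (N + 1) (listIdx l) k with hD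
  have hset : {ρ : ℕ → Fin n | ∃ b ∈ blocks 0 (sizes J),
      Detects (oracle A) (N + 1) (fun a => (ρ (b.1 + a) : ℕ)) b.2}
      = {ρ | ¬ NoBlock D (sizes J) ((List.range' 0 (sizes J).sum).map ρ)} := by
    ext ρ
    rw [Set.mem_ofPred_eq, Set.mem_ofPred_eq, noBlock_map_range']
    push Not
    refine exists_congr fun b => and_congr_right fun _ => detects_congr _ _ fun a ha => ?_
    simp [listIdx, List.getD, ha]
  rw [hset, uniformIndices_setOf _ fun l => ¬ NoBlock D (sizes J) l]
  refine ENNReal.ofReal_le_ofReal ?_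
  have h1 := avg_noBlock_sizes_le D hj hp
  have h2 : avg (sizes J).sum (fun l => if ¬ NoBlock D (sizes J) l then (1 : ℝ) else 0)
      + avg (sizes J).sum (fun l => if NoBlock D (sizes J) l then (1 : ℝ) else 0) = 1 := by
    rw [← avg_add]
    refine (avg_congr _ fun l _ => ?_).trans (avg_const _ 1)
    split_ifs <;> simp
  have h3 : 3 / 4 ≤ avg (sizes J).sum
      fun l => if ¬ NoBlock D (sizes J) l then (1 : ℝ) else 0 := by linarith
  convert h3

/-! ### Total correctness with a bound on the number of steps -/

/-- The configuration of the machine without the clock. -/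
structure Mem where
  nreg : ℕ → ℕ
  narr : ℕ → ℕ → ℕ
  rreg : ℕ → ℝ
  rarr : ℕ → ℕ → ℕ → ℝ
  draws : ℕ
  queries : List (ℕ × ℕ)

/-- Forgets the clock. -/
def State.mem (s : State) : Mem := ⟨s.nreg, s.narr, s.rreg, s.rarr, s.draws, s.queries⟩

/-- Effect of one instruction on the memory. -/
noncomputable def Instr.eff (O : ℕ → ℕ → ℝ) (ρ : ℕ → ℕ) (m : Mem) : Instr → Mem
  | .nconst x c => { m with nreg := Function.update m.nreg x c }
  | .nadd x y z => { m with nreg := Function.update m.nreg x (m.nreg y + m.nreg z) }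
  | .nsub x y z => { m with nreg := Function.update m.nreg x (m.nreg y - m.nreg z) }
  | .nload x a y => { m with nreg := Function.update m.nreg x (m.narr a (m.nreg y)) }
  | .nstore a y x =>
      { m with
        narr := Function.update m.narr a
          (Function.update (m.narr a) (m.nreg y) (m.nreg x)) }
  | .rconst r c => { m with rreg := Function.update m.rreg r (c : ℝ) }
  | .radd r u t => { m with rreg := Function.update m.rreg r (m.rreg u + m.rreg t) }
  | .rsub r u t => { m with rreg := Function.update m.rreg r (m.rreg u - m.rreg t) }
  | .rmul r u t => { m with rreg := Function.update m.rreg r (m.rreg u * m.rreg t) }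
  | .rdiv r u t => { m with rreg := Function.update m.rreg r (m.rreg u / m.rreg t) }
  | .rload r a x y => { m with rreg := Function.update m.rreg r (m.rarr a (m.nreg x) (m.nreg y)) }
  | .rstore a x y r =>
      { m with
        rarr := Function.update m.rarr a
          (Function.update (m.rarr a) (m.nreg x)
            (Function.update (m.rarr a (m.nreg x)) (m.nreg y) (m.rreg r))) }
  | .draw x =>
      { m with
        nreg := Function.update m.nreg x (ρ m.draws)
        draws := m.draws + 1 }
  | .query r x y =>
      { m with
        rreg := Function.update m.rreg r (O (m.nreg x) (m.nreg y))
        queries := (m.nreg x, m.nreg y) :: m.queries }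

lemma Instr.mem_apply (O : ℕ → ℕ → ℝ) (ρ : ℕ → ℕ) (s : State) (i : Instr) :
    (i.apply O ρ s).mem = i.eff O ρ s.mem := by
  cases i <;> rfl

lemma Instr.time_apply (O : ℕ → ℕ → ℝ) (ρ : ℕ → ℕ) (s : State) (i : Instr) :
    (i.apply O ρ s).time = s.time + 1 := by
  cases i <;> rfl

/-- The outcome of a test, as a property of the memory. -/
def Test.sat (m : Mem) : Test → Prop
  | .nlt x y => m.nreg x < m.nreg y
  | .rlt r t => m.rreg r < m.rreg t

lemma Test.holds_iff (s : State) (b : Test) : b.holds s ↔ b.sat s.mem := by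
  cases b <;> rfl

/-- Total correctness within a time bound: started in a memory with the property `Pre`, the program
`p` halts after at most `T` steps, in a memory with the property `Post`. -/
def Triple (O : ℕ → ℕ → ℝ) (ρ : ℕ → ℕ) (p : Prog) (T : ℝ) (Pre Post : Mem → Prop) : Prop :=
  ∀ s : State, Pre s.mem → ∃ s' : State, Exec O ρ p s s' ∧ (s'.time : ℝ) ≤ s.time + T ∧ Post s'.mem

section Rules

variable {O : ℕ → ℕ → ℝ} {ρ : ℕ → ℕ}

lemma Triple.conseq {p : Prog} {T T' : ℝ} {Pre Pre' Post Post' : Mem → Prop}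
    (h : Triple O ρ p T Pre Post) (hT : T ≤ T') (hPre : ∀ m, Pre' m → Pre m)
    (hPost : ∀ m, Post m → Post' m) : Triple O ρ p T' Pre' Post' := fun s hs => by
  obtain ⟨s', h1, h2, h3⟩ := h s (hPre _ hs)
  exact ⟨s', h1, by linarith, hPost _ h3⟩

lemma Triple.seq {p q : Prog} {T T' : ℝ} {Pre Mid Post : Mem → Prop}
    (hp : Triple O ρ p T Pre Mid) (hq : Triple O ρ q T' Mid Post) :
    Triple O ρ (.seq p q) (T + T') Pre Post := fun s hs => by
  obtain ⟨s₁, h1, h2, h3⟩ := hp s hs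
  obtain ⟨s₂, h4, h5, h6⟩ := hq s₁ h3
  exact ⟨s₂, .seq h1 h4, by linarith, h6⟩

lemma Triple.instr (i : Instr) (Post : Mem → Prop) :
    Triple O ρ (.instr i) 1 (fun m => Post (i.eff O ρ m)) Post := fun s hs =>
  ⟨i.apply O ρ s, .instr i s, by rw [Instr.time_apply]; push_cast; rfl,
    by rw [Instr.mem_apply]; exact hs⟩

lemma Triple.ite {b : Test} {p q : Prog} {T : ℝ} {Pre Post : Mem → Prop}
    (hp : Triple O ρ p T (fun m => Pre m ∧ b.sat m) Post)
    (hq : Triple O ρ q T (fun m => Pre m ∧ ¬ b.sat m) Post) :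
    Triple O ρ (.ite b p q) (T + 1) Pre Post := fun s hs => by
  by_cases hb : b.holds s
  · obtain ⟨s', h1, h2, h3⟩ := hp s.tick ⟨hs, (Test.holds_iff s b).1 hb⟩
    refine ⟨s', .ite_true hb h1, h2.trans ?_, h3⟩
    simp only [State.tick, Nat.cast_add, Nat.cast_one]
    linarith
  · obtain ⟨s', h1, h2, h3⟩ := hq s.tick ⟨hs, fun h => hb ((Test.holds_iff s b).2 h)⟩
    refine ⟨s', .ite_false hb h1, h2.trans ?_, h3⟩
    simp only [State.tick, Nat.cast_add, Nat.cast_one]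
    linarith

/-- A loop that is run exactly `N` times, with the invariant `I i` before the `i`-th pass. -/
lemma Triple.while {b : Test} {p : Prog} {N : ℕ} {T : ℕ → ℝ} {I : ℕ → Mem → Prop}
    (hbody : ∀ i < N, Triple O ρ p (T i) (I i) (I (i + 1)))
    (htrue : ∀ i < N, ∀ m, I i m → b.sat m) (hfalse : ∀ m, I N m → ¬ b.sat m) :
    Triple O ρ (.while b p) (∑ i ∈ range N, (T i + 1) + 1) (I 0) (I N) := by
  suffices h : ∀ d ≤ N, Triple O ρ (.while b p) (∑ i ∈ Ico (N - d) N, (T i + 1) + 1)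
      (I (N - d)) (I N) by
    simpa [← Finset.range_eq_Ico] using h N le_rfl
  intro d
  induction d with
  | zero =>
    intro _ s hs
    refine ⟨s.tick, .while_false fun h => hfalse _ hs ((Test.holds_iff s b).1 h), ?_, hs⟩
    simp [State.tick]
  | succ d ih =>
    intro hd s hs
    have hi : N - (d + 1) < N := by omega
    have e : N - d = N - (d + 1) + 1 := by omega
    obtain ⟨s₁, h1, h2, h3⟩ := hbody _ hi s.tick hs
    rw [← e] at h3
    obtain ⟨s₂, h4, h5, h6⟩ := ih (by omega) s₁ h3
    refine ⟨s₂, .while_true ((Test.holds_iff s b).2 (htrue _ hi _ hs)) h1 h4, ?_, h6⟩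
    rw [Finset.sum_eq_sum_Ico_succ_bot hi, ← e]
    simp only [State.tick, Nat.cast_add, Nat.cast_one] at h2
    linarith

lemma Triple.while_const {b : Test} {p : Prog} {N : ℕ} {T : ℝ} {I : ℕ → Mem → Prop}
    (hbody : ∀ i < N, Triple O ρ p T (I i) (I (i + 1)))
    (htrue : ∀ i < N, ∀ m, I i m → b.sat m) (hfalse : ∀ m, I N m → ¬ b.sat m) :
    Triple O ρ (.while b p) (N * (T + 1) + 1) (I 0) (I N) := by
  have := Triple.while hbody htrue hfalse
  rwa [Finset.sum_const, card_range, nsmul_eq_mul] at this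

/-- A sequence of instructions. -/
def line : Instr → List Instr → Prog
  | i, [] => .instr i
  | i, j :: l => .seq (.instr i) (line j l)

lemma Triple.line (i : Instr) (l : List Instr) (Post : Mem → Prop) :
    Triple O ρ (line i l) (l.length + 1)
      (fun m => Post ((i :: l).foldl (fun m i => i.eff O ρ m) m)) Post := by
  induction l generalizing i with
  | nil => exact (Triple.instr i Post).conseq (by simp) (fun _ h => h) fun _ h => h
  | cons j l ih =>
    refine ((Triple.instr i _).seq (ih j)).conseq ?_ (fun _ h => h) fun _ h => h
    rw [List.length_cons]
    push_cast
    linarith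

end Rules

/-! ### Frame conditions -/

/-- The target of the instruction is a register less than `b`, or an array less than `a`. -/
def Instr.Local (b a : ℕ) : Instr → Prop
  | .nconst x _ => x < b
  | .nadd x _ _ => x < b
  | .nsub x _ _ => x < b
  | .nload x _ _ => x < b
  | .nstore c _ _ => c < a
  | .rconst r _ => r < b
  | .radd r _ _ => r < b
  | .rsub r _ _ => r < b
  | .rmul r _ _ => r < b
  | .rdiv r _ _ => r < b
  | .rload r _ _ _ => r < b
  | .rstore c _ _ _ => c < a
  | .draw x => x < b
  | .query r _ _ => r < b

/-- All targets of the instructions of the program are registers less than `b` or arrays less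
than `a`. -/
def Prog.Local (b a : ℕ) : Prog → Prop
  | .instr i => i.Local b a
  | .seq p q => p.Local b a ∧ q.Local b a
  | .ite _ p q => p.Local b a ∧ q.Local b a
  | .while _ p => p.Local b a

lemma Instr.Local.mono {b b' a a' : ℕ} (hb : b ≤ b') (ha : a ≤ a') {i : Instr}
    (hi : i.Local b a) : i.Local b' a' := by
  cases i <;> first | exact lt_of_lt_of_le hi hb | exact lt_of_lt_of_le hi ha

lemma Prog.Local.mono {b b' a a' : ℕ} (hb : b ≤ b') (ha : a ≤ a') {p : Prog}
    (hp : p.Local b a) : p.Local b' a' := by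
  induction p with
  | instr i => exact Instr.Local.mono hb ha hp
  | seq p q ihp ihq => exact ⟨ihp hp.1, ihq hp.2⟩
  | ite _ p q ihp ihq => exact ⟨ihp hp.1, ihq hp.2⟩
  | _ => rename_i ih; exact ih hp

lemma Instr.exists_local (i : Instr) : ∃ b, i.Local b b := by
  cases i <;> exact ⟨_, Nat.lt_succ_self _⟩

lemma Prog.exists_local (p : Prog) : ∃ b, p.Local b b := by
  induction p with
  | instr i => exact i.exists_local
  | seq p q ihp ihq =>
    obtain ⟨b, hb⟩ := ihp
    obtain ⟨b', hb'⟩ := ihq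
    exact ⟨max b b', hb.mono (le_max_left _ _) (le_max_left _ _),
      hb'.mono (le_max_right _ _) (le_max_right _ _)⟩
  | ite _ p q ihp ihq =>
    obtain ⟨b, hb⟩ := ihp
    obtain ⟨b', hb'⟩ := ihq
    exact ⟨max b b', hb.mono (le_max_left _ _) (le_max_left _ _),
      hb'.mono (le_max_right _ _) (le_max_right _ _)⟩
  | _ => rename_i ih; exact ih

/-- The two memories agree on all registers from `b` on and on all arrays from `a` on. -/
structure Agree (b a : ℕ) (m m' : Mem) : Prop where
  nreg : ∀ i, b ≤ i → m'.nreg i = m.nreg i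
  rreg : ∀ i, b ≤ i → m'.rreg i = m.rreg i
  narr : ∀ i, a ≤ i → m'.narr i = m.narr i
  rarr : ∀ i, a ≤ i → m'.rarr i = m.rarr i

lemma Agree.refl (b a : ℕ) (m : Mem) : Agree b a m m :=
  ⟨fun _ _ => rfl, fun _ _ => rfl, fun _ _ => rfl, fun _ _ => rfl⟩

lemma Agree.trans {b a : ℕ} {m m' m'' : Mem} (h : Agree b a m m') (h' : Agree b a m' m'') :
    Agree b a m m'' :=
  ⟨fun i hi => (h'.nreg i hi).trans (h.nreg i hi), fun i hi => (h'.rreg i hi).trans (h.rreg i hi),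
    fun i hi => (h'.narr i hi).trans (h.narr i hi), fun i hi => (h'.rarr i hi).trans (h.rarr i hi)⟩

lemma Agree.mono {b b' a a' : ℕ} {m m' : Mem} (h : Agree b a m m') (hb : b ≤ b') (ha : a ≤ a') :
    Agree b' a' m m' :=
  ⟨fun i hi => h.nreg i (hb.trans hi), fun i hi => h.rreg i (hb.trans hi),
    fun i hi => h.narr i (ha.trans hi), fun i hi => h.rarr i (ha.trans hi)⟩

lemma Instr.Local.agree_eff {b a : ℕ} {i : Instr} (hi : i.Local b a) (O : ℕ → ℕ → ℝ) (ρ : ℕ → ℕ)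
    (m : Mem) : Agree b a m (i.eff O ρ m) := by
  have hne {x j c : ℕ} (hx : x < c) (hj : c ≤ j) : j ≠ x := by omega
  cases i <;>
    (refine ⟨fun j hj => ?_, fun j hj => ?_, fun j hj => ?_, fun j hj => ?_⟩ <;>
      first | rfl | exact Function.update_of_ne (hne hi hj) _ _)

lemma Exec.agree {O : ℕ → ℕ → ℝ} {ρ : ℕ → ℕ} {p : Prog} {s s' : State} (h : Exec O ρ p s s')
    {b a : ℕ} (hp : p.Local b a) : Agree b a s.mem s'.mem := by
  induction h with
  | instr i s =>
    rw [Instr.mem_apply]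
    exact Instr.Local.agree_eff hp O ρ s.mem
  | seq _ _ ih₁ ih₂ => exact (ih₁ hp.1).trans (ih₂ hp.2)
  | ite_true _ _ ih => exact ih hp.1
  | ite_false _ _ ih => exact ih hp.2
  | while_true _ _ _ ih₁ ih₂ => exact (ih₁ hp).trans (ih₂ hp)
  | while_false _ => exact Agree.refl _ _ _

/-- The two memories have the same records of draws and queries. -/
def SameRecords (m m' : Mem) : Prop := m'.draws = m.draws ∧ m'.queries = m.queries

lemma Exec.sameRecords {O : ℕ → ℕ → ℝ} {ρ : ℕ → ℕ} {p : Prog} {s s' : State}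
    (h : Exec O ρ p s s') (hp : p.IsArithmetical) : SameRecords s.mem s'.mem := by
  induction h with
  | instr i s =>
    rw [Instr.mem_apply]
    cases i <;> first | exact ⟨rfl, rfl⟩ | exact hp.elim
  | seq _ _ ih₁ ih₂ =>
    exact ⟨(ih₂ hp.2).1.trans (ih₁ hp.1).1, (ih₂ hp.2).2.trans (ih₁ hp.1).2⟩
  | ite_true _ _ ih => exact ih hp.1
  | ite_false _ _ ih => exact ih hp.2
  | while_true _ _ _ ih₁ ih₂ => exact ⟨(ih₂ hp).1.trans (ih₁ hp).1, (ih₂ hp).2.trans (ih₁ hp).2⟩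
  | while_false _ => exact ⟨rfl, rfl⟩

section Rules

variable {O : ℕ → ℕ → ℝ} {ρ : ℕ → ℕ}

/-- A property that does not depend on the possible targets of a program survives it. -/
lemma Triple.keep {p : Prog} {T : ℝ} {Pre Post K : Mem → Prop} {b a : ℕ}
    (h : Triple O ρ p T Pre Post) (hp : p.Local b a)
    (hK : ∀ m m', Agree b a m m' → K m → K m') :
    Triple O ρ p T (fun m => K m ∧ Pre m) (fun m => K m ∧ Post m) := fun s hs => by
  obtain ⟨s', h1, h2, h3⟩ := h s hs.2
  exact ⟨s', h1, h2, hK _ _ (h1.agree hp) hs.1, h3⟩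

lemma Triple.sameRecords {p : Prog} {T : ℝ} {Pre Post : Mem → Prop}
    (h : Triple O ρ p T Pre Post) (hp : p.IsArithmetical) (m₀ : Mem) :
    Triple O ρ p T (fun m => SameRecords m₀ m ∧ Pre m) (fun m => SameRecords m₀ m ∧ Post m) :=
  fun s hs => by
    obtain ⟨s', h1, h2, h3⟩ := h s hs.2
    have h4 := h1.sameRecords hp
    exact ⟨s', h1, h2, ⟨h4.1.trans hs.1.1, h4.2.trans hs.1.2⟩, h3⟩

/-- The loop `for x := 0, …, lim - 1`; the register `one` holds `1`. -/
def loop (x lim one : ℕ) (body : Prog) : Prog :=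
  .seq (.instr (.nconst x 0)) (.while (.nlt x lim) (.seq body (.instr (.nadd x x one))))

/-- The rule for a counting loop whose body does not change the counter `x` nor any register
behind it; `K` collects facts that survive the loop, and `I` is the invariant. -/
lemma Triple.loop {x lim one a N : ℕ} {body : Prog} {T : ℝ} {K : Mem → Prop} {I : ℕ → Mem → Prop}
    (hlim : x < lim) (hone : x < one) (hloc : body.Local x a)
    (hK : ∀ m m', Agree (x + 1) a m m' → K m → K m')
    (hI : ∀ i m v, I i m → I i { m with nreg := v })
    (hbody : ∀ i < N, Triple O ρ body T (fun m => m.nreg x = i ∧ K m ∧ I i m) (I (i + 1))) :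
    Triple O ρ (loop x lim one body) (N * (T + 2) + 2)
      (fun m => m.nreg lim = N ∧ m.nreg one = 1 ∧ K m ∧ I 0 m) (fun m => K m ∧ I N m) := by
  set J : ℕ → Mem → Prop := fun i m =>
    (m.nreg x = i ∧ m.nreg lim = N ∧ m.nreg one = 1 ∧ K m) ∧ I i m with hJ
  have hbody' (i : ℕ) (hi : i < N) :
      Triple O ρ (.seq body (.instr (.nadd x x one))) (T + 1) (J i) (J (i + 1)) := by
    have h1 := (hbody i hi).keep
      (K := fun m => m.nreg x = i ∧ m.nreg lim = N ∧ m.nreg one = 1 ∧ K m)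
      hloc fun m m' h hm => ⟨(h.nreg _ le_rfl).trans hm.1, (h.nreg _ hlim.le).trans hm.2.1,
        (h.nreg _ hone.le).trans hm.2.2.1, hK _ _ (h.mono (Nat.le_succ x) le_rfl) hm.2.2.2⟩
    refine (h1.conseq le_rfl (fun m hm => ?_) fun m hm => ?_).seq
      (Triple.instr (.nadd x x one) (J (i + 1)))
    · exact ⟨hm.1, hm.1.1, hm.1.2.2.2, hm.2⟩
    · obtain ⟨⟨h2, h3, h4, h5⟩, h6⟩ := hm
      have hag : Agree (x + 1) a m ((Instr.nadd x x one).eff O ρ m) :=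
        Instr.Local.agree_eff (i := .nadd x x one) (Nat.lt_succ_self x) O ρ m
      refine ⟨⟨?_, (hag.nreg _ hlim).trans h3, (hag.nreg _ hone).trans h4, hK _ _ hag h5⟩, ?_⟩
      · simp [Instr.eff, h2, h4]
      · exact hI _ _ _ h6
  have h := Triple.while_const (O := O) (ρ := ρ) (b := .nlt x lim) hbody'
    (fun i hi m hm => by
      simp only [Test.sat, hm.1.1, hm.1.2.1, hi])
    (fun m hm => by
      simp only [Test.sat, hm.1.1, hm.1.2.1, lt_irrefl, not_false_iff])
  refine ((Triple.instr (.nconst x 0) (J 0)).seq h).conseq (by linarith) (fun m hm => ?_)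
    fun m hm => ⟨hm.1.2.2.2, hm.2⟩
  obtain ⟨h3, h4, h5, h6⟩ := hm
  have hag : Agree (x + 1) a m ((Instr.nconst x 0).eff O ρ m) :=
    Instr.Local.agree_eff (i := .nconst x 0) (Nat.lt_succ_self x) O ρ m
  refine ⟨⟨?_, (hag.nreg _ hlim).trans h3, (hag.nreg _ hone).trans h4, hK _ _ hag h5⟩, ?_⟩
  · simp [Instr.eff]
  · exact hI _ _ _ h6

end Rules

/-! ### The exponent of matrix multiplication is at least two -/

/-- A run changes at most as many cells of a real array as it makes steps. -/
lemma Exec.exists_changed {O : ℕ → ℕ → ℝ} {ρ : ℕ → ℕ} {p : Prog} {s s' : State}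
    (h : Exec O ρ p s s') (a : ℕ) : ∃ F : Finset (ℕ × ℕ), F.card + s.time ≤ s'.time ∧
      ∀ i j, (i, j) ∉ F → s'.rarr a i j = s.rarr a i j := by
  induction h with
  | instr i s =>
    have h1 := Instr.time_apply O ρ s i
    cases i with
    | rstore a' x y r =>
      refine ⟨{(s.nreg x, s.nreg y)}, ?_, fun i j hij => ?_⟩
      · rw [h1, card_singleton, add_comm]
      · simp only [mem_singleton, Prod.mk.injEq, not_and] at hij
        simp only [Instr.apply]
        by_cases ha : a = a'
        · subst ha
          by_cases hi : i = s.nreg x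
          · subst hi
            rw [Function.update_self, Function.update_self, Function.update_of_ne (hij rfl)]
          · rw [Function.update_self, Function.update_of_ne hi]
        · rw [Function.update_of_ne ha]
    | _ => exact ⟨∅, by rw [h1]; simp, fun _ _ _ => rfl⟩
  | seq _ _ ih₁ ih₂ =>
    obtain ⟨F, hF, hF'⟩ := ih₁
    obtain ⟨G, hG, hG'⟩ := ih₂
    refine ⟨F ∪ G, ?_, fun i j hij => ?_⟩
    · have := card_union_le F G
      omega
    · simp only [mem_union, not_or] at hij
      exact (hG' i j hij.2).trans (hF' i j hij.1)
  | ite_true _ _ ih =>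
    obtain ⟨F, hF, hF'⟩ := ih
    refine ⟨F, ?_, hF'⟩
    simp only [State.tick] at hF
    omega
  | ite_false _ _ ih =>
    obtain ⟨F, hF, hF'⟩ := ih
    refine ⟨F, ?_, hF'⟩
    simp only [State.tick] at hF
    omega
  | while_true _ _ _ ih₁ ih₂ =>
    obtain ⟨F, hF, hF'⟩ := ih₁
    obtain ⟨G, hG, hG'⟩ := ih₂
    refine ⟨F ∪ G, ?_, fun i j hij => ?_⟩
    · have := card_union_le F G
      simp only [State.tick] at hF
      omega
    · simp only [mem_union, not_or] at hij
      exact (hG' i j hij.2).trans (hF' i j hij.1)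
  | while_false _ => exact ⟨∅, by simp [State.tick], fun _ _ _ => rfl⟩

/-- The product has `k ^ 2` entries, each of which has to be written. -/
lemma two_le_of_matMul {ω C : ℝ} {M : Prog}
    (hM : ∀ (O : ℕ → ℕ → ℝ) (ρ : ℕ → ℕ) (k : ℕ) (s : State), 1 ≤ k → s.nreg 0 = k →
      ∃ s' : State, Exec O ρ M s s' ∧ (s'.time : ℝ) ≤ s.time + C * (k : ℝ) ^ ω ∧
        ∀ i < k, ∀ j < k, s'.rarr 2 i j = ∑ l ∈ range k, s.rarr 0 i l * s.rarr 1 l j) :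
    2 ≤ ω := by
  have key (k : ℕ) (hk : 1 ≤ k) : (k : ℝ) ^ 2 ≤ C * (k : ℝ) ^ ω := by
    -- the factors are zero, and the cells for the product hold the number `1`
    obtain ⟨s', h1, h2, h3⟩ := hM (fun _ _ => 0) (fun _ => 0) k
      { nreg := fun _ => k, narr := fun _ _ => 0, rreg := fun _ => 0,
        rarr := fun a _ _ => if a = 2 then 1 else 0, time := 0, draws := 0, queries := [] } hk rfl
    obtain ⟨F, hF, hF'⟩ := h1.exists_changed 2
    have hsub : range k ×ˢ range k ⊆ F := by
      rintro ⟨i, j⟩ hij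
      rw [mem_product, mem_range, mem_range] at hij
      by_contra hne
      have h4 := hF' i j hne
      rw [h3 i hij.1 j hij.2] at h4
      simp at h4
    have h5 := card_le_card hsub
    rw [card_product, card_range] at h5
    have h6 : ((k * k : ℕ) : ℝ) ≤ s'.time := by exact_mod_cast h5.trans (by simpa using hF)
    push_cast at h2 h6
    rw [sq]
    linarith
  by_contra hω
  push Not at hω
  have htend : Filter.Tendsto (fun k : ℕ => (k : ℝ) ^ (2 - ω)) Filter.atTop Filter.atTop :=
    (tendsto_rpow_atTop (by linarith)).comp tendsto_natCast_atTop_atTop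
  obtain ⟨k, hk1, hk2⟩ := ((htend.eventually_gt_atTop C).and (Filter.eventually_ge_atTop 1)).exists
  have hk0 : (0 : ℝ) < k := by exact_mod_cast hk2
  have h1 := key k hk2
  have h2 : (k : ℝ) ^ (2 - ω) * (k : ℝ) ^ ω = (k : ℝ) ^ 2 := by
    rw [← Real.rpow_add hk0]
    norm_num
  have h3 : C * (k : ℝ) ^ ω < (k : ℝ) ^ (2 - ω) * (k : ℝ) ^ ω :=
    mul_lt_mul_of_pos_right hk1 (Real.rpow_pos_of_pos hk0 _)
  linarith

/-! ### The matrix part of the program -/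

/-- The constants of the program that are fixed for a block of `k` indices. -/
structure HasSize (B k : ℕ) (m : Mem) : Prop where
  one : m.nreg (B + 5) = 1
  size : m.nreg (B + 6) = k
  rone : m.rreg (B + 5) = 1
  rsize : m.rreg (B + 6) = k

lemma HasSize.of_agree {B k b a : ℕ} {m m' : Mem} (h' : Agree b a m m') (hb : b ≤ B + 5)
    (h : HasSize B k m) : HasSize B k m' :=
  ⟨(h'.nreg _ hb).trans h.one, (h'.nreg _ (by omega)).trans h.size,
    (h'.rreg _ hb).trans h.rone, (h'.rreg _ (by omega)).trans h.rsize⟩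

lemma update_cell {α : Type*} (R : ℕ → ℕ → ℕ → α) (c a b : ℕ) (r : α) (c' i j : ℕ) :
    Function.update R c (Function.update (R c) a (Function.update (R c a) b r)) c' i j
      = if c' = c ∧ i = a ∧ j = b then r else R c' i j := by
  by_cases hc : c' = c
  · subst hc
    by_cases ha : i = a
    · subst ha
      by_cases hb : j = b
      · subst hb
        simp
      · simp [hb]
    · simp [ha]
  · simp [hc]

lemma update_cell_apply {α : Type*} (R : ℕ → ℕ → α) (a b : ℕ) (r : α) (i j : ℕ) :
    Function.update R a (Function.update (R a) b r) i j = if i = a ∧ j = b then r else R i j := by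
  simpa using update_cell (fun _ => R) 0 a b r 0 i j

/-- Two nested loops over the `k` indices of a block. -/
def grid (B : ℕ) (body : Prog) : Prog :=
  loop (B + 3) (B + 6) (B + 5) (loop (B + 2) (B + 6) (B + 5) body)

lemma local_loop {b a x lim one : ℕ} {p : Prog} (hx : x < b) (hp : p.Local b a) :
    (loop x lim one p).Local b a := ⟨hx, hp, hx⟩

lemma local_grid {B a : ℕ} {body : Prog} (h : body.Local (B + 2) a) :
    (grid B body).Local (B + 4) a :=
  local_loop (by omega) (local_loop (by omega) (h.mono (by omega) le_rfl))

section Rules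

variable {O : ℕ → ℕ → ℝ} {ρ : ℕ → ℕ}

lemma Triple.grid {B k a : ℕ} {body : Prog} {T : ℝ} {K : Mem → Prop} {I : ℕ → ℕ → Mem → Prop}
    (hloc : body.Local (B + 2) a)
    (hK : ∀ m m', Agree (B + 4) a m m' → K m → K m')
    (hI : ∀ i j m v, I i j m → I i j { m with nreg := v })
    (hbody : ∀ i < k, ∀ j < k, Triple O ρ body T
      (fun m => m.nreg (B + 3) = i ∧ m.nreg (B + 2) = j ∧ HasSize B k m ∧ K m ∧ I i j m)
      (I i (j + 1)))
    (hrow : ∀ i < k, ∀ m, I i k m → I (i + 1) 0 m) :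
    Triple O ρ (grid B body) (k * (k * (T + 2) + 4) + 2)
      (fun m => HasSize B k m ∧ K m ∧ I 0 0 m) (fun m => HasSize B k m ∧ K m ∧ I k 0 m) := by
  have h := Triple.loop (O := O) (ρ := ρ) (x := B + 3) (lim := B + 6) (one := B + 5) (N := k)
    (a := a) (K := fun m => HasSize B k m ∧ K m) (I := fun i m => I i 0 m)
    (body := PSDTest.loop (B + 2) (B + 6) (B + 5) body) (T := k * (T + 2) + 2)
    (by omega) (by omega) (local_loop (by omega) (hloc.mono (by omega) le_rfl))
    (fun m m' h hm => ⟨hm.1.of_agree h (by omega), hK _ _ h hm.2⟩) (fun i m v => hI i 0 m v) ?_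
  · refine h.conseq (by linarith) (fun m hm => ⟨hm.1.size, hm.1.one, ⟨hm.1, hm.2.1⟩, hm.2.2⟩)
      fun m hm => ⟨hm.1.1, hm.1.2, hm.2⟩
  · intro i hi
    have h' := Triple.loop (O := O) (ρ := ρ) (x := B + 2) (lim := B + 6) (one := B + 5) (N := k)
      (a := a) (K := fun m => m.nreg (B + 3) = i ∧ HasSize B k m ∧ K m) (I := fun j m => I i j m)
      (body := body) (T := T) (by omega) (by omega) hloc
      (fun m m' h hm => ⟨(h.nreg _ le_rfl).trans hm.1, hm.2.1.of_agree h (by omega),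
        hK _ _ (h.mono (by omega) le_rfl) hm.2.2⟩) (fun j m v => hI i j m v)
      (fun j hj => (hbody i hi j hj).conseq le_rfl
        (fun m hm => ⟨hm.2.1.1, hm.1, hm.2.1.2.1, hm.2.1.2.2, hm.2.2⟩) fun m hm => hm)
    exact h'.conseq le_rfl
      (fun m hm => ⟨hm.2.1.1.size, hm.2.1.1.one, ⟨hm.1, hm.2.1⟩, hm.2.2⟩)
      fun m hm => hrow i hi m hm.2

/-- Copies array `2` to the arrays `0` and `1`. -/
def copyProg (B : ℕ) : Prog :=
  grid B (line (.rload B 2 (B + 3) (B + 2))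
    [.rstore 0 (B + 3) (B + 2) B, .rstore 1 (B + 3) (B + 2) B])

lemma local_copyProg {B : ℕ} (hB : 3 ≤ B) : (copyProg B).Local (B + 4) B :=
  local_grid (by simp only [line, Prog.Local, Instr.Local]; omega)

lemma triple_copyProg {B k : ℕ} (hB : 3 ≤ B) (X : Matrix (Fin k) (Fin k) ℝ) :
    Triple O ρ (copyProg B) (k * (k * 5 + 4) + 2)
      (fun m => HasSize B k m ∧ ∀ i j : Fin k, m.rarr 2 i j = X i j)
      (fun m => HasSize B k m ∧ ∀ i j : Fin k, m.rarr 0 i j = X i j ∧ m.rarr 1 i j = X i j) := by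
  have h := Triple.grid (O := O) (ρ := ρ) (B := B) (k := k) (a := B) (T := 3)
    (body := line (.rload B 2 (B + 3) (B + 2))
      [.rstore 0 (B + 3) (B + 2) B, .rstore 1 (B + 3) (B + 2) B]) (K := fun _ => True)
    (I := fun a b m => (∀ i j : Fin k, m.rarr 2 i j = X i j) ∧
      ∀ i j : Fin k, ((i : ℕ) < a ∨ (i : ℕ) = a ∧ (j : ℕ) < b) →
        m.rarr 0 i j = X i j ∧ m.rarr 1 i j = X i j)
    (by simp only [line, Prog.Local, Instr.Local]; omega) (fun _ _ _ h => h)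
    (fun _ _ _ _ h => h) ?_ ?_
  · refine h.conseq (le_of_eq (by ring)) (fun m hm => ⟨hm.1, trivial, hm.2, ?_⟩) fun m hm =>
      ⟨hm.1, fun i j => hm.2.2.2 i j (Or.inl i.2)⟩
    simp
  · intro a ha b hb
    refine (Triple.line _ _ _).conseq (by norm_num) ?_ fun _ h => h
    rintro m ⟨h1, h2, -, -, h3, h4⟩
    refine ⟨by simpa [Instr.eff] using h3, fun i j hij => ?_⟩
    simp only [List.foldl, Instr.eff, h1, h2, Function.update_self]
    by_cases hc : (i : ℕ) = a ∧ (j : ℕ) = b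
    · obtain ⟨rfl, rfl⟩ := hc
      simp [h3 i j]
    · have h5 := h4 i j (by omega)
      refine ⟨?_, by simp [update_cell_apply, hc, h5]⟩
      simp only [update_cell, hc, and_false, if_false, h5]
  · rintro a ha m ⟨h3, h4⟩
    exact ⟨h3, fun i j hij => h4 i j (by omega)⟩

/-- Writes the matrix `-(E + Eᵀ) / (2k)` to array `2`, for the matrix `E` in array `B`. -/
def formProg (B : ℕ) : Prog :=
  grid B (line (.rload B B (B + 3) (B + 2))
    [.rload (B + 1) B (B + 2) (B + 3), .radd B B (B + 1), .radd (B + 1) (B + 6) (B + 6),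
      .rdiv B B (B + 1), .rsub (B + 1) (B + 1) (B + 1), .rsub B (B + 1) B,
      .rstore 2 (B + 3) (B + 2) B])

lemma local_formProg {B : ℕ} (hB : 3 ≤ B) : (formProg B).Local (B + 4) B :=
  local_grid (by simp only [line, Prog.Local, Instr.Local]; omega)

lemma triple_formProg {B k : ℕ} (hB : 3 ≤ B) (E : Matrix (Fin k) (Fin k) ℝ) :
    Triple O ρ (formProg B) (k * (k * 10 + 4) + 2)
      (fun m => HasSize B k m ∧ ∀ i j : Fin k, m.rarr B i j = E i j)
      (fun m => HasSize B k m ∧ ∀ i j : Fin k, m.rarr 2 i j = -((E i j + E j i) / (k + k))) := by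
  have h := Triple.grid (O := O) (ρ := ρ) (B := B) (k := k) (a := B) (T := 8)
    (body := line (.rload B B (B + 3) (B + 2))
      [.rload (B + 1) B (B + 2) (B + 3), .radd B B (B + 1), .radd (B + 1) (B + 6) (B + 6),
        .rdiv B B (B + 1), .rsub (B + 1) (B + 1) (B + 1), .rsub B (B + 1) B,
        .rstore 2 (B + 3) (B + 2) B])
    (K := fun m => ∀ i j : Fin k, m.rarr B i j = E i j)
    (I := fun a b m => ∀ i j : Fin k, ((i : ℕ) < a ∨ (i : ℕ) = a ∧ (j : ℕ) < b) →
        m.rarr 2 i j = -((E i j + E j i) / (k + k)))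
    (by simp only [line, Prog.Local, Instr.Local]; omega)
    (fun m m' h h' => by rwa [h.rarr B le_rfl])
    (fun _ _ _ _ h => h) ?_ ?_
  · refine h.conseq (le_of_eq (by ring)) (fun m hm => ⟨hm.1, hm.2, ?_⟩) fun m hm =>
      ⟨hm.1, fun i j => hm.2.2 i j (Or.inl i.2)⟩
    simp
  · intro a ha b hb
    refine (Triple.line _ _ _).conseq (by norm_num) ?_ fun _ h => h
    rintro m ⟨h1, h2, hs, h3, h4⟩ i j hij
    by_cases hc : (i : ℕ) = a ∧ (j : ℕ) = b
    · obtain ⟨rfl, rfl⟩ := hc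
      simp [Instr.eff, h1, h2, h3, hs.rsize]
    · have h5 := h4 i j (by omega)
      simp only [List.foldl, Instr.eff, h1, h2, update_cell, true_and, if_neg hc, h5]
  · rintro a ha m h4
    exact fun i j hij => h4 i j (by omega)

/-- Adds `1` to the diagonal of the matrix in array `2`. -/
def diagProg (B : ℕ) : Prog :=
  loop (B + 3) (B + 6) (B + 5) (line (.rload B 2 (B + 3) (B + 3))
    [.radd B B (B + 5), .rstore 2 (B + 3) (B + 3) B])

lemma local_diagProg {B : ℕ} (hB : 3 ≤ B) : (diagProg B).Local (B + 4) B :=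
  local_loop (by omega) (by simp only [line, Prog.Local, Instr.Local]; omega)

lemma triple_diagProg {B k : ℕ} (hB : 3 ≤ B) (X : Matrix (Fin k) (Fin k) ℝ) :
    Triple O ρ (diagProg B) (k * 5 + 2)
      (fun m => HasSize B k m ∧ ∀ i j : Fin k, m.rarr 2 i j = X i j)
      (fun m => HasSize B k m ∧ ∀ i j : Fin k, m.rarr 2 i j = (1 + X) i j) := by
  have h := Triple.loop (O := O) (ρ := ρ) (x := B + 3) (lim := B + 6) (one := B + 5) (N := k)
    (a := B) (T := 3) (K := fun m => HasSize B k m)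
    (body := line (.rload B 2 (B + 3) (B + 3)) [.radd B B (B + 5), .rstore 2 (B + 3) (B + 3) B])
    (I := fun a m => ∀ i j : Fin k, m.rarr 2 i j
      = (if (i : ℕ) = j ∧ (i : ℕ) < a then 1 else 0) + X i j)
    (by omega) (by omega) (by simp only [line, Prog.Local, Instr.Local]; omega)
    (fun m m' h h' => h'.of_agree h (by omega)) (fun _ _ _ h => h) ?_
  · refine h.conseq (le_of_eq (by ring)) (fun m hm => ⟨hm.1.size, hm.1.one, hm.1, ?_⟩) fun m hm =>
      ⟨hm.1, fun i j => ?_⟩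
    · simpa using hm.2
    · rw [hm.2 i j, Matrix.add_apply, one_apply]
      simp [Fin.ext_iff]
  · intro a ha
    refine (Triple.line _ _ _).conseq (by norm_num) ?_ fun _ h => h
    rintro m ⟨h1, hs, h4⟩ i j
    simp only [List.foldl, Instr.eff, h1, update_cell, true_and]
    by_cases hc : (i : ℕ) = a ∧ (j : ℕ) = a
    · have hji : j = i := Fin.ext (hc.2.trans hc.1.symm)
      subst hji
      have h5 := h4 j j
      rw [hc.1] at h5 ⊢
      simp [h5, hs.rone]
      ring
    · rw [if_neg hc, h4 i j]
      congr 1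
      refine if_congr ?_ rfl rfl
      omega

/-- Computes the trace of the matrix in array `2`. -/
def traceProg (B : ℕ) : Prog :=
  .seq (.instr (.rconst (B + 2) 0))
    (loop (B + 3) (B + 6) (B + 5) (line (.rload B 2 (B + 3) (B + 3)) [.radd (B + 2) (B + 2) B]))

lemma local_traceProg {B : ℕ} : (traceProg B).Local (B + 4) B :=
  ⟨by simp only [Prog.Local, Instr.Local]; omega,
    local_loop (by omega) (by simp only [line, Prog.Local, Instr.Local]; omega)⟩

lemma triple_traceProg {B k : ℕ} (X : Matrix (Fin k) (Fin k) ℝ) :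
    Triple O ρ (traceProg B) (k * 4 + 3)
      (fun m => HasSize B k m ∧ ∀ i j : Fin k, m.rarr 2 i j = X i j)
      (fun m => HasSize B k m ∧ m.rreg (B + 2) = X.trace) := by
  have h := Triple.loop (O := O) (ρ := ρ) (x := B + 3) (lim := B + 6) (one := B + 5) (N := k)
    (a := 0) (T := 2) (K := fun m => HasSize B k m ∧ ∀ i j : Fin k, m.rarr 2 i j = X i j)
    (body := line (.rload B 2 (B + 3) (B + 3)) [.radd (B + 2) (B + 2) B])
    (I := fun a m => m.rreg (B + 2) = ∑ l ∈ range a, m.rarr 2 l l)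
    (by omega) (by omega) (by simp only [line, Prog.Local, Instr.Local]; omega)
    (fun m m' h h' => ⟨h'.1.of_agree h (by omega), by rw [h.rarr 2 (by omega)]; exact h'.2⟩)
    (fun _ _ _ h => h) ?_
  · refine ((Triple.instr _ _).seq h).conseq (by linarith) (fun m hm => ?_) fun m hm => ⟨hm.1.1, ?_⟩
    · have hag := Instr.Local.agree_eff (i := .rconst (B + 2) 0) (b := B + 3) (a := 0)
        (Nat.lt_succ_self _) O ρ m
      have hs := hm.1.of_agree hag (by omega)
      exact ⟨hs.size, hs.one, ⟨hs, hm.2⟩, by simp [Instr.eff]⟩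
    · rw [hm.2, Matrix.trace, Finset.sum_range]
      simp [hm.1.2]
  · intro a ha
    refine (Triple.line _ _ _).conseq (by norm_num) ?_ fun _ h => h
    rintro m ⟨h1, -, h4⟩
    simp [Instr.eff, h1, h4, Finset.sum_range_succ]

/-- Squares the matrix in array `2`, by means of the program `M` for matrix multiplication. -/
def squareProg (B : ℕ) (M : Prog) : Prog :=
  .seq (copyProg B) (.seq (line (.nconst B 0) [.nadd 0 (B + 6) B]) M)

lemma local_squareProg {B : ℕ} {M : Prog} (hB : 3 ≤ B) (hM : M.Local B B) :
    (squareProg B M).Local (B + 4) B :=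
  ⟨local_copyProg hB, by simp only [line, Prog.Local, Instr.Local]; omega,
    hM.mono (by omega) le_rfl⟩

/-- `M` multiplies `k × k` matrices in `T` steps. -/
def Multiplies (M : Prog) (k : ℕ) (T : ℝ) : Prop :=
  ∀ (O : ℕ → ℕ → ℝ) (ρ : ℕ → ℕ) (s : State), s.nreg 0 = k →
    ∃ s' : State, Exec O ρ M s s' ∧ (s'.time : ℝ) ≤ s.time + T ∧
      ∀ i < k, ∀ j < k, s'.rarr 2 i j = ∑ l ∈ range k, s.rarr 0 i l * s.rarr 1 l j

lemma triple_squareProg {B k : ℕ} {M : Prog} {T : ℝ} (hB : 3 ≤ B) (hloc : M.Local B B)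
    (hM : Multiplies M k T) (X : Matrix (Fin k) (Fin k) ℝ) :
    Triple O ρ (squareProg B M) (k * (k * 5 + 4) + 4 + T)
      (fun m => HasSize B k m ∧ ∀ i j : Fin k, m.rarr 2 i j = X i j)
      (fun m => HasSize B k m ∧ ∀ i j : Fin k, m.rarr 2 i j = (X ^ 2) i j) := by
  have hmul : Triple O ρ M T (fun m => HasSize B k m ∧ m.nreg 0 = k ∧
        ∀ i j : Fin k, m.rarr 0 i j = X i j ∧ m.rarr 1 i j = X i j)
      (fun m => HasSize B k m ∧ ∀ i j : Fin k, m.rarr 2 i j = (X ^ 2) i j) := by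
    refine Triple.keep (fun s hs => ?_) hloc fun m m' h h' => h'.of_agree h (by omega)
    obtain ⟨s', h1, h2, h3⟩ := hM O ρ s hs.1
    refine ⟨s', h1, h2, fun i j => (h3 i i.2 j j.2).trans ?_⟩
    rw [sq, mul_apply, Finset.sum_range]
    exact Finset.sum_congr rfl fun l _ => congrArg₂ _ (hs.2 i l).1 (hs.2 l j).2
  have hline : Triple O ρ (line (.nconst B 0) [.nadd 0 (B + 6) B]) 2
      (fun m => HasSize B k m ∧ ∀ i j : Fin k, m.rarr 0 i j = X i j ∧ m.rarr 1 i j = X i j)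
      (fun m => HasSize B k m ∧ m.nreg 0 = k ∧
        ∀ i j : Fin k, m.rarr 0 i j = X i j ∧ m.rarr 1 i j = X i j) := by
    refine (Triple.line _ _ _).conseq (by norm_num) ?_ fun _ h => h
    rintro m ⟨hs, h⟩
    have h0 : B ≠ 0 := by omega
    refine ⟨⟨?_, ?_, hs.rone, hs.rsize⟩, ?_, h⟩ <;> simp [Instr.eff, hs.one, hs.size, h0]
  exact ((triple_copyProg hB X).seq (hline.seq hmul)).conseq (by linarith) (fun _ h => h)
    fun _ h => h

end Rules

section Rules

variable {O : ℕ → ℕ → ℝ} {ρ : ℕ → ℕ}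

/-- Squares the matrix in array `2` until the exponent reaches the bound in register `B + 17`. -/
def powerProg (B : ℕ) (M : Prog) : Prog :=
  .seq (.instr (.rconst (B + 4) 1))
    (.while (.rlt (B + 4) (B + 17))
      (.seq (squareProg B M) (.instr (.radd (B + 4) (B + 4) (B + 4)))))

lemma local_powerProg {B : ℕ} {M : Prog} (hB : 3 ≤ B) (hM : M.Local B B) :
    (powerProg B M).Local (B + 5) B :=
  ⟨Nat.lt_succ_self _, (local_squareProg hB hM).mono (by omega) le_rfl, Nat.lt_succ_self _⟩

lemma triple_powerProg {B k N : ℕ} {M : Prog} {T W : ℝ} (hB : 3 ≤ B) (hloc : M.Local B B)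
    (hM : Multiplies M k T) (X : Matrix (Fin k) (Fin k) ℝ) (hlt : ∀ i < N, (2 : ℝ) ^ i < W)
    (hle : W ≤ 2 ^ N) :
    Triple O ρ (powerProg B M) (N * (k * (k * 5 + 4) + 4 + T + 2) + 2)
      (fun m => m.rreg (B + 17) = W ∧ HasSize B k m ∧ ∀ i j : Fin k, m.rarr 2 i j = X i j)
      (fun m => HasSize B k m ∧ ∀ i j : Fin k, m.rarr 2 i j = (X ^ 2 ^ N) i j) := by
  set I : ℕ → Mem → Prop := fun i m => (m.rreg (B + 4) = 2 ^ i ∧ m.rreg (B + 17) = W) ∧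
    HasSize B k m ∧ ∀ a b : Fin k, m.rarr 2 a b = (X ^ 2 ^ i) a b with hI
  have hbody (i : ℕ) : Triple O ρ
      (.seq (squareProg B M) (.instr (.radd (B + 4) (B + 4) (B + 4))))
      (k * (k * 5 + 4) + 4 + T + 1) (I i) (I (i + 1)) := by
    refine (((triple_squareProg hB hloc hM (X ^ 2 ^ i)).keep
      (K := fun m => m.rreg (B + 4) = 2 ^ i ∧ m.rreg (B + 17) = W) (local_squareProg hB hloc)
      fun m m' h h' => ⟨(h.rreg _ le_rfl).trans h'.1, (h.rreg _ (by omega)).trans h'.2⟩).conseq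
      le_rfl (fun _ h => h) ?_).seq (Triple.instr _ _)
    rintro m ⟨⟨h1, h2⟩, h3, h4⟩
    refine ⟨⟨?_, by simpa [Instr.eff] using h2⟩, h3.of_agree (Instr.Local.agree_eff (b := B + 5)
      (a := 0) (i := .radd (B + 4) (B + 4) (B + 4)) (Nat.lt_succ_self _) O ρ m) le_rfl, ?_⟩
    · simp [Instr.eff, h1, pow_succ, mul_two]
    · intro a b
      rw [pow_succ 2, pow_mul]
      exact h4 a b
  have h := Triple.while_const (O := O) (ρ := ρ) (b := .rlt (B + 4) (B + 17)) (N := N)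
    (fun i _ => hbody i)
    (fun i hi m hm => by simp only [Test.sat, hm.1.1, hm.1.2, hlt i hi])
    (fun m hm => by simp only [Test.sat, hm.1.1, hm.1.2, not_lt, hle])
  refine ((Triple.instr _ _).seq h).conseq (by linarith) (fun m hm => ?_) fun m hm => hm.2
  obtain ⟨h2, h3, h4⟩ := hm
  refine ⟨⟨by simp [Instr.eff], by simpa [Instr.eff] using h2⟩, h3.of_agree (Instr.Local.agree_eff
    (b := B + 5) (a := 0) (i := .rconst (B + 4) 1) (Nat.lt_succ_self _) O ρ m) le_rfl, ?_⟩
  intro a b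
  rw [pow_zero, pow_one]
  exact h4 a b

/-- Computes the trace that is compared with the size in the test of a block. -/
def matrixProg (B : ℕ) (M : Prog) : Prog :=
  .seq (formProg B) (.seq (diagProg B) (.seq (powerProg B M) (traceProg B)))

lemma local_matrixProg {B : ℕ} {M : Prog} (hB : 3 ≤ B) (hM : M.Local B B) :
    (matrixProg B M).Local (B + 5) B :=
  ⟨(local_formProg hB).mono (by omega) le_rfl, (local_diagProg hB).mono (by omega) le_rfl,
    local_powerProg hB hM, (local_traceProg).mono (by omega) le_rfl⟩

lemma isArithmetical_matrixProg (B : ℕ) {M : Prog} (hM : M.IsArithmetical) :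
    (matrixProg B M).IsArithmetical := by
  simp [matrixProg, formProg, diagProg, powerProg, traceProg, squareProg, copyProg, grid, loop,
    line, Prog.IsArithmetical, hM]

lemma triple_matrixProg {B k N : ℕ} {M : Prog} {T W : ℝ} (hB : 3 ≤ B) (hloc : M.Local B B)
    (hM : Multiplies M k T) (E : Matrix (Fin k) (Fin k) ℝ) (hlt : ∀ i < N, (2 : ℝ) ^ i < W)
    (hle : W ≤ 2 ^ N) :
    Triple O ρ (matrixProg B M)
      (k * (k * 10 + 4) + 2 + (k * 5 + 2) + (N * (k * (k * 5 + 4) + 4 + T + 2) + 2) + (k * 4 + 3))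
      (fun m => m.rreg (B + 17) = W ∧ HasSize B k m ∧ ∀ i j : Fin k, m.rarr B i j = E i j)
      (fun m => HasSize B k m ∧ m.rreg (B + 2) = (shifted E ^ 2 ^ N).trace) := by
  have hE : shifted E = 1 + of fun i j => -((E i j + E j i) / ((k : ℝ) + k)) := by
    rw [shifted, sub_eq_add_neg]
    congr 1
    ext i j
    simp only [Matrix.neg_apply, Matrix.smul_apply, Matrix.add_apply, transpose_apply, of_apply,
      smul_eq_mul]
    ring
  have h1 := (triple_formProg (O := O) (ρ := ρ) hB E).keep (K := fun m => m.rreg (B + 17) = W)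
    (local_formProg hB) fun m m' h h' => (h.rreg _ (by omega)).trans h'
  have h2 := (triple_diagProg (O := O) (ρ := ρ) hB
    (of fun i j => -((E i j + E j i) / ((k : ℝ) + k)))).keep (K := fun m => m.rreg (B + 17) = W)
    (local_diagProg hB) fun m m' h h' => (h.rreg _ (by omega)).trans h'
  have h3 := triple_powerProg (O := O) (ρ := ρ) hB hloc hM (shifted E) hlt hle
  have h4 := triple_traceProg (O := O) (ρ := ρ) (B := B) (shifted E ^ 2 ^ N)
  rw [← hE] at h2
  exact (h1.seq (h2.seq (h3.seq h4))).conseq (by linarith) (fun _ h => h) fun _ h => h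

/-! ### The test of one block -/

/-- Draws the indices of a block, and stores them in array `B + 1`. -/
def drawProg (B : ℕ) : Prog :=
  loop (B + 3) (B + 6) (B + 5) (line (.draw B) [.nstore (B + 1) (B + 3) B])

lemma local_drawProg (B : ℕ) : (drawProg B).Local (B + 4) (B + 2) :=
  local_loop (by omega) (by simp only [line, Prog.Local, Instr.Local]; omega)

lemma triple_drawProg (B k t : ℕ) (q : List (ℕ × ℕ)) :
    Triple O ρ (drawProg B) (k * 4 + 2)
      (fun m => HasSize B k m ∧ m.draws = t ∧ m.queries = q)
      (fun m => HasSize B k m ∧ m.draws = t + k ∧ m.queries = q ∧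
        ∀ a < k, m.narr (B + 1) a = ρ (t + a)) := by
  have h := Triple.loop (O := O) (ρ := ρ) (x := B + 3) (lim := B + 6) (one := B + 5) (N := k)
    (a := B + 2) (T := 2) (K := fun m => HasSize B k m)
    (body := line (.draw B) [.nstore (B + 1) (B + 3) B])
    (I := fun i m => m.draws = t + i ∧ m.queries = q ∧ ∀ a < i, m.narr (B + 1) a = ρ (t + a))
    (by omega) (by omega) (by simp only [line, Prog.Local, Instr.Local]; omega)
    (fun m m' h h' => h'.of_agree h (by omega)) (fun _ _ _ h => h) ?_
  · exact h.conseq (le_of_eq (by ring))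
      (fun m hm => ⟨hm.1.size, hm.1.one, hm.1, hm.2.1, hm.2.2, by simp⟩) fun m hm => hm
  · intro i hi
    refine (Triple.line _ _ _).conseq (by norm_num) ?_ fun _ h => h
    rintro m ⟨h1, -, h2, h3, h4⟩
    refine ⟨by simp [Instr.eff, h2, add_assoc], by simpa [Instr.eff] using h3, fun a ha => ?_⟩
    rcases Nat.lt_succ_iff_lt_or_eq.1 ha with ha | rfl
    · simp [Instr.eff, h1, ha.ne, h4 a ha]
    · simp [Instr.eff, h1, h2]

/-- The positions `(x, I 0), …, (x, I (b - 1))`, latest first. -/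
def rowQueries (I : ℕ → ℕ) (x : ℕ) : ℕ → List (ℕ × ℕ)
  | 0 => []
  | b + 1 => (x, I b) :: rowQueries I x b

/-- The positions of the first `a` rows of the block of the indices `I 0, …, I (k - 1)`, latest
first. -/
def blockQueries (I : ℕ → ℕ) (k : ℕ) : ℕ → List (ℕ × ℕ)
  | 0 => []
  | a + 1 => rowQueries I (I a) k ++ blockQueries I k a

lemma length_rowQueries (I : ℕ → ℕ) (x b : ℕ) : (rowQueries I x b).length = b := by
  induction b with
  | zero => rfl
  | succ b ih => rw [rowQueries, List.length_cons, ih]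

lemma length_blockQueries (I : ℕ → ℕ) (k a : ℕ) : (blockQueries I k a).length = a * k := by
  induction a with
  | zero => simp [blockQueries]
  | succ a ih => rw [blockQueries, List.length_append, ih, length_rowQueries]; ring

lemma mem_rowQueries {I : ℕ → ℕ} {x b i j : ℕ} :
    (i, j) ∈ rowQueries I x b ↔ i = x ∧ ∃ d < b, I d = j := by
  induction b with
  | zero => simp [rowQueries]
  | succ b ih =>
    rw [rowQueries, List.mem_cons, ih, Prod.mk.injEq, Nat.exists_lt_succ_right, ← and_or_left,
      or_comm, eq_comm (a := j)]

lemma mem_blockQueries {I : ℕ → ℕ} {k a i j : ℕ} :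
    (i, j) ∈ blockQueries I k a ↔ (∃ c < a, I c = i) ∧ ∃ d < k, I d = j := by
  induction a with
  | zero => simp [blockQueries]
  | succ a ih =>
    rw [blockQueries, List.mem_append, ih, mem_rowQueries, Nat.exists_lt_succ_right, ← or_and_right,
      or_comm, eq_comm (a := i)]

/-- Queries the submatrix on the indices in array `B + 1`, and stores it in array `B`. -/
def fillProg (B : ℕ) : Prog :=
  grid B (line (.nload B (B + 1) (B + 3))
    [.nload (B + 1) (B + 1) (B + 2), .query B B (B + 1), .rstore B (B + 3) (B + 2) B])

lemma local_fillProg (B : ℕ) : (fillProg B).Local (B + 4) (B + 1) :=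
  local_grid (by simp only [line, Prog.Local, Instr.Local]; omega)

lemma triple_fillProg (B k t : ℕ) (I : ℕ → ℕ) (q : List (ℕ × ℕ)) :
    Triple O ρ (fillProg B) (k * (k * 6 + 4) + 2)
      (fun m => HasSize B k m ∧ m.draws = t ∧ m.queries = q ∧ ∀ a < k, m.narr (B + 1) a = I a)
      (fun m => HasSize B k m ∧ m.draws = t ∧ m.queries = blockQueries I k k ++ q ∧
        (∀ a < k, m.narr (B + 1) a = I a) ∧
        ∀ i j : Fin k, m.rarr B i j = blockMatrix O I k i j) := by
  have h := Triple.grid (O := O) (ρ := ρ) (B := B) (k := k) (a := B + 1) (T := 4)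
    (body := line (.nload B (B + 1) (B + 3))
      [.nload (B + 1) (B + 1) (B + 2), .query B B (B + 1), .rstore B (B + 3) (B + 2) B])
    (K := fun m => ∀ a < k, m.narr (B + 1) a = I a)
    (I := fun a b m => m.draws = t ∧
      m.queries = rowQueries I (I a) b ++ (blockQueries I k a ++ q) ∧
      ∀ i j : Fin k, ((i : ℕ) < a ∨ (i : ℕ) = a ∧ (j : ℕ) < b) →
        m.rarr B i j = blockMatrix O I k i j)
    (by simp only [line, Prog.Local, Instr.Local]; omega)
    (fun m m' h h' => by rwa [h.narr _ le_rfl]) (fun _ _ _ _ h => h) ?_ ?_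
  · refine h.conseq (le_of_eq (by ring)) (fun m hm => ⟨hm.1, hm.2.2.2, hm.2.1, ?_, ?_⟩) fun m hm =>
      ⟨hm.1, hm.2.2.1, ?_, hm.2.1, fun i j => hm.2.2.2.2 i j (Or.inl i.2)⟩
    · simpa [rowQueries, blockQueries] using hm.2.2.1
    · simp
    · simpa [rowQueries] using hm.2.2.2.1
  · intro a ha b hb
    refine (Triple.line _ _ _).conseq (by norm_num) ?_ fun _ h => h
    rintro m ⟨h1, h2, -, h3, h4, h5, h6⟩
    refine ⟨by simpa [Instr.eff] using h4, ?_, fun i j hij => ?_⟩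
    · simp [Instr.eff, h1, h2, h3 a ha, h3 b hb, h5, rowQueries]
    · by_cases hc : (i : ℕ) = a ∧ (j : ℕ) = b
      · obtain ⟨rfl, rfl⟩ := hc
        simp [Instr.eff, h1, h2, h3 i ha, h3 j hb, blockMatrix]
      · have h7 := h6 i j (by omega)
        simp [Instr.eff, h1, h2, update_cell, hc, h7]
  · rintro a ha m ⟨h3, h4, h5⟩
    refine ⟨h3, by simpa [rowQueries, blockQueries] using h4, fun i j hij => h5 i j (by omega)⟩

/-- A rejected block is on record: the flag is set, and the block of `k` indices from the `t`-th
one on is stored as the certificate. -/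
def Rejected (B : ℕ) (ρ : ℕ → ℕ) (t k : ℕ) (m : Mem) : Prop :=
  m.nreg (B + 7) = 1 ∧ m.nreg (B + 8) = k ∧ ∀ a < k, m.narr (B + 2) a = ρ (t + a)

/-- Puts the present block on record as a rejected one. -/
def recordProg (B : ℕ) : Prog :=
  .seq (line (.nconst (B + 7) 1) [.nconst B 0, .nadd (B + 8) (B + 6) B])
    (loop (B + 3) (B + 6) (B + 5) (line (.nload B (B + 1) (B + 3)) [.nstore (B + 2) (B + 3) B]))

lemma local_recordProg (B : ℕ) : (recordProg B).Local (B + 9) (B + 3) :=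
  ⟨by simp only [line, Prog.Local, Instr.Local]; omega,
    local_loop (by omega) (by simp only [line, Prog.Local, Instr.Local]; omega)⟩

lemma isArithmetical_recordProg (B : ℕ) : (recordProg B).IsArithmetical := by
  simp [recordProg, loop, line, Prog.IsArithmetical]

lemma triple_recordProg (B k t : ℕ) :
    Triple O ρ (recordProg B) (k * 4 + 5)
      (fun m => HasSize B k m ∧ ∀ a < k, m.narr (B + 1) a = ρ (t + a))
      (fun m => HasSize B k m ∧ Rejected B ρ t k m) := by
  have h := Triple.loop (O := O) (ρ := ρ) (x := B + 3) (lim := B + 6) (one := B + 5) (N := k)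
    (a := B + 3) (T := 2) (K := fun m => HasSize B k m ∧ m.nreg (B + 7) = 1 ∧ m.nreg (B + 8) = k)
    (body := line (.nload B (B + 1) (B + 3)) [.nstore (B + 2) (B + 3) B])
    (I := fun i m => (∀ a < k, m.narr (B + 1) a = ρ (t + a)) ∧
      ∀ a < i, m.narr (B + 2) a = ρ (t + a))
    (by omega) (by omega) (by simp only [line, Prog.Local, Instr.Local]; omega)
    (fun m m' h h' => ⟨h'.1.of_agree h (by omega), (h.nreg _ (by omega)).trans h'.2.1,
      (h.nreg _ (by omega)).trans h'.2.2⟩) (fun _ _ _ h => h) ?_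
  · refine ((Triple.line _ _ _).seq h).conseq (by norm_num; linarith) (fun m hm => ?_) fun m hm =>
      ⟨hm.1.1, hm.1.2.1, hm.1.2.2, hm.2.2⟩
    obtain ⟨hs, h1⟩ := hm
    refine ⟨?_, ?_, ⟨⟨?_, ?_, hs.rone, hs.rsize⟩, ?_, ?_⟩, h1, by simp⟩ <;>
      simp [Instr.eff, hs.one, hs.size]
  · intro i hi
    refine (Triple.line _ _ _).conseq (by norm_num) ?_ fun _ h => h
    rintro m ⟨h1, -, h2, h3⟩
    refine ⟨by simpa [Instr.eff] using h2, fun a ha => ?_⟩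
    rcases Nat.lt_succ_iff_lt_or_eq.1 ha with ha | rfl
    · simp [Instr.eff, h1, ha.ne, h3 a ha]
    · simp [Instr.eff, h1, h2 a hi]

/-- Draws a block of indices, queries the submatrix on it, tests it, and puts it on record if it is
rejected. -/
def trialProg (B : ℕ) (M : Prog) : Prog :=
  .seq (drawProg B) (.seq (fillProg B) (.seq (matrixProg B M)
    (.ite (.rlt (B + 6) (B + 2)) (recordProg B) (.instr (.nconst B 0)))))

lemma local_trialProg {B : ℕ} {M : Prog} (hB : 3 ≤ B) (hM : M.Local B B) :
    (trialProg B M).Local (B + 9) (B + 3) :=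
  ⟨(local_drawProg B).mono (by omega) (by omega), (local_fillProg B).mono (by omega) (by omega),
    (local_matrixProg hB hM).mono (by omega) (by omega), local_recordProg B,
    by simp only [Prog.Local, Instr.Local]; omega⟩

lemma triple_trialProg {B k N : ℕ} {M : Prog} {T W : ℝ} (hB : 3 ≤ B) (hloc : M.Local B B)
    (hA : M.IsArithmetical) (hM : Multiplies M k T) (hk : 1 ≤ k)
    (hlt : ∀ i < N, (2 : ℝ) ^ i < W) (hle : W ≤ 2 ^ N)
    (t : ℕ) (q : List (ℕ × ℕ)) {F : Mem → Prop}
    (hF : ∀ m m', Agree (B + 5) (B + 2) m m' → F m → F m') :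
    Triple O ρ (trialProg B M) (61 * (k : ℝ) ^ 2 * (N + 1) + N * T)
      (fun m => HasSize B k m ∧ m.rreg (B + 17) = W ∧ m.draws = t ∧ m.queries = q ∧ F m)
      (fun m => HasSize B k m ∧ m.draws = t + k ∧
        m.queries = blockQueries (fun a => ρ (t + a)) k k ++ q ∧
        (Detects O N (fun a => ρ (t + a)) k ∧ Rejected B ρ t k m ∨
          ¬ Detects O N (fun a => ρ (t + a)) k ∧ F m)) := by
  set I : ℕ → ℕ := fun a => ρ (t + a) with hI
  set q' := blockQueries I k k ++ q with hq'
  have h1 := (triple_drawProg (O := O) (ρ := ρ) B k t q).keep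
    (K := fun m => m.rreg (B + 17) = W ∧ F m) (local_drawProg B) fun m m' h h' =>
      ⟨(h.rreg _ (by omega)).trans h'.1, hF _ _ (h.mono (by omega) le_rfl) h'.2⟩
  have h2 := (triple_fillProg (O := O) (ρ := ρ) B k (t + k) I q).keep
    (K := fun m => m.rreg (B + 17) = W ∧ F m) (local_fillProg B) fun m m' h h' =>
      ⟨(h.rreg _ (by omega)).trans h'.1, hF _ _ (h.mono (by omega) (by omega)) h'.2⟩
  have h3 := ((triple_matrixProg (O := O) (ρ := ρ) hB hloc hM (blockMatrix O I k) hlt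
    hle).sameRecords (isArithmetical_matrixProg B hA) ⟨0, 0, 0, 0, t + k, q'⟩).keep
    (K := fun m => F m ∧ ∀ a < k, m.narr (B + 1) a = I a) (local_matrixProg hB hloc)
    fun m m' h h' => ⟨hF _ _ (h.mono le_rfl (by omega)) h'.1,
      by rw [h.narr _ (by omega)]; exact h'.2⟩
  have h4 := (triple_recordProg (O := O) (ρ := ρ) B k t).sameRecords
    (isArithmetical_recordProg B) ⟨0, 0, 0, 0, t + k, q'⟩
  have h5 : Triple O ρ (.ite (.rlt (B + 6) (B + 2)) (recordProg B) (.instr (.nconst B 0)))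
      (k * 4 + 5 + 1)
      (fun m => (F m ∧ ∀ a < k, m.narr (B + 1) a = I a) ∧
        SameRecords ⟨0, 0, 0, 0, t + k, q'⟩ m ∧ HasSize B k m ∧
        m.rreg (B + 2) = (shifted (blockMatrix O I k) ^ 2 ^ N).trace)
      (fun m => HasSize B k m ∧ m.draws = t + k ∧ m.queries = q' ∧
        (Detects O N I k ∧ Rejected B ρ t k m ∨ ¬ Detects O N I k ∧ F m)) := by
    refine Triple.ite ?_ ?_
    · intro s hs
      obtain ⟨⟨⟨-, h6⟩, h7, h8, h9⟩, h10⟩ := hs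
      obtain ⟨s', e1, e2, e3⟩ := h4 s ⟨h7, h8, h6⟩
      refine ⟨s', e1, e2, e3.2.1, e3.1.1, e3.1.2, Or.inl ⟨?_, e3.2.2⟩⟩
      simpa only [Test.sat, h9, h8.rsize, Detects] using h10
    · refine (Triple.instr _ _).conseq (by linarith [(k.cast_nonneg : (0 : ℝ) ≤ k)]) ?_
        fun _ h => h
      rintro m ⟨⟨⟨h6, -⟩, h7, h8, h9⟩, h10⟩
      have hag : Agree (B + 5) (B + 2) m ((Instr.nconst B 0).eff O ρ m) :=
        Instr.Local.agree_eff (by simp only [Instr.Local]; omega) O ρ m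
      refine ⟨h8.of_agree hag le_rfl, h7.1, h7.2, Or.inr ⟨?_, hF _ _ hag h6⟩⟩
      simpa only [Test.sat, h9, h8.rsize, Detects] using h10
  refine (h1.seq ((h2.conseq le_rfl ?_ fun _ h => h).seq
    ((h3.conseq le_rfl ?_ fun _ h => h).seq h5))).conseq ?_ ?_ fun _ h => h
  · rintro m ⟨h6, h7⟩
    exact ⟨h6, h7⟩
  · rintro m ⟨h6, h7, h8, h9, h10, h11⟩
    exact ⟨⟨h6.2, h10⟩, ⟨h8, h9⟩, h6.1, h7, h11⟩
  · have hk' : (1 : ℝ) ≤ k := by exact_mod_cast hk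
    have hN : (0 : ℝ) ≤ N := N.cast_nonneg
    have e1 : (k : ℝ) ≤ k ^ 2 := by nlinarith
    have e2 : (N : ℝ) * (k * (k * 5 + 4) + 4 + T + 2) ≤ 15 * k ^ 2 * N + N * T := by
      have : (k : ℝ) * (k * 5 + 4) + 4 + T + 2 ≤ 15 * k ^ 2 + T := by nlinarith
      nlinarith
    nlinarith
  · rintro m ⟨h6, h7, h8, h9, h10⟩
    exact ⟨⟨h7, h10⟩, h6, h8, h9⟩

end Rules

/-! ### The whole program -/

section Rules

variable {O : ℕ → ℕ → ℝ} {ρ : ℕ → ℕ}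

/-- The record of queries after the blocks of the lengths `l`. -/
def allQueries (ρ : ℕ → ℕ) (l : List ℕ) : List (ℕ × ℕ) :=
  (blocks 0 l).reverse.flatMap fun b => blockQueries (fun a => ρ (b.1 + a)) b.2 b.2

lemma allQueries_concat (ρ : ℕ → ℕ) (l : List ℕ) (k : ℕ) :
    allQueries ρ (l ++ [k])
      = blockQueries (fun a => ρ (l.sum + a)) k k ++ allQueries ρ l := by
  simp [allQueries, blocks_append, blocks]

/-- What is known about the blocks of the lengths `l`: either none of them is rejected and the flag
is not set, or one that is rejected is on record. -/
def Status (O : ℕ → ℕ → ℝ) (ρ : ℕ → ℕ) (B N : ℕ) (l : List ℕ) (m : Mem) : Prop :=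
  (m.nreg (B + 7) = 0 ∧ m.nreg (B + 8) = 0 ∧
      ∀ b ∈ blocks 0 l, ¬ Detects O N (fun a => ρ (b.1 + a)) b.2) ∨
    ∃ b ∈ blocks 0 l, Detects O N (fun a => ρ (b.1 + a)) b.2 ∧ Rejected B ρ b.1 b.2 m

lemma Status.of_agree {B N b a : ℕ} {l : List ℕ} {m m' : Mem} (h' : Agree b a m m')
    (hb : b ≤ B + 7) (ha : a ≤ B + 2) (h : Status O ρ B N l m) : Status O ρ B N l m' := by
  have h7 := h'.nreg (B + 7) hb
  have h8 := h'.nreg (B + 8) (by omega)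
  have h2 := h'.narr (B + 2) ha
  simpa only [Status, Rejected, h7, h8, h2] using h

/-- The situation after the blocks of the lengths `l`. -/
structure Done (O : ℕ → ℕ → ℝ) (ρ : ℕ → ℕ) (B N : ℕ) (l : List ℕ) (m : Mem) : Prop where
  draws : m.draws = l.sum
  queries : m.queries = allQueries ρ l
  status : Status O ρ B N l m

lemma triple_trialProg_done {B k N : ℕ} {M : Prog} {T W : ℝ} (hB : 3 ≤ B) (hloc : M.Local B B)
    (hA : M.IsArithmetical) (hM : Multiplies M k T) (hk : 1 ≤ k)
    (hlt : ∀ i < N, (2 : ℝ) ^ i < W) (hle : W ≤ 2 ^ N) (l : List ℕ) :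
    Triple O ρ (trialProg B M) (61 * (k : ℝ) ^ 2 * (N + 1) + N * T)
      (fun m => m.rreg (B + 17) = W ∧ HasSize B k m ∧ Done O ρ B N l m)
      (fun m => m.rreg (B + 17) = W ∧ HasSize B k m ∧ Done O ρ B N (l ++ [k]) m) := by
  have h := (triple_trialProg (O := O) (ρ := ρ) hB hloc hA hM hk hlt hle l.sum (allQueries ρ l)
    (F := Status O ρ B N l) fun m m' h h' => h'.of_agree h (by omega) le_rfl).keep
    (K := fun m => m.rreg (B + 17) = W) (local_trialProg hB hloc)
    fun m m' h h' => (h.rreg _ (by omega)).trans h'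
  refine h.conseq le_rfl (fun m hm => ⟨hm.1, hm.2.1, hm.1, hm.2.2.draws, hm.2.2.queries,
    hm.2.2.status⟩) fun m hm => ?_
  obtain ⟨h1, h2, h3, h4, h5⟩ := hm
  refine ⟨h1, h2, by simpa using h3, by rw [h4, allQueries_concat], ?_⟩
  have hb : blocks 0 (l ++ [k]) = blocks 0 l ++ [(l.sum, k)] := by simp [blocks_append, blocks]
  rw [Status, hb]
  rcases h5 with ⟨h5, h6⟩ | ⟨h5, h6 | ⟨b, h6, h7⟩⟩
  · exact Or.inr ⟨(l.sum, k), by simp, h5, h6⟩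
  · refine Or.inl ⟨h6.1, h6.2.1, fun b hb => ?_⟩
    rcases List.mem_append.1 hb with hb | hb
    · exact h6.2.2 b hb
    · rw [List.mem_singleton.1 hb]
      exact h5
  · exact Or.inr ⟨b, List.mem_append_left _ h6, h7⟩

/-- Tests as many blocks of the present size as the real register `B + 18` tells. -/
def repeatProg (B : ℕ) (M : Prog) : Prog :=
  .seq (.instr (.rconst (B + 10) 0)) (.while (.rlt (B + 10) (B + 18))
    (.seq (trialProg B M) (.instr (.radd (B + 10) (B + 10) (B + 5)))))

lemma local_repeatProg {B : ℕ} {M : Prog} (hB : 3 ≤ B) (hM : M.Local B B) :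
    (repeatProg B M).Local (B + 11) (B + 3) :=
  ⟨by simp only [Prog.Local, Instr.Local]; omega, (local_trialProg hB hM).mono (by omega) le_rfl,
    by simp only [Prog.Local, Instr.Local]; omega⟩

lemma triple_repeatProg {B k N : ℕ} {M : Prog} {T W : ℝ} (hB : 3 ≤ B) (hloc : M.Local B B)
    (hA : M.IsArithmetical) (hM : Multiplies M k T) (hk : 1 ≤ k)
    (hlt : ∀ i < N, (2 : ℝ) ^ i < W) (hle : W ≤ 2 ^ N) (l : List ℕ) (r : ℕ) :
    Triple O ρ (repeatProg B M) (r * (61 * (k : ℝ) ^ 2 * (N + 1) + N * T + 2) + 2)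
      (fun m => m.rreg (B + 18) = r ∧ m.rreg (B + 17) = W ∧ HasSize B k m ∧ Done O ρ B N l m)
      (fun m => m.rreg (B + 17) = W ∧ HasSize B k m ∧
        Done O ρ B N (l ++ List.replicate r k) m) := by
  set I : ℕ → Mem → Prop := fun i m => (m.rreg (B + 10) = i ∧ m.rreg (B + 18) = r) ∧
    m.rreg (B + 17) = W ∧ HasSize B k m ∧ Done O ρ B N (l ++ List.replicate i k) m with hI
  have hag (i : Instr) (hi : i = .radd (B + 10) (B + 10) (B + 5) ∨ i = .rconst (B + 10) 0)
      {l : List ℕ} (m : Mem) (hm : m.rreg (B + 17) = W ∧ HasSize B k m ∧ Done O ρ B N l m) :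
      (i.eff O ρ m).rreg (B + 17) = W ∧ HasSize B k (i.eff O ρ m) ∧
        Done O ρ B N l (i.eff O ρ m) := by
    obtain ⟨h1, ⟨h2, h3, h4, h5⟩, h6, h7, h8⟩ := hm
    rcases hi with rfl | rfl
    · exact ⟨by simpa [Instr.eff] using h1, ⟨h2, h3, by simpa [Instr.eff] using h4,
        by simpa [Instr.eff] using h5⟩, h6, h7, h8⟩
    · exact ⟨by simpa [Instr.eff] using h1, ⟨h2, h3, by simpa [Instr.eff] using h4,
        by simpa [Instr.eff] using h5⟩, h6, h7, h8⟩
  have hbody (i : ℕ) : Triple O ρ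
      (.seq (trialProg B M) (.instr (.radd (B + 10) (B + 10) (B + 5))))
      (61 * (k : ℝ) ^ 2 * (N + 1) + N * T + 1) (I i) (I (i + 1)) := by
    refine (((triple_trialProg_done hB hloc hA hM hk hlt hle (l ++ List.replicate i k)).keep
      (K := fun m => m.rreg (B + 10) = i ∧ m.rreg (B + 18) = r) (local_trialProg hB hloc)
      fun m m' h h' => ⟨(h.rreg _ (by omega)).trans h'.1,
        (h.rreg _ (by omega)).trans h'.2⟩).conseq le_rfl (fun _ h => h) ?_).seq (Triple.instr _ _)
    rintro m ⟨⟨h1, h2⟩, h3⟩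
    refine ⟨⟨?_, by simpa [Instr.eff] using h2⟩, ?_⟩
    · simp [Instr.eff, h1, h3.2.1.rone]
    · rw [List.replicate_succ', ← List.append_assoc]
      exact hag _ (Or.inl rfl) m h3
  have h := Triple.while_const (O := O) (ρ := ρ) (b := .rlt (B + 10) (B + 18)) (N := r)
    (fun i _ => hbody i)
    (fun i hi m hm => by simp only [Test.sat, hm.1.1, hm.1.2]; exact_mod_cast hi)
    (fun m hm => by simp only [Test.sat, hm.1.1, hm.1.2, lt_irrefl, not_false_iff])
  refine ((Triple.instr _ _).seq h).conseq (by linarith) (fun m hm => ?_) fun m hm => hm.2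
  refine ⟨⟨by simp [Instr.eff], by simpa [Instr.eff] using hm.1⟩, ?_⟩
  simpa using hag _ (Or.inr rfl) m hm.2

/-- Goes through all the scales. -/
def scalesProg (B : ℕ) (M : Prog) : Prog :=
  .while (.rlt (B + 11) (B + 12)) (.seq (repeatProg B M) (line (.rconst B 4)
    [.rdiv (B + 18) (B + 18) B, .nadd (B + 6) (B + 6) (B + 6), .radd (B + 6) (B + 6) (B + 6),
      .radd (B + 11) (B + 11) (B + 5)]))

/-- The sizes of the blocks of the first `j` scales. -/
def sizesBelow (J j : ℕ) : List ℕ :=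
  (List.range j).flatMap fun i => List.replicate (256000 * (J + 1) * 4 ^ (J - i)) (2 * 2 ^ i)

lemma sizesBelow_succ (J j : ℕ) : sizesBelow J (j + 1)
    = sizesBelow J j ++ List.replicate (256000 * (J + 1) * 4 ^ (J - j)) (2 * 2 ^ j) := by
  simp [sizesBelow, List.range_succ]

lemma triple_scalesProg {B J N : ℕ} {M : Prog} {T : ℕ → ℝ} {W : ℝ} (hB : 3 ≤ B)
    (hloc : M.Local B B) (hA : M.IsArithmetical) (hM : ∀ k, 1 ≤ k → Multiplies M k (T k))
    (hlt : ∀ i < N, (2 : ℝ) ^ i < W) (hle : W ≤ 2 ^ N) :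
    Triple O ρ (scalesProg B M)
      (∑ j ∈ range (J + 1), (256000 * (J + 1) * 4 ^ (J - j) *
        (61 * (2 * 2 ^ j) ^ 2 * (N + 1) + N * T (2 * 2 ^ j) + 2) + 8) + 1)
      (fun m => m.rreg (B + 11) = 0 ∧ m.rreg (B + 12) = J + 1 ∧
        m.rreg (B + 18) = 256000 * (J + 1) * 4 ^ J ∧ m.rreg (B + 17) = W ∧ HasSize B 2 m ∧
        Done O ρ B N [] m)
      (fun m => (∃ k, HasSize B k m) ∧ Done O ρ B N (sizes J) m) := by
  set I : ℕ → Mem → Prop := fun j m =>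
    (m.rreg (B + 11) = j ∧ m.rreg (B + 12) = J + 1 ∧
      m.rreg (B + 18) = 256000 * (J + 1) * 4 ^ J / 4 ^ j) ∧ m.rreg (B + 17) = W ∧
      HasSize B (2 * 2 ^ j) m ∧ Done O ρ B N (sizesBelow J j) m with hI
  have hbody (j : ℕ) (hj : j < J + 1) : Triple O ρ (.seq (repeatProg B M) (line (.rconst B 4)
      [.rdiv (B + 18) (B + 18) B, .nadd (B + 6) (B + 6) (B + 6), .radd (B + 6) (B + 6) (B + 6),
        .radd (B + 11) (B + 11) (B + 5)]))
      (256000 * (J + 1) * 4 ^ (J - j) *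
        (61 * (2 * 2 ^ j) ^ 2 * (N + 1) + N * T (2 * 2 ^ j) + 2) + 7) (I j) (I (j + 1)) := by
    have hr : ((256000 * (J + 1) * 4 ^ (J - j) : ℕ) : ℝ) = 256000 * (J + 1) * 4 ^ J / 4 ^ j := by
      push_cast
      rw [eq_div_iff (by positivity), mul_assoc, ← pow_add, Nat.sub_add_cancel (by omega)]
    have hk : 1 ≤ 2 * 2 ^ j := Nat.succ_le_of_lt (by positivity)
    have h := (triple_repeatProg (O := O) (ρ := ρ) hB hloc hA (hM (2 * 2 ^ j) hk) hk hlt hle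
      (sizesBelow J j) (256000 * (J + 1) * 4 ^ (J - j))).keep
      (K := fun m => m.rreg (B + 11) = j ∧ m.rreg (B + 12) = J + 1 ∧
        m.rreg (B + 18) = 256000 * (J + 1) * 4 ^ J / 4 ^ j) (local_repeatProg hB hloc)
      fun m m' h h' => ⟨(h.rreg _ (by omega)).trans h'.1, (h.rreg _ (by omega)).trans h'.2.1,
        (h.rreg _ (by omega)).trans h'.2.2⟩
    refine ((h.conseq le_rfl (fun m hm => ⟨hm.1, hm.1.2.2.trans hr.symm, hm.2⟩) ?_).seq
      (Triple.line _ _ _)).conseq ?_ (fun _ h => h) fun _ h => h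
    · rintro m ⟨⟨h1, h2, h3⟩, h4, h5, h6⟩
      rw [← sizesBelow_succ] at h6
      refine ⟨⟨?_, ?_, ?_⟩, ?_, ⟨?_, ?_, ?_, ?_⟩, h6.draws, h6.queries, ?_⟩
      · simp [Instr.eff, h1, h5.rone]
      · simp [Instr.eff, h2]
      · simp [Instr.eff, h3, pow_succ, div_div]
      · simp [Instr.eff, h4]
      · simp [Instr.eff, h5.one]
      · simp [Instr.eff, h5.size]; ring
      · simp [Instr.eff, h5.rone]
      · simp [Instr.eff, h5.rsize]; ring
      · have h7 := h6.status
        simpa [Status, Rejected, Instr.eff] using h7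
    · push_cast
      norm_num
      linarith
  have h := Triple.while (O := O) (ρ := ρ) (b := .rlt (B + 11) (B + 12)) (N := J + 1) hbody
    (fun i hi m hm => by simp only [Test.sat, hm.1.1, hm.1.2.1]; exact_mod_cast hi)
    (fun m hm => by
      simp only [Test.sat, hm.1.1, hm.1.2.1]
      push_cast
      exact lt_irrefl _)
  refine h.conseq (le_of_eq ?_) (fun m hm => ?_) fun m hm => ⟨⟨_, hm.2.2.1⟩, hm.2.2.2⟩
  · congr 1
    exact Finset.sum_congr rfl fun j _ => by ring
  · obtain ⟨h1, h2, h3, h4, h5, h6⟩ := hm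
    exact ⟨⟨by simpa using h1, h2, by simpa using h3⟩, h4, by simpa using h5, h6⟩

/-- Computes the least `J` with `32 ≤ ε 2 ^ J`, and initializes the registers. -/
def initProg (B : ℕ) : Prog :=
  .seq (line (.nconst (B + 5) 1) [.rconst (B + 5) 1, .rconst B 0, .radd (B + 13) 0 B,
      .radd (B + 14) 0 B, .rconst (B + 15) 1, .rconst (B + 12) 1, .rconst (B + 16) 32])
    (.seq (.while (.rlt (B + 13) (B + 16)) (line (.radd (B + 13) (B + 13) (B + 13))
      [.radd (B + 15) (B + 15) (B + 15), .radd (B + 12) (B + 12) (B + 5)]))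
    (.seq (line (.rconst B 256000) [.rmul (B + 18) B (B + 12), .rmul (B + 18) (B + 18) (B + 15),
      .rmul (B + 18) (B + 18) (B + 15)])
    (.seq (line (.rconst B 8) [.rmul (B + 17) B (B + 15), .rmul (B + 17) (B + 17) (B + 15),
      .rdiv (B + 17) (B + 17) (B + 14)])
    (line (.rconst (B + 11) 0) [.nconst (B + 6) 2, .rconst (B + 6) 2, .nconst (B + 7) 0,
      .nconst (B + 8) 0]))))

lemma triple_initProg {B J : ℕ} {ε : ℝ} (hB : 3 ≤ B) (hlt : ∀ i < J, ε * 2 ^ i < 32)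
    (hle : 32 ≤ ε * 2 ^ J) (N : ℕ) :
    Triple O ρ (initProg B) (4 * J + 22)
      (fun m => m.rreg 0 = ε ∧ m.draws = 0 ∧ m.queries = [])
      (fun m => m.rreg (B + 11) = 0 ∧ m.rreg (B + 12) = J + 1 ∧
        m.rreg (B + 18) = 256000 * (J + 1) * 4 ^ J ∧ m.rreg (B + 17) = 8 * 4 ^ J / ε ∧
        HasSize B 2 m ∧ Done O ρ B N [] m) := by
  have h0 : 0 ≠ B := by omega
  set I : ℕ → Mem → Prop := fun i m => m.rreg (B + 13) = ε * 2 ^ i ∧ m.rreg (B + 14) = ε ∧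
    m.rreg (B + 15) = 2 ^ i ∧ m.rreg (B + 12) = i + 1 ∧ m.rreg (B + 16) = 32 ∧
    m.rreg (B + 5) = 1 ∧ m.nreg (B + 5) = 1 ∧ m.draws = 0 ∧ m.queries = [] with hI
  have hbody (i : ℕ) : Triple O ρ (line (.radd (B + 13) (B + 13) (B + 13))
      [.radd (B + 15) (B + 15) (B + 15), .radd (B + 12) (B + 12) (B + 5)]) 3 (I i) (I (i + 1)) := by
    refine (Triple.line _ _ _).conseq (by norm_num) ?_ fun _ h => h
    rintro m ⟨h1, h2, h3, h4, h5, h6, h7, h8, h9⟩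
    refine ⟨?_, ?_, ?_, ?_, ?_, ?_, h7, h8, h9⟩ <;>
      simp [Instr.eff, h1, h2, h3, h4, h5, h6, pow_succ] <;> ring
  have h := Triple.while_const (O := O) (ρ := ρ) (b := .rlt (B + 13) (B + 16)) (N := J)
    (fun i _ => hbody i)
    (fun i hi m hm => by simp only [Test.sat, hm.1, hm.2.2.2.2.1, hlt i hi])
    (fun m hm => by simp only [Test.sat, hm.1, hm.2.2.2.2.1, not_lt, hle])
  have h44 : (4 : ℝ) ^ J = 2 ^ J * 2 ^ J := by rw [← mul_pow]; norm_num
  have hfirst : Triple O ρ (line (.nconst (B + 5) 1) [.rconst (B + 5) 1, .rconst B 0,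
      .radd (B + 13) 0 B, .radd (B + 14) 0 B, .rconst (B + 15) 1, .rconst (B + 12) 1,
      .rconst (B + 16) 32]) 8 (fun m => m.rreg 0 = ε ∧ m.draws = 0 ∧ m.queries = []) (I 0) := by
    refine (Triple.line _ _ _).conseq (by norm_num) ?_ fun _ h => h
    rintro m ⟨h1, h2, h3⟩
    simp only [List.foldl, Instr.eff, hI]
    refine ⟨?_, ?_, ?_, ?_, ?_, ?_, ?_, h2, h3⟩ <;> simp [h1, h0]
  have hR : Triple O ρ (line (.rconst B 256000) [.rmul (B + 18) B (B + 12),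
      .rmul (B + 18) (B + 18) (B + 15), .rmul (B + 18) (B + 18) (B + 15)]) 4 (I J)
      (fun m => m.rreg (B + 18) = 256000 * (J + 1) * 4 ^ J ∧ I J m) := by
    refine (Triple.line _ _ _).conseq (by norm_num) ?_ fun _ h => h
    rintro m ⟨h1, h2, h3, h4, h5, h6, h7, h8, h9⟩
    simp only [List.foldl, Instr.eff, hI]
    refine ⟨?_, ?_, ?_, ?_, ?_, ?_, ?_, h7, h8, h9⟩ <;> simp [h1, h2, h3, h4, h5, h6, h44]
    ring
  have hW : Triple O ρ (line (.rconst B 8) [.rmul (B + 17) B (B + 15),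
      .rmul (B + 17) (B + 17) (B + 15), .rdiv (B + 17) (B + 17) (B + 14)]) 4
      (fun m => m.rreg (B + 18) = 256000 * (J + 1) * 4 ^ J ∧ I J m)
      (fun m => m.rreg (B + 17) = 8 * 4 ^ J / ε ∧ m.rreg (B + 18) = 256000 * (J + 1) * 4 ^ J ∧
        I J m) := by
    refine (Triple.line _ _ _).conseq (by norm_num) ?_ fun _ h => h
    rintro m ⟨h, h1, h2, h3, h4, h5, h6, h7, h8, h9⟩
    simp only [List.foldl, Instr.eff, hI]
    refine ⟨?_, ?_, ?_, ?_, ?_, ?_, ?_, ?_, h7, h8, h9⟩ <;> simp [h, h1, h2, h3, h4, h5, h6, h44]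
    ring
  refine (hfirst.seq (h.seq (hR.seq (hW.seq ((Triple.line _ _ _).conseq (T' := 5) (by norm_num)
    ?_ fun _ h => h))))).conseq (by linarith) (fun _ h => h) fun _ h => h
  rintro m ⟨hw, hr, h1, h2, h3, h4, h5, h6, h7, h8, h9⟩
  simp only [List.foldl, Instr.eff]
  refine ⟨?_, ?_, ?_, ?_, ⟨?_, ?_, ?_, ?_⟩, h8, h9, Or.inl ⟨?_, ?_, ?_⟩⟩
  · simp
  · simp [h4]
  · simp [hr]
  · simp [hw]
  · simp [h7]
  · simp
  · simp [h6]
  · simp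
  · simp
  · simp
  · simp [blocks]

/-- Moves the flag and the certificate to the places for the output. -/
def outputProg (B : ℕ) : Prog :=
  .seq (loop (B + 3) (B + 8) (B + 5) (line (.nload B (B + 2) (B + 3)) [.nstore 0 (B + 3) B]))
    (line (.nconst B 0) [.nadd 0 (B + 7) B, .nadd 1 (B + 8) B])

lemma triple_outputProg {B : ℕ} (hB : 3 ≤ B) (k f : ℕ) (v : ℕ → ℕ) (q : List (ℕ × ℕ)) :
    Triple O ρ (outputProg B) (k * 4 + 5)
      (fun m => m.nreg (B + 5) = 1 ∧ m.nreg (B + 7) = f ∧ m.nreg (B + 8) = k ∧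
        m.queries = q ∧ ∀ a < k, m.narr (B + 2) a = v a)
      (fun m => m.nreg 0 = f ∧ m.nreg 1 = k ∧ m.queries = q ∧ ∀ a < k, m.narr 0 a = v a) := by
  have h := Triple.loop (O := O) (ρ := ρ) (x := B + 3) (lim := B + 8) (one := B + 5) (N := k)
    (a := 1) (T := 2) (K := fun m => m.nreg (B + 7) = f ∧ m.nreg (B + 8) = k ∧
      ∀ a < k, m.narr (B + 2) a = v a)
    (body := line (.nload B (B + 2) (B + 3)) [.nstore 0 (B + 3) B])
    (I := fun i m => m.queries = q ∧ ∀ a < i, m.narr 0 a = v a)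
    (by omega) (by omega) (by simp only [line, Prog.Local, Instr.Local]; omega)
    (fun m m' h h' => ⟨(h.nreg _ (by omega)).trans h'.1, (h.nreg _ (by omega)).trans h'.2.1,
      by rw [h.narr _ (by omega)]; exact h'.2.2⟩) (fun _ _ _ h => h) ?_
  · refine ((h.conseq le_rfl (fun m hm => ⟨hm.2.2.1, hm.1, ⟨hm.2.1, hm.2.2.1, hm.2.2.2.2⟩,
      hm.2.2.2.1, by simp⟩) ?_).seq (Triple.line _ _ _)).conseq (by norm_num; linarith)
      (fun _ h => h) fun _ h => h
    rintro m ⟨⟨h1, h2, -⟩, h3, h4⟩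
    refine ⟨?_, ?_, h3, h4⟩
    · have h5 : B ≠ 0 := by omega
      simp [Instr.eff, h1, h5]
    · have h5 : B ≠ 0 := by omega
      simp [Instr.eff, h2, h5]
  · intro i hi
    refine (Triple.line _ _ _).conseq (by norm_num) ?_ fun _ h => h
    rintro m ⟨h1, ⟨-, -, h2⟩, h3, h4⟩
    refine ⟨h3, fun a ha => ?_⟩
    rcases Nat.lt_succ_iff_lt_or_eq.1 ha with ha | rfl
    · simp [Instr.eff, h1, ha.ne, h4 a ha]
    · simp [Instr.eff, h1, h2 a hi]

/-- The tester; `M` is a program for matrix multiplication, and the registers and arrays from `B`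
on are free for use. -/
def testerProg (B : ℕ) (M : Prog) : Prog :=
  .seq (initProg B) (.seq (scalesProg B M) (outputProg B))

/-- The result of the run on the blocks of the lengths `l`. -/
def Result (O : ℕ → ℕ → ℝ) (ρ : ℕ → ℕ) (N : ℕ) (l : List ℕ) (m : Mem) : Prop :=
  (m.nreg 0 = 0 ∧ ∀ b ∈ blocks 0 l, ¬ Detects O N (fun a => ρ (b.1 + a)) b.2) ∨
    ∃ b ∈ blocks 0 l, Detects O N (fun a => ρ (b.1 + a)) b.2 ∧
      m.nreg 0 = 1 ∧ m.nreg 1 = b.2 ∧ ∀ a < b.2, m.narr 0 a = ρ (b.1 + a)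

lemma le_of_mem_sizes {J k : ℕ} (h : k ∈ sizes J) : k ≤ 2 * 2 ^ J := by
  simp only [sizes, List.mem_flatMap, List.mem_range, List.mem_replicate] at h
  obtain ⟨j, hj, -, rfl⟩ := h
  exact Nat.mul_le_mul_left 2 (Nat.pow_le_pow_right (by norm_num) (by omega))

lemma triple_testerProg {B J N : ℕ} {M : Prog} {T : ℕ → ℝ} {ε : ℝ} (hB : 3 ≤ B)
    (hloc : M.Local B B) (hA : M.IsArithmetical) (hM : ∀ k, 1 ≤ k → Multiplies M k (T k))
    (hJlt : ∀ i < J, ε * 2 ^ i < 32) (hJle : 32 ≤ ε * 2 ^ J)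
    (hlt : ∀ i < N, (2 : ℝ) ^ i < 8 * 4 ^ J / ε) (hle : 8 * 4 ^ J / ε ≤ 2 ^ N) :
    Triple O ρ (testerProg B M)
      (∑ j ∈ range (J + 1), (256000 * (J + 1) * 4 ^ (J - j) *
        (61 * (2 * 2 ^ j) ^ 2 * (N + 1) + N * T (2 * 2 ^ j) + 2) + 8) + (4 * J + 8 * 2 ^ J + 28))
      (fun m => m.rreg 0 = ε ∧ m.draws = 0 ∧ m.queries = [])
      (fun m => m.queries = allQueries ρ (sizes J) ∧ Result O ρ N (sizes J) m) := by
  have hout : Triple O ρ (outputProg B) (8 * 2 ^ J + 5)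
      (fun m => (∃ k, HasSize B k m) ∧ Done O ρ B N (sizes J) m)
      (fun m => m.queries = allQueries ρ (sizes J) ∧ Result O ρ N (sizes J) m) := by
    rintro s ⟨⟨k, hs⟩, hd⟩
    rcases hd.status with ⟨h1, h2, h3⟩ | ⟨b, h1, h2, h3, h4, h5⟩
    · obtain ⟨s', e1, e2, e3⟩ := triple_outputProg (O := O) (ρ := ρ) hB 0 0 0
        (allQueries ρ (sizes J)) s ⟨hs.one, h1, h2, hd.queries, by simp⟩
      refine ⟨s', e1, e2.trans ?_, e3.2.2.1, Or.inl ⟨e3.1, h3⟩⟩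
      have : (0 : ℝ) ≤ 2 ^ J := by positivity
      push_cast
      linarith
    · obtain ⟨s', e1, e2, e3⟩ := triple_outputProg (O := O) (ρ := ρ) hB b.2 1
        (fun a => ρ (b.1 + a)) (allQueries ρ (sizes J)) s ⟨hs.one, h3, h4, hd.queries, h5⟩
      refine ⟨s', e1, e2.trans ?_, e3.2.2.1, Or.inr ⟨b, h1, h2, e3.1, e3.2.1, e3.2.2.2⟩⟩
      have h6 : (b.2 : ℝ) ≤ 2 * 2 ^ J := by
        exact_mod_cast le_of_mem_sizes (snd_mem_of_mem_blocks h1)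
      linarith
  exact ((triple_initProg hB hJlt hJle N).seq ((triple_scalesProg hB hloc hA hM hlt hle).seq
    hout)).conseq (by linarith) (fun _ h => h) fun _ h => h

end Rules

/-! ### Estimates of the cost -/

lemma card_toFinset_sizes_le (J : ℕ) : (sizes J).toFinset.card ≤ J + 1 := by
  have h : (sizes J).toFinset ⊆ (range (J + 1)).image fun j => 2 * 2 ^ j := fun k hk => by
    simp only [sizes, List.mem_toFinset, List.mem_flatMap, List.mem_range,
      List.mem_replicate] at hk
    obtain ⟨j, hj, -, rfl⟩ := hk
    exact mem_image_of_mem _ (mem_range.2 hj)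
  exact (card_le_card h).trans (card_image_le.trans (card_range _).le)

lemma pos_of_mem_sizes {J k : ℕ} (h : k ∈ sizes J) : 1 ≤ k := by
  simp only [sizes, List.mem_flatMap, List.mem_range, List.mem_replicate] at h
  obtain ⟨j, hj, -, rfl⟩ := h
  exact Nat.succ_le_of_lt (by positivity)

lemma length_allQueries (ρ : ℕ → ℕ) (l : List ℕ) :
    (allQueries ρ l).length = (l.map (· ^ 2)).sum := by
  induction l using List.reverseRecOn with
  | nil => simp [allQueries, blocks]
  | append_singleton l k ih =>
    rw [allQueries_concat, List.length_append, ih, length_blockQueries]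
    simp [sq, add_comm]

lemma sum_sq_sizes (J : ℕ) :
    ((sizes J).map (· ^ 2)).sum = 1024000 * (J + 1) ^ 2 * 4 ^ J := by
  have h (n : ℕ) (hn : n ≤ J + 1) :
      ((sizesBelow J n).map (· ^ 2)).sum = n * (1024000 * (J + 1) * 4 ^ J) := by
    induction n with
    | zero => simp [sizesBelow]
    | succ n ih =>
      have h1 : (4 : ℕ) ^ J = 4 ^ (J - n) * 4 ^ n := by
        rw [← pow_add, Nat.sub_add_cancel (by omega)]
      have h2 : ((2 : ℕ) * 2 ^ n) ^ 2 = 4 * 4 ^ n := by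
        rw [mul_pow, ← pow_mul, mul_comm n, pow_mul]; norm_num
      rw [sizesBelow_succ, List.map_append, List.sum_append, ih (by omega)]
      simp only [List.map_replicate, List.sum_replicate, smul_eq_mul, h2, h1]
      ring
  rw [show sizes J = sizesBelow J (J + 1) from rfl, h _ le_rfl]
  ring

/-- The positions queried are those of the principal submatrices on the sampled sets. -/
lemma mem_allQueries {n : ℕ} (ρ : ℕ → Fin n) (l : List ℕ) (i j : ℕ) :
    (i, j) ∈ allQueries (fun t => (ρ t : ℕ)) l ↔
      ∃ T ∈ sampledSets ρ 0 l, i ∈ T.image Fin.val ∧ j ∈ T.image Fin.val := by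
  simp [allQueries, sampledSets_eq_map, mem_blockQueries]

/-- A power of `2` that is polynomial in `1 / x` has a logarithmic exponent. -/
lemma le_log_of_two_pow_le {a : ℕ} {x : ℝ} {c d : ℕ} (hx : 0 < x) (hx1 : x ≤ 1)
    (h : (2 : ℝ) ^ a ≤ 2 ^ c * (1 / x) ^ d) : (a : ℝ) ≤ c + 2 * d * Real.log (1 / x) := by
  have h2 := Real.log_two_gt_d9
  have hl : 0 ≤ Real.log (1 / x) := Real.log_nonneg (by rw [le_div_iff₀ hx]; linarith)
  have h1 := Real.log_le_log (by positivity) h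
  rw [Real.log_mul (by positivity) (by positivity), Real.log_pow, Real.log_pow, Real.log_pow] at h1
  have hd : 0 ≤ (d : ℝ) * Real.log (1 / x) := by positivity
  by_contra hlt
  push Not at hlt
  nlinarith

/-- No scale costs more than the last one, up to a constant. -/
lemma scale_cost_le {ω C : ℝ} (hω : 2 ≤ ω) (hC : 1 ≤ C) {J j : ℕ} (hj : j ≤ J) (N : ℕ) :
    256000 * (J + 1) * 4 ^ (J - j) * (61 * (2 * 2 ^ j) ^ 2 * (N + 1)
        + N * (C * ((2 * 2 ^ j : ℕ) : ℝ) ^ ω) + 2) + 8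
      ≤ 16640000 * C * (J + 1) * (N + 1) * (2 * 2 ^ J : ℝ) ^ ω := by
  set k : ℝ := 2 * 2 ^ j with hk
  have hcast : ((2 * 2 ^ j : ℕ) : ℝ) = k := by push_cast; rfl
  have h2j : (1 : ℝ) ≤ 2 ^ j := one_le_pow₀ (by norm_num)
  have hk1 : 1 ≤ k := by linarith
  have hJN : (0 : ℝ) ≤ N := N.cast_nonneg
  have hJ0 : (0 : ℝ) ≤ J := J.cast_nonneg
  have hp1 : 1 ≤ k ^ ω := Real.one_le_rpow hk1 (by linarith)
  have hp2 : k ^ 2 ≤ k ^ ω := by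
    rw [← Real.rpow_natCast]
    exact Real.rpow_le_rpow_of_exponent_le hk1 (by exact_mod_cast hω)
  have hfac : (4 : ℝ) ^ (J - j) * k ^ ω ≤ (2 * 2 ^ J) ^ ω := by
    have h1 : (2 * 2 ^ J : ℝ) = 2 ^ (J - j) * k := by
      have : (2 : ℝ) ^ J = 2 ^ (J - j) * 2 ^ j := by rw [← pow_add, Nat.sub_add_cancel hj]
      rw [this, hk]
      ring
    have h2 : (4 : ℝ) ^ (J - j) ≤ ((2 : ℝ) ^ (J - j)) ^ ω := by
      have h3 : (4 : ℝ) ^ (J - j) = ((2 : ℝ) ^ (J - j)) ^ (2 : ℝ) := by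
        rw [Real.rpow_two, ← pow_mul, mul_comm, pow_mul]
        norm_num
      rw [h3]
      exact Real.rpow_le_rpow_of_exponent_le (one_le_pow₀ (by norm_num)) hω
    rw [h1, Real.mul_rpow (x := 2 ^ (J - j)) (y := k) (by positivity) (by positivity)]
    exact mul_le_mul_of_nonneg_right h2 (by positivity)
  have hin : 61 * k ^ 2 * (N + 1) + N * (C * k ^ ω) + 2 ≤ 64 * C * (N + 1) * k ^ ω := by
    have e1 : 61 * k ^ 2 * (N + 1) ≤ 61 * k ^ ω * (N + 1) := by gcongr
    have e2 : (N + 1 : ℝ) * k ^ ω ≤ C * ((N + 1) * k ^ ω) :=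
      le_mul_of_one_le_left (by positivity) hC
    have e3 : 1 ≤ (N + 1 : ℝ) * k ^ ω := by nlinarith
    have e4 : N * (C * k ^ ω) ≤ C * ((N + 1) * k ^ ω) := by nlinarith
    linarith
  have hZ : (1 : ℝ) ≤ (2 * 2 ^ J) ^ ω := by
    refine Real.one_le_rpow ?_ (by linarith)
    have : (1 : ℝ) ≤ 2 ^ J := one_le_pow₀ (by norm_num)
    linarith
  have hone : 1 ≤ C * (J + 1) * (N + 1) * (2 * 2 ^ J : ℝ) ^ ω := by
    have a1 : 1 ≤ C * (J + 1) := one_le_mul_of_one_le_of_one_le hC (by linarith)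
    have a2 := one_le_mul_of_one_le_of_one_le a1 (show (1 : ℝ) ≤ N + 1 by linarith)
    exact one_le_mul_of_one_le_of_one_le a2 hZ
  have h5 : 256000 * (J + 1) * 4 ^ (J - j) * (61 * k ^ 2 * (N + 1) + N * (C * k ^ ω) + 2)
      ≤ 256000 * (J + 1) * 4 ^ (J - j) * (64 * C * (N + 1) * k ^ ω) := by gcongr
  have h6 : 256000 * (J + 1) * (64 * C * (N + 1)) * (4 ^ (J - j) * k ^ ω)
      ≤ 256000 * (J + 1) * (64 * C * (N + 1)) * (2 * 2 ^ J) ^ ω := by gcongr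
  rw [hcast]
  linarith

/-- The number of steps of the whole program. -/
lemma total_cost_le {ω C : ℝ} (hω : 2 ≤ ω) (hC : 1 ≤ C) (J N : ℕ) :
    ∑ j ∈ range (J + 1), (256000 * (J + 1) * 4 ^ (J - j) * (61 * (2 * 2 ^ j) ^ 2 * (N + 1)
        + N * (C * ((2 * 2 ^ j : ℕ) : ℝ) ^ ω) + 2) + 8) + (4 * J + 8 * 2 ^ J + 28)
      ≤ 16640100 * C * (J + 1) ^ 2 * (N + 1) * (2 * 2 ^ J : ℝ) ^ ω := by
  have h1 := Finset.sum_le_sum fun j (hj : j ∈ range (J + 1)) =>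
    scale_cost_le hω hC (Nat.lt_succ_iff.1 (mem_range.1 hj)) N
  rw [Finset.sum_const, card_range, nsmul_eq_mul] at h1
  have hJ0 : (0 : ℝ) ≤ J := J.cast_nonneg
  have hN0 : (0 : ℝ) ≤ N := N.cast_nonneg
  have h2J : (1 : ℝ) ≤ 2 ^ J := one_le_pow₀ (by norm_num)
  have hZ : (2 ^ J : ℝ) ≤ (2 * 2 ^ J) ^ ω := by
    calc (2 ^ J : ℝ) ≤ (2 * 2 ^ J : ℝ) ^ (1 : ℝ) := by rw [Real.rpow_one]; linarith
      _ ≤ _ := Real.rpow_le_rpow_of_exponent_le (by linarith) (by linarith)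
  have h3 : (J + 1) * (2 * 2 ^ J : ℝ) ^ ω ≤ C * (J + 1) ^ 2 * (N + 1) * (2 * 2 ^ J : ℝ) ^ ω := by
    refine mul_le_mul_of_nonneg_right ?_ (by linarith)
    have a1 : (J + 1 : ℝ) ≤ C * (J + 1) ^ 2 := by nlinarith
    nlinarith
  have h4 : 4 * J + 8 * 2 ^ J + 28 ≤ 100 * ((J + 1) * (2 * 2 ^ J : ℝ) ^ ω) := by
    have a1 : (J + 1 : ℝ) ≤ (J + 1) * (2 * 2 ^ J : ℝ) ^ ω := by nlinarith
    have a2 : (2 * 2 ^ J : ℝ) ^ ω ≤ (J + 1) * (2 * 2 ^ J : ℝ) ^ ω := by nlinarith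
    linarith
  push_cast at h1 ⊢
  linarith

/-- The constant in front of all cost bounds. -/
noncomputable def costConst (ω C : ℝ) : ℝ := 10 ^ 12 + 2 * 10 ^ 10 * C * (128 : ℝ) ^ ω

/-- The number `J + 1` of scales and the number `N + 1` of squarings, as the program finds them, are
logarithmic in `1 / ε`. -/
lemma exists_parameters {ε : ℝ} (hε : 0 < ε) (hε1 : ε ≤ 1) : ∃ J N : ℕ,
    (∀ i < J, ε * 2 ^ i < 32) ∧ 32 ≤ ε * 2 ^ J ∧
    (∀ i < N + 1, (2 : ℝ) ^ i < 8 * 4 ^ J / ε) ∧ 8 * 4 ^ J / ε ≤ 2 ^ (N + 1) ∧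
    (2 : ℝ) ^ J ≤ 64 * (1 / ε) ∧ (J + 1 : ℝ) ≤ 7 * (1 + Real.log (1 / ε)) ∧
    ((N + 1 : ℕ) + 1 : ℝ) ≤ 17 * (1 + Real.log (1 / ε)) := by
  classical
  have hl : 0 ≤ Real.log (1 / ε) := Real.log_nonneg (by rw [le_div_iff₀ hε]; linarith)
  have hex (x : ℝ) : ∃ J : ℕ, x ≤ 2 ^ J := by
    obtain ⟨J, hJ⟩ := pow_unbounded_of_one_lt x (show (1 : ℝ) < 2 by norm_num)
    exact ⟨J, hJ.le⟩
  have hexJ : ∃ J : ℕ, 32 ≤ ε * 2 ^ J := by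
    obtain ⟨J, hJ⟩ := hex (32 / ε)
    exact ⟨J, by rwa [div_le_iff₀ hε, mul_comm] at hJ⟩
  obtain ⟨J, hJ, hJlt⟩ : ∃ J : ℕ, 32 ≤ ε * 2 ^ J ∧ ∀ i < J, ε * 2 ^ i < 32 :=
    ⟨Nat.find hexJ, Nat.find_spec hexJ, fun i hi => not_le.1 (Nat.find_min hexJ hi)⟩
  have hJ0 : J ≠ 0 := by
    rintro rfl
    rw [pow_zero] at hJ
    linarith
  obtain ⟨J', rfl⟩ := Nat.exists_eq_succ_of_ne_zero hJ0
  have hJ2 : (2 : ℝ) ^ (J' + 1) ≤ 64 * (1 / ε) := by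
    have h1 := hJlt J' (Nat.lt_succ_self _)
    rw [mul_one_div, le_div_iff₀ hε, pow_succ]
    linarith
  obtain ⟨N, hN, hNlt⟩ : ∃ N : ℕ, 8 * 4 ^ (J' + 1) / ε ≤ 2 ^ N ∧
      ∀ i < N, (2 : ℝ) ^ i < 8 * 4 ^ (J' + 1) / ε :=
    ⟨Nat.find (hex _), Nat.find_spec (hex _), fun i hi => not_le.1 (Nat.find_min (hex _) hi)⟩
  have hN0 : N ≠ 0 := by
    rintro rfl
    rw [pow_zero, div_le_iff₀ hε] at hN
    have : (1 : ℝ) ≤ 4 ^ (J' + 1) := one_le_pow₀ (by norm_num)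
    linarith
  obtain ⟨N', rfl⟩ := Nat.exists_eq_succ_of_ne_zero hN0
  refine ⟨J' + 1, N', hJlt, hJ, hNlt, hN, hJ2, ?_, ?_⟩
  · have h1 := le_log_of_two_pow_le (a := J' + 1) (c := 6) (d := 1) hε hε1
      (by rw [pow_one]; norm_num at hJ2 ⊢; exact hJ2)
    push_cast at h1 ⊢
    linarith
  · have h1 := (hNlt N' (Nat.lt_succ_self _)).le
    have h4 : (4 : ℝ) ^ (J' + 1) = (2 ^ (J' + 1)) ^ 2 := by
      rw [← pow_mul, mul_comm, pow_mul]; norm_num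
    have h2 : 8 * 4 ^ (J' + 1) / ε ≤ 2 ^ 15 * (1 / ε) ^ 3 := by
      calc 8 * 4 ^ (J' + 1) / ε = 8 * (2 ^ (J' + 1)) ^ 2 * (1 / ε) := by rw [h4]; ring
        _ ≤ 8 * (64 * (1 / ε)) ^ 2 * (1 / ε) := by gcongr
        _ = 2 ^ 15 * (1 / ε) ^ 3 := by ring
    have h3 := le_log_of_two_pow_le hε hε1 (h1.trans h2)
    push_cast at h3 ⊢
    linarith

end PSDTest

open PSDTest

theorem theorem3 (ω : ℝ) (hω : PSDTest.IsMatMulExponent ω) :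
    ∃ (P : PSDTest.Prog) (C : ℝ) (c : ℕ),
      ∀ (n : ℕ) (ε : ℝ), 1 ≤ n → 0 < ε → ε ≤ 1 →
        -- the sizes of the random principal submatrices, and the positions that are queried:
        -- they are fixed before the matrix is known
        ∃ (sizes : List ℕ) (Q : (ℕ → Fin n) → List (ℕ × ℕ)),
          (sizes.toFinset.card : ℝ) ≤ C * (1 + Real.log (1 / ε)) ∧
          (∀ (ρ : ℕ → Fin n) (i j : ℕ), (i, j) ∈ Q ρ ↔
            ∃ T ∈ PSDTest.sampledSets ρ 0 sizes,
              i ∈ T.image Fin.val ∧ j ∈ T.image Fin.val) ∧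
          (∀ ρ : ℕ → Fin n,
            ((Q ρ).length : ℝ) ≤ C * (1 + Real.log (1 / ε)) ^ c * (1 / ε) ^ 2) ∧
          ∀ A : Matrix (Fin n) (Fin n) ℝ, (∀ i j, |A i j| ≤ 1) →
            -- every run: termination, non-adaptivity, time, output
            (∀ ρ : ℕ → Fin n, ∃ s : PSDTest.State, PSDTest.Run P ε A ρ s ∧
              s.queries = Q ρ ∧
              (s.time : ℝ) ≤ C * (1 + Real.log (1 / ε)) ^ c * (1 / ε) ^ ω ∧
              (s.SaysPSD ∨ s.SaysNotPSD) ∧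
              (PSDTest.IsPSD A → s.SaysPSD) ∧
              (s.SaysNotPSD → ∃ T ∈ PSDTest.sampledSets ρ 0 sizes,
                s.certificate = T.image Fin.val ∧
                ¬ PSDTest.IsPSD (PSDTest.principal A T))) ∧
            -- matrices that are far from positive semi-definite are rejected
            ((∃ x : Fin n → ℝ, ∑ i, x i ^ 2 ≤ 1 ∧ x ⬝ᵥ A.mulVec x ≤ -(ε * n)) →
              ENNReal.ofReal (3 / 4) ≤ PSDTest.uniformIndices n
                {ρ | ∃ s : PSDTest.State, PSDTest.Run P ε A ρ s ∧ s.SaysNotPSD}) := by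
  obtain ⟨M, C₀, hA, hM⟩ := hω
  have hω2 := two_le_of_matMul hM
  obtain ⟨b, hb⟩ := M.exists_local
  have hloc : M.Local (max 3 b) (max 3 b) := hb.mono (le_max_right _ _) (le_max_right _ _)
  have hC : (1 : ℝ) ≤ max C₀ 1 := le_max_right _ _
  have hmul (k : ℕ) (hk : 1 ≤ k) : Multiplies M k (max C₀ 1 * (k : ℝ) ^ ω) := fun O ρ s hs => by
    obtain ⟨s', h1, h2, h3⟩ := hM O ρ k s hk hs
    have h4 : C₀ * (k : ℝ) ^ ω ≤ max C₀ 1 * (k : ℝ) ^ ω :=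
      mul_le_mul_of_nonneg_right (le_max_left _ _) (by positivity)
    exact ⟨s', h1, by linarith, h3⟩
  set B := max 3 b with hBdef
  have hB : 3 ≤ B := le_max_left _ _
  set C := max C₀ 1 with hCdef
  have hpos : 0 ≤ 2 * 10 ^ 10 * C * (128 : ℝ) ^ ω := by positivity
  refine ⟨testerProg B M, costConst ω C, 3, fun n ε hn hε hε1 => ?_⟩
  have : NeZero n := ⟨by omega⟩
  obtain ⟨J, N, hJlt, hJle, hNlt, hNle, hJ2, hJL, hNL⟩ := exists_parameters hε hε1
  set L := 1 + Real.log (1 / ε) with hL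
  have h1ε : 1 ≤ 1 / ε := by rw [le_div_iff₀ hε]; linarith
  have hL1 : 1 ≤ L := by have := Real.log_nonneg h1ε; linarith
  have hrun (A : Matrix (Fin n) (Fin n) ℝ) (ρ : ℕ → Fin n) := triple_testerProg (O := oracle A)
    (ρ := fun t => (ρ t : ℕ)) hB hloc hA hmul hJlt hJle hNlt hNle (init n ε)
    ⟨by simp [State.mem, init], rfl, rfl⟩
  refine ⟨sizes J, fun ρ => allQueries (fun t => (ρ t : ℕ)) (sizes J), ?_,
    fun ρ i j => mem_allQueries ρ _ i j, fun ρ => ?_, fun A hA1 => ⟨fun ρ => ?_, ?_⟩⟩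
  · have h1 : ((sizes J).toFinset.card : ℝ) ≤ J + 1 := by
      exact_mod_cast card_toFinset_sizes_le J
    rw [costConst]
    nlinarith
  · rw [length_allQueries, sum_sq_sizes]
    have h4 : (4 : ℝ) ^ J = (2 ^ J) ^ 2 := by rw [← pow_mul, mul_comm, pow_mul]; norm_num
    push_cast
    calc 1024000 * ((J : ℝ) + 1) ^ 2 * 4 ^ J
        ≤ 1024000 * (7 * L) ^ 2 * (64 * (1 / ε)) ^ 2 := by rw [h4]; gcongr
      _ = 205520896000 * L ^ 2 * (1 / ε) ^ 2 := by ring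
      _ ≤ costConst ω C * L ^ 3 * (1 / ε) ^ 2 := by
        have h5 : L ^ 2 ≤ L ^ 3 := pow_le_pow_right₀ hL1 (by norm_num)
        have h6 : 205520896000 ≤ costConst ω C := by rw [costConst]; linarith
        gcongr
  · obtain ⟨s, h1, h2, h3, h4⟩ := hrun A ρ
    refine ⟨s, h1, h3, ?_, ?_, fun hpsd => ?_, fun hnot => ?_⟩
    · rw [show (init n ε).time = 0 from rfl, Nat.cast_zero, zero_add] at h2
      refine h2.trans ((total_cost_le hω2 hC J (N + 1)).trans ?_)
      calc 16640100 * C * ((J : ℝ) + 1) ^ 2 * (((N + 1 : ℕ) : ℝ) + 1) * (2 * 2 ^ J : ℝ) ^ ω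
          ≤ 16640100 * C * (7 * L) ^ 2 * (17 * L) * (2 * (64 * (1 / ε))) ^ ω := by
            have : 0 ≤ ω := by linarith
            gcongr
        _ = 16640100 * 833 * C * (128 : ℝ) ^ ω * L ^ 3 * (1 / ε) ^ ω := by
            rw [show 2 * (64 * (1 / ε)) = 128 * (1 / ε) by ring,
              Real.mul_rpow (by norm_num) (by positivity)]
            ring
        _ ≤ costConst ω C * L ^ 3 * (1 / ε) ^ ω := by
            have h6 : 16640100 * 833 * C * (128 : ℝ) ^ ω ≤ costConst ω C := by
              rw [costConst]
              nlinarith [show 0 ≤ C * (128 : ℝ) ^ ω by positivity]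
            gcongr
    · exact h4.imp (fun h => h.1) fun ⟨_, _, _, h, _⟩ => h
    · rcases h4 with h4 | ⟨b, hb, h5, -⟩
      · exact h4.1
      · exact absurd h5 (not_detects_of_isPSD hA1 hpsd _ (fun a => ρ (b.1 + a))
          (pos_of_mem_sizes (snd_mem_of_mem_blocks hb)))
    · rcases h4 with h4 | ⟨b, hb, h5, -, h6, h7⟩
      · exact absurd (h4.1.symm.trans hnot) (by norm_num)
      · refine ⟨(Finset.range b.2).image fun a => ρ (b.1 + a), ?_, ?_,
          not_isPSD_principal_of_detects hA1 (pos_of_mem_sizes (snd_mem_of_mem_blocks hb)) h5⟩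
        · rw [sampledSets_eq_map]
          exact List.mem_map_of_mem hb
        · rw [State.certificate, show s.nreg 1 = b.2 from h6, Finset.image_image]
          exact Finset.image_congr fun a ha => h7 a (by simpa using ha)
  · rintro ⟨x, hx, hx'⟩
    refine (le_uniformIndices_detects hA1 hε hε1 hx hx' hJle hNle).trans
      (MeasureTheory.measure_mono ?_)
    rintro ρ ⟨b, hb, h5⟩
    obtain ⟨s, h1, -, -, h4⟩ := hrun A ρ
    refine ⟨s, h1, ?_⟩
    rcases h4 with h4 | ⟨_, _, _, h4, _⟩
    · exact absurd h5 (h4.2 b hb)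
    · exact h4
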